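/- Let $d\ge 1$, $\alpha>0$, $1/2<H<1$, $\alpha_H=H(2H-1)$, and let $p_t(x)=(2\pi t)^{-d/2}e^{-|x|^2/(2t)}$ on $\mathbb{R}^d$. Consider the following kernels of order $\alpha$ on $\mathbb{R}^d$: the Riesz kernel ($\alpha<d$) $f(x)=\frac{\Gamma((d-\alpha)/2)\,2^{-\alpha}\pi^{-d/2}}{\Gamma(\alpha/2)}|x|^{-d+\alpha}$; the Bessel kernel $f(x)=\kappa\int_0^\infty w^{(\alpha-d)/2-1}e^{-w}e^{-|x|^2/(4w)}\,dw$, with any normalising constant $\kappa>0$; the heat kernel $f(x)=(2\pi\alpha)^{-d/2}e^{-|x|^2/(2\alpha)}$; the Poisson kernel $f(x)=\pi^{-(d+1)/2}\Gamma((d+1)/2)\,\alpha\,(|x|^2+\alpha^2)^{-(d+1)/2}$. Let $J_f(u,v,y,z)=\int_{\mathbb{R}^d}\int_{\mathbb{R}^d}p_u(x-y)p_v(x'-z)f(x-x')\,dx\,dx'$ and $\Phi(x,a)=\sum_{n\ge0}x^n/(n!)^a\in[0,\infty]$. For $t,\gamma>0$, let $\eta:[0,t]^2\to\mathbb{R}_+$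 be measurable with $\eta(r,s)\le\gamma|r-s|^{2H-2}$ for all $r\ne s$ in $[0,t]$; let $B^1,B^2$ be independent standard $d$-dimensional Brownian motions on a probability space, and put $$L_{t,\varepsilon}(\eta)=\int_0^t\int_0^t\int_{\mathbb{R}^d}\eta(r,s)\,p_\varepsilon(B^1_r-B^2_s-y)\,f(y)\,dy\,dr\,ds,\qquad \varepsilon>0 .$$ There exists $\beta_H>0$ such that, for all measurable $\varphi:(0,\infty)\to[0,\infty]$, $$\alpha_H\int_0^\infty\int_0^\infty\varphi(s)\varphi(r)|r-s|^{2H-2}\,dr\,ds\le\beta_H^2\Big(\int_0^\infty\varphi(s)^{1/H}ds\Big)^{2H}. \qquad (1)$$ (i) Suppose $\alpha<d\le 2+\alpha$. There is a constant $C^*=C^*_{H,d,\alpha}>0$, depending only on $H,d,\alpha$, such that the following holds whenever $f$ is the Riesz kernel or a Bessel kernel of order $\alpha$. There exists $D_{\alpha,d}>0$ such that $$J_f(u,v,y,z)\le D_{\alpha,d}(u+v)^{-(d-\alpha)/2}\quad\text{for all }u,v>0,\ y,z\in\mathbb{R}^d. \qquad (2)$$ For all $t,\gamma,\eta,B^1,B^2$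 as above, the integral $L_{t,\varepsilon}(\eta)$ converges absolutely almost surely for every $\varepsilon>0$, and, as $\varepsilon\downarrow0$, $L_{t,\varepsilon}(\eta)$ converges to one and the same random variable $L_t(\eta)$ in $L^p(\Omega)$ for every $1\le p<\infty$. Moreover, for all constants $\beta_H>0$ satisfying (1) and $D_{\alpha,d}>0$ satisfying (2), and for all $\lambda>0$, $$\sup_{\varepsilon>0}E\big[e^{\lambda L_{t,\varepsilon}(\eta)}\big]\le C^*\,\Phi\Big(\lambda D(t),\,1-\tfrac{d-\alpha}{2}\Big),$$ where $$D(t)=D_{\alpha,d}2^{-(d-\alpha)/2}\frac{\gamma}{\alpha_H}\beta_H^2\,\Gamma\Big(1-\frac{d-\alpha}{4H}\Big)^{2H}\Big(1-\frac{d-\alpha}{4H}\Big)^{-[2H-(d-\alpha)/2]}t^{2H-(d-\alpha)/2},$$ and the right-hand side is finite for all $0<\lambda<\lambda_0(t)$, where $\lambda_0(t)=\infty$ if $d<2+\alpha$ and $$\lambda_0(t)=\Big(1-\frac1{2H}\Big)^{2H-1}D_{\alpha,d}^{-1}\,2\,\alpha_H\,\gamma^{-1}\beta_H^{-2}\,\Gamma\Big(1-\frac1{2H}\Big)^{-2H}t^{1-2H}\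 \big(=1/D(t)\big)\quad\text{if }d=2+\alpha .$$ (ii) Let $f$ be the heat kernel or the Poisson kernel of order $\alpha$. There exists $C_{\alpha,d}>0$ such that $$J_f(u,v,y,z)\le C_{\alpha,d}\quad\text{for all }u,v>0,\ y,z\in\mathbb{R}^d. \qquad (3)$$ For all $t,\gamma,\eta,B^1,B^2$ as above, the integral $L_{t,\varepsilon}(\eta)$ converges absolutely almost surely for every $\varepsilon>0$, and, as $\varepsilon\downarrow0$, $L_{t,\varepsilon}(\eta)$ converges to one and the same random variable $L_t(\eta)$ in $L^p(\Omega)$ for every $1\le p<\infty$. Moreover, for every $C_{\alpha,d}>0$ satisfying (3) and every $\lambda>0$, $$\sup_{\varepsilon>0}E\big[e^{\lambda L_{t,\varepsilon}(\eta)}\big]\le e^{\lambda C(t)},\qquad C(t)=C_{\alpha,d}\,\gamma\,t^{2H}/\alpha_H .$$ -/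

import Mathlib

open MeasureTheory ProbabilityTheory Filter Set
open scoped NNReal ENNReal Topology

noncomputable section

namespace ConvolutedLocalTime

/-- The constant `H (2H - 1)`. -/
def alphaH (H : ℝ) : ℝ := H * (2 * H - 1)

/-- The Gaussian heat density `p_t(x) = (2πt)^{-d/2} exp(-|x|²/(2t))`. -/
def heatDensity (d : ℕ) (t : ℝ) (x : EuclideanSpace ℝ (Fin d)) : ℝ :=
  (2 * Real.pi * t) ^ (-((d : ℝ) / 2)) * Real.exp (-‖x‖ ^ 2 / (2 * t))

/-! ### The four spatial kernels -/

/-- Riesz kernel of order `α` (`0 < α < d`). -/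
def rieszKernel (d : ℕ) (α : ℝ) (x : EuclideanSpace ℝ (Fin d)) : ℝ :=
  Real.Gamma (((d : ℝ) - α) / 2) * 2 ^ (-α) * Real.pi ^ (-((d : ℝ) / 2)) / Real.Gamma (α / 2)
    * ‖x‖ ^ (-(d : ℝ) + α)

/-- Bessel kernel of order `α`, with normalising constant `κ`. -/
def besselKernel (d : ℕ) (α κ : ℝ) (x : EuclideanSpace ℝ (Fin d)) : ℝ :=
  κ * ∫ w in Ioi (0 : ℝ),
    w ^ ((α - (d : ℝ)) / 2 - 1) * Real.exp (-w) * Real.exp (-‖x‖ ^ 2 / (4 * w))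

/-- Heat kernel of order `α`. -/
def heatKernel (d : ℕ) (α : ℝ) (x : EuclideanSpace ℝ (Fin d)) : ℝ :=
  (2 * Real.pi * α) ^ (-((d : ℝ) / 2)) * Real.exp (-‖x‖ ^ 2 / (2 * α))

/-- Poisson kernel of order `α`. -/
def poissonKernel (d : ℕ) (α : ℝ) (x : EuclideanSpace ℝ (Fin d)) : ℝ :=
  Real.pi ^ (-(((d : ℝ) + 1) / 2)) * Real.Gamma (((d : ℝ) + 1) / 2) * α
    * (‖x‖ ^ 2 + α ^ 2) ^ (-(((d : ℝ) + 1) / 2))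

/-- `f` is the Riesz kernel of order `α`, or a Bessel kernel of order `α`
(with an arbitrary positive normalising constant). -/
def IsRieszOrBessel (d : ℕ) (α : ℝ) (f : EuclideanSpace ℝ (Fin d) → ℝ) : Prop :=
  f = rieszKernel d α ∨ ∃ κ : ℝ, 0 < κ ∧ f = besselKernel d α κ

/-- `f` is the heat kernel or the Poisson kernel of order `α`. -/
def IsHeatOrPoisson (d : ℕ) (α : ℝ) (f : EuclideanSpace ℝ (Fin d) → ℝ) : Prop :=
  f = heatKernel d α ∨ f = poissonKernel d α

/-! ### The constants `D_{α,d}`, `C_{α,d}` and `β_H` -/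

/-- `J_f(u,v,y,z) = ∫∫ p_u(x - y) p_v(x' - z) f(x - x') dx dx'`, for `f ≥ 0`. -/
def kernelEnergy (d : ℕ) (f : EuclideanSpace ℝ (Fin d) → ℝ) (u v : ℝ)
    (y z : EuclideanSpace ℝ (Fin d)) : ℝ≥0∞ :=
  ∫⁻ x' : EuclideanSpace ℝ (Fin d), ∫⁻ x : EuclideanSpace ℝ (Fin d),
    ENNReal.ofReal (heatDensity d u (x - y) * heatDensity d v (x' - z) * f (x - x'))

/-- `D` is a positive constant with `J_f(u,v,y,z) ≤ D (u+v)^{-(d-α)/2}` for all `u, v > 0`. -/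
def IsRoughKernelConst (d : ℕ) (α : ℝ) (f : EuclideanSpace ℝ (Fin d) → ℝ) (D : ℝ) : Prop :=
  0 < D ∧ ∀ u v : ℝ, 0 < u → 0 < v → ∀ y z : EuclideanSpace ℝ (Fin d),
    kernelEnergy d f u v y z ≤ ENNReal.ofReal (D * (u + v) ^ (-(((d : ℝ) - α) / 2)))

/-- `K` is a positive constant with `J_f(u,v,y,z) ≤ K` for all `u, v > 0`. -/
def IsSmoothKernelConst (d : ℕ) (f : EuclideanSpace ℝ (Fin d) → ℝ) (K : ℝ) : Prop :=
  0 < K ∧ ∀ u v : ℝ, 0 < u → 0 < v → ∀ y z : EuclideanSpace ℝ (Fin d),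
    kernelEnergy d f u v y z ≤ ENNReal.ofReal K

/-- `β` is a positive constant such that, for all `φ` on `(0,∞)`,
`α_H ∫∫ φ(s) φ(r) |r-s|^{2H-2} dr ds ≤ β² (∫ |φ|^{1/H})^{2H}`. (As the weight is nonnegative,
nonnegative `φ` suffice; for these both sides are meaningful in `[0,∞]`.) -/
def IsTimeConst (H β : ℝ) : Prop :=
  0 < β ∧ ∀ φ : ℝ → ℝ≥0∞, Measurable φ →
    ENNReal.ofReal (alphaH H) * (∫⁻ s in Ioi (0 : ℝ), ∫⁻ r in Ioi (0 : ℝ),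
        φ s * φ r * ENNReal.ofReal (|r - s| ^ (2 * H - 2)))
      ≤ ENNReal.ofReal (β ^ 2) * (∫⁻ s in Ioi (0 : ℝ), φ s ^ (1 / H)) ^ (2 * H)

/-- `Φ(x,a) = ∑ₙ xⁿ / (n!)^a`, with value in `[0,∞]`. -/
def seriesPhi (x a : ℝ) : ℝ≥0∞ :=
  ∑' n : ℕ, ENNReal.ofReal (x ^ n / (n.factorial : ℝ) ^ a)

/-- The quantity `D(t)`, as a function of the constants `D = D_{α,d}` and `β = β_H`. -/
def growthConst (d : ℕ) (α H γ D β t : ℝ) : ℝ :=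
  D * 2 ^ (-(((d : ℝ) - α) / 2)) * (γ / alphaH H) * β ^ 2
    * Real.Gamma (1 - ((d : ℝ) - α) / (4 * H)) ^ (2 * H)
    * (1 - ((d : ℝ) - α) / (4 * H)) ^ (-(2 * H - ((d : ℝ) - α) / 2))
    * t ^ (2 * H - ((d : ℝ) - α) / 2)

/-- The critical parameter `λ₀(t)`: finite for `d = 2 + α`, infinite otherwise. -/
def lambdaZero (d : ℕ) (α H γ D β t : ℝ) : ℝ≥0∞ :=
  open Classical in
  if (d : ℝ) = 2 + α then
    ENNReal.ofReal ((1 - 1 / (2 * H)) ^ (2 * H - 1) * D⁻¹ * 2 * alphaH H * γ⁻¹ * β ^ (-2 : ℝ)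
      * Real.Gamma (1 - 1 / (2 * H)) ^ (-(2 * H)) * t ^ (1 - 2 * H))
  else ⊤

/-! ### Brownian motions and the approximate local time -/

/-- `B` is a standard `d`-dimensional Brownian motion: its coordinates are independent standard
real Brownian motions (with almost surely continuous paths). -/
structure IsStdBrownian {Ω : Type*} [MeasurableSpace Ω] (P : Measure Ω) (d : ℕ)
    (B : ℝ≥0 → Ω → EuclideanSpace ℝ (Fin d)) : Prop where
  coord : ∀ i : Fin d, IsBrownianReal (fun t ω => B t ω i) P
  indep : iIndepFun (fun (i : Fin d) (ω : Ω) (t : ℝ≥0) => B t ω i) P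

/-- `B¹` and `B²` are independent standard `d`-dimensional Brownian motions. -/
structure IsIndepBrownianPair {Ω : Type*} [MeasurableSpace Ω] (P : Measure Ω) (d : ℕ)
    (B₁ B₂ : ℝ≥0 → Ω → EuclideanSpace ℝ (Fin d)) : Prop where
  left : IsStdBrownian P d B₁
  right : IsStdBrownian P d B₂
  indep : IndepFun (fun (ω : Ω) (t : ℝ≥0) => B₁ t ω) (fun (ω : Ω) (t : ℝ≥0) => B₂ t ω) P

/-- `η` is measurable, nonnegative on `[0,t]²`, and `η(r,s) ≤ γ |r-s|^{2H-2}` there. Since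
`2H - 2 < 0`, the bound is void (right side `+∞`) on the diagonal. -/
structure IsWeight (H γ t : ℝ) (η : ℝ → ℝ → ℝ) : Prop where
  measurable : Measurable (fun q : ℝ × ℝ => η q.1 q.2)
  nonneg : ∀ r ∈ Icc 0 t, ∀ s ∈ Icc 0 t, 0 ≤ η r s
  bound : ∀ r ∈ Icc 0 t, ∀ s ∈ Icc 0 t, r ≠ s → η r s ≤ γ * |r - s| ^ (2 * H - 2)

/-- The integrand `η(r,s) p_ε(B¹_r - B²_s - y) f(y)`. -/
def integrand {Ω : Type*} (d : ℕ) (f : EuclideanSpace ℝ (Fin d) → ℝ) (η : ℝ → ℝ → ℝ)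
    (B₁ B₂ : ℝ≥0 → Ω → EuclideanSpace ℝ (Fin d)) (ε : ℝ) (ω : Ω) (r s : ℝ)
    (y : EuclideanSpace ℝ (Fin d)) : ℝ :=
  η r s * heatDensity d ε (B₁ r.toNNReal ω - B₂ s.toNNReal ω - y) * f y

/-- `L_{t,ε}(η) = ∫₀ᵗ ∫₀ᵗ ∫_{ℝᵈ} η(r,s) p_ε(B¹_r - B²_s - y) f(y) dy dr ds`. -/
def approxLocalTime {Ω : Type*} (d : ℕ) (f : EuclideanSpace ℝ (Fin d) → ℝ) (η : ℝ → ℝ → ℝ)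
    (B₁ B₂ : ℝ≥0 → Ω → EuclideanSpace ℝ (Fin d)) (t ε : ℝ) (ω : Ω) : ℝ :=
  ∫ s in (0 : ℝ)..t, ∫ r in (0 : ℝ)..t, ∫ y : EuclideanSpace ℝ (Fin d),
    integrand d f η B₁ B₂ ε ω r s y

/-- The triple integral defining `L_{t,ε}(η)` converges absolutely, almost surely,
for every `ε > 0`. -/
def ApproxWellDefined {Ω : Type*} [MeasurableSpace Ω] (P : Measure Ω) (d : ℕ)
    (f : EuclideanSpace ℝ (Fin d) → ℝ) (η : ℝ → ℝ → ℝ)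
    (B₁ B₂ : ℝ≥0 → Ω → EuclideanSpace ℝ (Fin d)) (t : ℝ) : Prop :=
  ∀ ε : ℝ, 0 < ε → ∀ᵐ ω ∂P,
    Integrable (fun q : (ℝ × ℝ) × EuclideanSpace ℝ (Fin d) =>
        integrand d f η B₁ B₂ ε ω q.1.1 q.1.2 q.2)
      (((volume : Measure (ℝ × ℝ)).restrict (Icc 0 t ×ˢ Icc 0 t)).prod volume)

/-- `X_ε` converges as `ε ↓ 0` to one random variable in `Lᵖ`, for every `1 ≤ p < ∞`. -/
def ConvergesInAllLp {Ω : Type*} [MeasurableSpace Ω] (P : Measure Ω) (X : ℝ → Ω → ℝ) : Prop :=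
  ∃ L : Ω → ℝ, ∀ p : ℝ≥0∞, 1 ≤ p → p ≠ ⊤ →
    (∀ ε : ℝ, 0 < ε → MemLp (X ε) p P) ∧ MemLp L p P ∧
    Tendsto (fun ε : ℝ => eLpNorm (fun ω => X ε ω - L ω) p P) (𝓝[>] 0) (𝓝 0)

/-- `sup_{ε > 0} E[exp(l X_ε)]`, with value in `[0,∞]`. -/
def supExpMoment {Ω : Type*} [MeasurableSpace Ω] (P : Measure Ω) (X : ℝ → Ω → ℝ) (l : ℝ) : ℝ≥0∞ :=
  ⨆ (ε : ℝ) (_ : 0 < ε), ∫⁻ ω, ENNReal.ofReal (Real.exp (l * X ε ω)) ∂P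

end ConvolutedLocalTime

end

/-!
Each of the four kernels `f` is a mixture `∫ p_{2w} ν(dw)` of Gaussian densities
(`IsGaussianMixture`): over a multiple of `w^{α/2-1} dw`, with an exponential factor in the Bessel
case, over a point mass for the heat kernel, and over an inverse Gamma law for the Poisson kernel.
Hence `p_ε * f` is the mixture `f_ε = ∫ p_{2w+ε} ν(dw)`, the energy `J_f(u,v,y,z)` is
`f_{u+v}(y-z)`, which is largest at `y = z`, and `L_{t,ε}` is a double time integral of
`η(r,s) f_ε(B¹_r - B²_s)` (`mixtureLocalTime`). All estimates are carried out in `[0,∞]`, for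
`ε ≥ 0`; the value at `ε = 0` is the limit.

*Moments.* As `p_{2w+ε}` is a convolution square, `f_ε` is a positive definite kernel, and in the
`n`-th moment, a `2n`-fold time integral of `E ∏ᵢ f_ε(B¹_{rᵢ} - B²_{sᵢ})`, the Cauchy–Schwarz
inequality separates the times `rᵢ` from the times `sᵢ` (`lintegral_prod_mixture_le`): the
expectation is at most the geometric mean of those of `∏ᵢ f_ε(B_{rᵢ} - B̃_{rᵢ})` and
`∏ᵢ f_ε(B_{sᵢ} - B̃_{sᵢ})`, with `B̃` an independent copy of `B`. These involve a single family of
times, which may be ordered; conditioning successively on the past bounds them by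
`∏ᵢ f_{2(rᵢ - rᵢ₋₁)}(0)` (`IsHeatMarkov.copyMoment_le`). The time inequality defining `β_H`
polarizes, its kernel `|r - s|^{2H-2}` being itself positive definite, and tensorizes by applying
it in one pair of times after the other (`lintegral_tensor_le`). There remains the Dirichlet
integral of `∏ᵢ (rᵢ - rᵢ₋₁)^{-(d-α)/(4H)}`, a quotient of Gamma functions, which the log-convexity
of `Γ` turns into a power of `n!` (`factorial_rpow_mul_le_Gamma`). The result is
`E L_{t,ε}ⁿ ≤ D(t)ⁿ (n!)^{(d-α)/2}`, and summing the exponential series gives the claim with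
`C* = 1`. For the heat and Poisson kernels `f_ε` is bounded and the exponential bound is
deterministic. The constant `β_H` exists by the Hardy–Littlewood–Sobolev inequality.

*Convergence.* By Fatou's lemma `L_{t,0} ≤ liminf L_{t,ε}` pathwise, while `E L_{t,ε} ≤ E L_{t,0}`
because `E f_ε(B¹_r - B²_s) = f_{ε+r+s}(0)` decreases in `ε`. Together these force convergence in
`L¹` (`tendsto_lintegral_of_le_liminf`), and the moment bounds, which are uniform in `ε ≥ 0`,
improve it to convergence in every `Lᵖ`. Brownian motion enters only through a jointly measurable
version and the Markov identity for Gaussian densities (`IsHeatMarkov`).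
-/

noncomputable section

namespace ConvolutedLocalTime

section

/-! ### Products of lower integrals -/

lemma lintegral_pi_succ {X : Type*} [MeasurableSpace X] (μ : Measure X) [SigmaFinite μ] (n : ℕ)
    (f : (Fin (n + 1) → X) → ℝ≥0∞) (hf : Measurable f) :
    ∫⁻ x, f x ∂(Measure.pi fun _ : Fin (n + 1) => μ) =
      ∫⁻ x₀, ∫⁻ x, f (Fin.cons x₀ x) ∂(Measure.pi fun _ : Fin n => μ) ∂μ := by
  have h := (measurePreserving_piFinSuccAbove (fun _ : Fin (n + 1) => μ) 0).symm
  rw [← h.lintegral_comp_emb (MeasurableEquiv.measurableEmbedding _), lintegral_prod]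
  · refine lintegral_congr fun x₀ => lintegral_congr fun x => ?_
    congr 1
    exact Fin.insertNth_zero' x₀ x
  · exact (hf.comp (MeasurableEquiv.measurable _)).aemeasurable

lemma lintegral_pi_zero {X : Type*} [MeasurableSpace X] (μ : Measure X) [SigmaFinite μ]
    (f : (Fin 0 → X) → ℝ≥0∞) :
    ∫⁻ x, f x ∂(Measure.pi fun _ : Fin 0 => μ) = f Fin.elim0 := by
  rw [Measure.pi_of_empty (fun _ : Fin 0 => μ) Fin.elim0, lintegral_dirac]

lemma measurable_finCons {X Y : Type*} [MeasurableSpace X] [MeasurableSpace Y] {n : ℕ}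
    {f : Y → X} {g : Y → Fin n → X} (hf : Measurable f) (hg : Measurable g) :
    Measurable fun y => (Fin.cons (f y) (g y) : Fin (n + 1) → X) := by
  rw [measurable_pi_iff]
  intro i
  refine Fin.cases ?_ (fun j => ?_) i
  · simpa using hf
  · simpa [Function.comp_def] using (measurable_pi_apply j).comp hg

lemma lintegral_pi_prod {X : Type*} [MeasurableSpace X] (μ : Measure X) [SigmaFinite μ] (n : ℕ)
    (f : Fin n → X → ℝ≥0∞) (hf : ∀ i, Measurable (f i)) :
    ∫⁻ x, ∏ i, f i (x i) ∂(Measure.pi fun _ : Fin n => μ) = ∏ i, ∫⁻ x, f i x ∂μ := by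
  induction n with
  | zero => rw [lintegral_pi_zero]; simp
  | succ n ih =>
    have hm : Measurable fun x : Fin (n + 1) → X => ∏ i, f i (x i) :=
      Finset.measurable_fun_prod _ fun i _ => (hf i).comp (measurable_pi_apply i)
    rw [lintegral_pi_succ _ _ _ hm, Fin.prod_univ_succ]
    simp only [Fin.prod_univ_succ, Fin.cons_zero, Fin.cons_succ]
    have h (x₀ : X) : ∫⁻ x : Fin n → X, f 0 x₀ * ∏ i : Fin n, f i.succ (x i)
        ∂(Measure.pi fun _ : Fin n => μ) = f 0 x₀ * ∏ i : Fin n, ∫⁻ x, f i.succ x ∂μ := by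
      have hm' : Measurable fun x : Fin n → X => ∏ i : Fin n, f i.succ (x i) :=
        Finset.measurable_fun_prod _ fun i _ => (hf i.succ).comp (measurable_pi_apply i)
      rw [lintegral_const_mul _ hm', ih (fun i => f i.succ) fun i => hf i.succ]
    simp_rw [h]
    rw [lintegral_mul_const _ (hf 0)]

/-! ### Gaussian densities -/

/-- Completing the square: the product of two Gaussian densities is a Gaussian density in the
common variable, times the value of the convolution. -/
lemma gaussianPDFReal_mul_gaussianPDFReal {u v : ℝ≥0} (hu : 0 < u) (hv : 0 < v) (x y z : ℝ) :
    gaussianPDFReal 0 u (x - y) * gaussianPDFReal 0 v (y - z) =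
      gaussianPDFReal 0 (u + v) (x - z) *
        gaussianPDFReal ((v * x + u * z) / (u + v)) (u * v / (u + v)) y := by
  have hu' : (0 : ℝ) < u := hu
  have hv' : (0 : ℝ) < v := hv
  simp only [gaussianPDFReal, sub_zero, NNReal.coe_add, NNReal.coe_mul, NNReal.coe_div]
  rw [mul_mul_mul_comm, mul_mul_mul_comm (√(2 * Real.pi * (u + v)))⁻¹, ← Real.exp_add,
    ← Real.exp_add, ← mul_inv, ← mul_inv, ← Real.sqrt_mul (by positivity),
    ← Real.sqrt_mul (by positivity)]
  congr 1
  · congr 2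
    field_simp
  · congr 1
    field_simp
    ring

lemma gaussianPDF_conv {u v : ℝ≥0} (hu : 0 < u) (hv : 0 < v) (x z : ℝ) :
    ∫⁻ y, gaussianPDF 0 u (x - y) * gaussianPDF 0 v (y - z) = gaussianPDF 0 (u + v) (x - z) := by
  have h (y : ℝ) : gaussianPDF 0 u (x - y) * gaussianPDF 0 v (y - z) =
      gaussianPDF 0 (u + v) (x - z) *
        gaussianPDF ((v * x + u * z) / (u + v)) (u * v / (u + v)) y := by
    simp only [gaussianPDF]
    rw [← ENNReal.ofReal_mul (gaussianPDFReal_nonneg _ _ _),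
      gaussianPDFReal_mul_gaussianPDFReal hu hv,
      ENNReal.ofReal_mul (gaussianPDFReal_nonneg _ _ _)]
  simp_rw [h]
  rw [lintegral_const_mul _ (measurable_gaussianPDF _ _), lintegral_gaussianPDF_eq_one, mul_one]
  positivity

lemma gaussianPDF_neg (v : ℝ≥0) (x : ℝ) : gaussianPDF 0 v (-x) = gaussianPDF 0 v x := by
  simp [gaussianPDF, gaussianPDFReal]

lemma lintegral_gaussianPDF_gaussianReal {u v : ℝ≥0} (hv : 0 < v) (x : ℝ) :
    ∫⁻ y, gaussianPDF 0 v (x + y) ∂(gaussianReal 0 u) = gaussianPDF 0 (v + u) x := by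
  rcases eq_or_ne u 0 with rfl | hu
  · simp [gaussianReal_zero_var]
  rw [gaussianReal_of_var_ne_zero _ hu, lintegral_withDensity_eq_lintegral_mul _
    (measurable_gaussianPDF _ _) (g := fun y => gaussianPDF 0 v (x + y))
    ((measurable_gaussianPDF _ _).comp (measurable_const_add x)), ← sub_zero x,
    ← gaussianPDF_conv hv (pos_iff_ne_zero.2 hu), ← lintegral_neg_eq_self]
  refine lintegral_congr fun y => ?_
  simp only [Pi.mul_apply, sub_zero, gaussianPDF_neg, ← sub_eq_add_neg, mul_comm]

variable {d : ℕ}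

/-- The heat density `p_v(x)` with values in `[0,∞]`. -/
def heatENN (d : ℕ) (v : ℝ) (x : EuclideanSpace ℝ (Fin d)) : ℝ≥0∞ :=
  ENNReal.ofReal (heatDensity d v x)

lemma heatDensity_nonneg {v : ℝ} (hv : 0 ≤ v) (x : EuclideanSpace ℝ (Fin d)) :
    0 ≤ heatDensity d v x := by
  unfold heatDensity; positivity

lemma heatENN_neg (v : ℝ) (x : EuclideanSpace ℝ (Fin d)) : heatENN d v (-x) = heatENN d v x := by
  simp [heatENN, heatDensity]

lemma heatENN_sub_comm (v : ℝ) (x y : EuclideanSpace ℝ (Fin d)) :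
    heatENN d v (x - y) = heatENN d v (y - x) := by
  rw [← heatENN_neg, neg_sub]

lemma measurable_uncurry_heatDensity :
    Measurable fun p : ℝ × EuclideanSpace ℝ (Fin d) => heatDensity d p.1 p.2 := by
  unfold heatDensity; fun_prop

@[fun_prop]
lemma measurable_heatDensity {Y : Type*} [MeasurableSpace Y] {v : Y → ℝ}
    {x : Y → EuclideanSpace ℝ (Fin d)} (hv : Measurable v) (hx : Measurable x) :
    Measurable fun y => heatDensity d (v y) (x y) :=
  measurable_uncurry_heatDensity.comp (hv.prodMk hx)

@[fun_prop]
lemma measurable_heatENN {Y : Type*} [MeasurableSpace Y] {v : Y → ℝ}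
    {x : Y → EuclideanSpace ℝ (Fin d)} (hv : Measurable v) (hx : Measurable x) :
    Measurable fun y => heatENN d (v y) (x y) :=
  (measurable_heatDensity hv hx).ennreal_ofReal

lemma heatENN_le_zero {v : ℝ} (hv : 0 < v) (x : EuclideanSpace ℝ (Fin d)) :
    heatENN d v x ≤ heatENN d v 0 := by
  refine ENNReal.ofReal_le_ofReal ?_
  unfold heatDensity
  gcongr
  simp

lemma heatENN_zero_anti {v v' : ℝ} (hv : 0 < v) (h : v ≤ v') :
    heatENN d v' 0 ≤ heatENN d v 0 := by
  refine ENNReal.ofReal_le_ofReal ?_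
  unfold heatDensity
  simp only [norm_zero, ne_eq, OfNat.ofNat_ne_zero, not_false_eq_true, zero_pow, neg_zero,
    zero_div, Real.exp_zero, mul_one]
  exact Real.rpow_le_rpow_of_nonpos (by positivity) (by gcongr) (by simp; positivity)

lemma heatENN_eq_prod {v : ℝ} (hv : 0 < v) (x : EuclideanSpace ℝ (Fin d)) :
    heatENN d v x = ∏ i, gaussianPDF 0 v.toNNReal (x i) := by
  simp only [gaussianPDF, heatENN]
  rw [← ENNReal.ofReal_prod_of_nonneg fun i _ => gaussianPDFReal_nonneg _ _ _]
  congr 1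
  simp only [gaussianPDFReal, heatDensity, Real.coe_toNNReal v hv.le, sub_zero]
  rw [Finset.prod_mul_distrib, ← Real.exp_sum, EuclideanSpace.norm_sq_eq]
  congr 1
  · rw [Finset.prod_const, Finset.card_univ, Fintype.card_fin, Real.sqrt_eq_rpow, inv_pow,
      ← Real.rpow_natCast, ← Real.rpow_mul (by positivity), Real.rpow_neg (by positivity)]
    congr 2; ring
  · simp only [Real.norm_eq_abs, sq_abs]
    rw [← Finset.sum_neg_distrib, Finset.sum_div]

lemma lintegral_euclidean_prod (f : Fin d → ℝ → ℝ≥0∞) (hf : ∀ i, Measurable (f i)) :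
    ∫⁻ y : EuclideanSpace ℝ (Fin d), ∏ i, f i (y i) = ∏ i, ∫⁻ y, f i y := by
  rw [← lintegral_pi_prod volume d f hf,
    ← volume_pi, ← (EuclideanSpace.volume_preserving_symm_measurableEquiv_toLp
      (Fin d)).lintegral_comp_emb (MeasurableEquiv.measurableEmbedding _)]
  rfl

/-- The semigroup property `p_u * p_v = p_{u+v}`. -/
lemma heatENN_conv {u v : ℝ} (hu : 0 < u) (hv : 0 < v) (x z : EuclideanSpace ℝ (Fin d)) :
    ∫⁻ y, heatENN d u (x - y) * heatENN d v (y - z) = heatENN d (u + v) (x - z) := by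
  have h (i : Fin d) := gaussianPDF_conv (Real.toNNReal_pos.2 hu) (Real.toNNReal_pos.2 hv)
    (x i) (z i)
  rw [heatENN_eq_prod (add_pos hu hv), Real.toNNReal_add hu.le hv.le]
  simp only [heatENN_eq_prod hu, heatENN_eq_prod hv, ← Finset.prod_mul_distrib, PiLp.sub_apply,
    ← h]
  refine lintegral_euclidean_prod
    (fun i y => gaussianPDF 0 u.toNNReal (x i - y) * gaussianPDF 0 v.toNNReal (y - z i))
    fun i => ?_
  exact ((measurable_gaussianPDF _ _).comp (by fun_prop)).mul
    ((measurable_gaussianPDF _ _).comp (by fun_prop))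

end

section

/-! ### Gaussian mixtures -/

variable {d : ℕ} {ν : Measure ℝ}

/-- The Gaussian mixture `∫ p_{2w+ε}(x) ν(dw)`. For `ε > 0` it is the mollification `p_ε * f` of
the mixture `f` at `ε = 0`. The variance is parametrized as `2w` so that `p_{2w} = p_w * p_w`. -/
def mixture (d : ℕ) (ν : Measure ℝ) (ε : ℝ) (x : EuclideanSpace ℝ (Fin d)) : ℝ≥0∞ :=
  ∫⁻ w, heatENN d (2 * w + ε) x ∂ν

/-- `f` is, away from the origin, the mixture of the Gaussian densities `p_{2w}`, `w > 0`, with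
respect to the measure `ν`. At the origin no condition is imposed: singular kernels have there a
conventional value. -/
structure IsGaussianMixture (d : ℕ) (f : EuclideanSpace ℝ (Fin d) → ℝ) (ν : Measure ℝ) :
    Prop where
  sigmaFinite : SigmaFinite ν
  pos : ∀ᵐ w ∂ν, 0 < w
  measurable : Measurable f
  nonneg : ∀ x, 0 ≤ f x
  eq_mixture : ∀ x, x ≠ 0 → ENNReal.ofReal (f x) = mixture d ν 0 x

@[fun_prop]
lemma measurable_mixture [SFinite ν] {Y : Type*} [MeasurableSpace Y] {v : Y → ℝ}
    {x : Y → EuclideanSpace ℝ (Fin d)} (hv : Measurable v) (hx : Measurable x) :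
    Measurable fun y => mixture d ν (v y) (x y) := by
  unfold mixture
  exact Measurable.lintegral_prod_right (f := fun y w => heatENN d (2 * w + v y) (x y))
    (by simp only [Function.uncurry_def]; fun_prop)

lemma mixture_neg (ε : ℝ) (x : EuclideanSpace ℝ (Fin d)) :
    mixture d ν ε (-x) = mixture d ν ε x := by
  simp only [mixture, heatENN_neg]

lemma mixture_sub_comm (ε : ℝ) (x y : EuclideanSpace ℝ (Fin d)) :
    mixture d ν ε (x - y) = mixture d ν ε (y - x) := by
  rw [← mixture_neg, neg_sub]

lemma mixture_le_zero (hν : ∀ᵐ w ∂ν, 0 < w) {ε : ℝ} (hε : 0 ≤ ε)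
    (x : EuclideanSpace ℝ (Fin d)) : mixture d ν ε x ≤ mixture d ν ε 0 := by
  refine lintegral_mono_ae ?_
  filter_upwards [hν] with w hw using heatENN_le_zero (by positivity) x

lemma mixture_zero_anti (hν : ∀ᵐ w ∂ν, 0 < w) {ε ε' : ℝ} (hε : 0 ≤ ε) (h : ε ≤ ε') :
    mixture d ν ε' 0 ≤ mixture d ν ε 0 := by
  refine lintegral_mono_ae ?_
  filter_upwards [hν] with w hw using heatENN_zero_anti (by positivity) (by gcongr)

/-- Mollifying a mixture by `p_u` adds `u` to all variances. -/
lemma lintegral_heatENN_mul_mixture [SFinite ν] (hν : ∀ᵐ w ∂ν, 0 < w) {u ε : ℝ} (hu : 0 < u)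
    (hε : 0 ≤ ε) (x z : EuclideanSpace ℝ (Fin d)) :
    ∫⁻ y, heatENN d u (x - y) * mixture d ν ε (y - z) = mixture d ν (ε + u) (x - z) := by
  have h (y : EuclideanSpace ℝ (Fin d)) : heatENN d u (x - y) * mixture d ν ε (y - z) =
      ∫⁻ w, heatENN d u (x - y) * heatENN d (2 * w + ε) (y - z) ∂ν := by
    rw [lintegral_const_mul _ (by fun_prop), mixture]
  simp_rw [h]
  rw [lintegral_lintegral_swap (by simp only [Function.uncurry_def]; fun_prop), mixture]
  refine lintegral_congr_ae ?_
  filter_upwards [hν] with w hw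
  rw [heatENN_conv hu (by positivity)]
  congr 1; ring

/-- The feature functions of the mixture, which is a positive definite kernel:
`mixture ε (x - x')` is the inner product of `mixtureFactor ε · x` and `mixtureFactor ε · x'`. -/
def mixtureFactor (d : ℕ) (ε : ℝ) (e : ℝ × EuclideanSpace ℝ (Fin d))
    (x : EuclideanSpace ℝ (Fin d)) : ℝ≥0∞ :=
  heatENN d (e.1 + ε / 2) (x - e.2)

@[fun_prop]
lemma measurable_mixtureFactor {Y : Type*} [MeasurableSpace Y] (ε : ℝ)
    {e : Y → ℝ × EuclideanSpace ℝ (Fin d)} {x : Y → EuclideanSpace ℝ (Fin d)}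
    (he : Measurable e) (hx : Measurable x) :
    Measurable fun y => mixtureFactor d ε (e y) (x y) := by
  unfold mixtureFactor; fun_prop

lemma mixture_eq_lintegral_mixtureFactor [SFinite ν] (hν : ∀ᵐ w ∂ν, 0 < w) {ε : ℝ} (hε : 0 ≤ ε)
    (x x' : EuclideanSpace ℝ (Fin d)) :
    mixture d ν ε (x - x') =
      ∫⁻ e, mixtureFactor d ε e x * mixtureFactor d ε e x' ∂(ν.prod volume) := by
  rw [lintegral_prod _ (by fun_prop), mixture]
  refine lintegral_congr_ae ?_
  filter_upwards [hν] with w hw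
  simp only [mixtureFactor]
  simp_rw [heatENN_sub_comm (w + ε / 2) x']
  rw [heatENN_conv (by positivity) (by positivity)]
  congr 1; ring

namespace IsGaussianMixture

variable {f : EuclideanSpace ℝ (Fin d) → ℝ}

lemma ofReal_ae_eq (hf : IsGaussianMixture d f ν) (hd : 0 < d) (z : EuclideanSpace ℝ (Fin d)) :
    ∀ᵐ x, ENNReal.ofReal (f (x - z)) = mixture d ν 0 (x - z) := by
  have : Nonempty (Fin d) := ⟨⟨0, hd⟩⟩
  filter_upwards [Measure.ae_ne volume z] with x hx
  exact hf.eq_mixture _ (sub_ne_zero.2 hx)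

lemma lintegral_heatENN_mul (hf : IsGaussianMixture d f ν) (hd : 0 < d) {u : ℝ} (hu : 0 < u)
    (x z : EuclideanSpace ℝ (Fin d)) :
    ∫⁻ y, heatENN d u (x - y) * ENNReal.ofReal (f (y - z)) = mixture d ν u (x - z) := by
  have := hf.sigmaFinite
  rw [← zero_add u, ← lintegral_heatENN_mul_mixture hf.pos hu le_rfl, zero_add]
  refine lintegral_congr_ae ?_
  filter_upwards [hf.ofReal_ae_eq hd z] with y hy
  rw [hy]

lemma kernelEnergy_eq (hf : IsGaussianMixture d f ν) (hd : 0 < d) {u v : ℝ} (hu : 0 < u)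
    (hv : 0 < v) (y z : EuclideanSpace ℝ (Fin d)) :
    kernelEnergy d f u v y z = mixture d ν (u + v) (y - z) := by
  have := hf.sigmaFinite
  unfold kernelEnergy
  have h (x' : EuclideanSpace ℝ (Fin d)) :
      ∫⁻ x, ENNReal.ofReal (heatDensity d u (x - y) * heatDensity d v (x' - z) * f (x - x')) =
        heatENN d v (z - x') * mixture d ν u (x' - y) := by
    rw [mixture_sub_comm, ← hf.lintegral_heatENN_mul hd hu, ← lintegral_const_mul]
    · refine lintegral_congr fun x => ?_
      rw [ENNReal.ofReal_mul (mul_nonneg (heatDensity_nonneg hu.le _)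
        (heatDensity_nonneg hv.le _)), ENNReal.ofReal_mul (heatDensity_nonneg hu.le _),
        heatENN_sub_comm v, heatENN_sub_comm u]
      simp only [heatENN]; ring
    · have := hf.measurable; fun_prop
  simp_rw [h]
  rw [lintegral_heatENN_mul_mixture hf.pos hv hu.le, mixture_sub_comm]

end IsGaussianMixture

end

section

/-! ### The four kernels are Gaussian mixtures -/

variable {d : ℕ}

lemma integral_rpow_mul_exp_neg_div {s A : ℝ} (hs : 0 < s) (hA : 0 < A) :
    ∫ w in Ioi (0 : ℝ), w ^ (-s - 1) * Real.exp (-A / w) = Real.Gamma s * A ^ (-s) := by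
  have h := integral_comp_rpow_Ioi (fun y => y ^ (s - 1) * Real.exp (-(A * y)))
    (p := -1) (by norm_num)
  rw [Real.integral_rpow_mul_exp_neg_mul_Ioi hs hA] at h
  rw [mul_comm, Real.rpow_neg hA.le, ← Real.inv_rpow hA.le, ← one_div, ← h]
  refine setIntegral_congr_fun measurableSet_Ioi fun w (hw : 0 < w) => ?_
  simp only [abs_neg, abs_one, one_mul, smul_eq_mul]
  rw [← Real.rpow_mul hw.le, ← mul_assoc, ← Real.rpow_add hw, Real.rpow_neg_one]
  congr 2
  · ring
  · field_simp

lemma integrableOn_rpow_mul_exp_neg_div {s A : ℝ} (hs : 0 < s) (hA : 0 < A) :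
    IntegrableOn (fun w : ℝ => w ^ (-s - 1) * Real.exp (-A / w)) (Ioi 0) := by
  refine Integrable.of_integral_ne_zero ?_
  rw [integral_rpow_mul_exp_neg_div hs hA]
  have := Real.Gamma_pos_of_pos hs
  positivity

/-- The measure on variances for which the mixture of the Gaussians `p_{2w}` is
`∫ g(w) exp(-|x|²/(4w)) dw`: the factor `(4πw)^{d/2}` undoes the normalization of `p_{2w}`. -/
def varianceMeasure (d : ℕ) (g : ℝ → ℝ) : Measure ℝ :=
  (volume.restrict (Ioi 0)).withDensity
    fun w => ENNReal.ofReal (g w * (2 * Real.pi * (2 * w)) ^ ((d : ℝ) / 2))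

instance (g : ℝ → ℝ) : SigmaFinite (varianceMeasure d g) := by
  unfold varianceMeasure; infer_instance

lemma varianceMeasure_pos (g : ℝ → ℝ) : ∀ᵐ w ∂(varianceMeasure d g), 0 < w :=
  (withDensity_absolutelyContinuous _ _).ae_le (ae_restrict_mem measurableSet_Ioi)

lemma lintegral_varianceMeasure {g : ℝ → ℝ} (hg : Measurable g) {F : ℝ → ℝ≥0∞}
    (hF : Measurable F) :
    ∫⁻ w, F w ∂(varianceMeasure d g) = ∫⁻ w in Ioi 0,
      ENNReal.ofReal (g w * (2 * Real.pi * (2 * w)) ^ ((d : ℝ) / 2)) * F w := by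
  rw [varianceMeasure, lintegral_withDensity_eq_lintegral_mul _ (by fun_prop) hF]
  rfl

lemma mixture_varianceMeasure {g : ℝ → ℝ} (hg : Measurable g) (hg0 : ∀ w, 0 < w → 0 ≤ g w)
    (x : EuclideanSpace ℝ (Fin d)) :
    mixture d (varianceMeasure d g) 0 x =
      ∫⁻ w in Ioi 0, ENNReal.ofReal (g w * Real.exp (-‖x‖ ^ 2 / (4 * w))) := by
  rw [mixture, lintegral_varianceMeasure hg (by fun_prop)]
  refine setLIntegral_congr_fun measurableSet_Ioi fun w (hw : 0 < w) => ?_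
  simp only [heatENN]
  rw [← ENNReal.ofReal_mul (mul_nonneg (hg0 w hw) (by positivity)), heatDensity]
  congr 1
  rw [add_zero, Real.rpow_neg (by positivity)]
  have : (2 * Real.pi * (2 * w)) ^ ((d : ℝ) / 2) ≠ 0 := by positivity
  field_simp
  congr 2; ring

lemma mixture_varianceMeasure_of_integral {g : ℝ → ℝ} (hg : Measurable g)
    (hg0 : ∀ w, 0 < w → 0 ≤ g w) (x : EuclideanSpace ℝ (Fin d))
    (hint : IntegrableOn (fun w => g w * Real.exp (-‖x‖ ^ 2 / (4 * w))) (Ioi 0)) :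
    ENNReal.ofReal (∫ w in Ioi 0, g w * Real.exp (-‖x‖ ^ 2 / (4 * w))) =
      mixture d (varianceMeasure d g) 0 x := by
  rw [mixture_varianceMeasure hg hg0, ofReal_integral_eq_lintegral_ofReal hint]
  filter_upwards [ae_restrict_mem measurableSet_Ioi] with w hw
  exact mul_nonneg (hg0 w hw) (by positivity)

lemma lintegral_Ioc_rpow_sub_one {a τ : ℝ} (ha : 0 < a) (hτ : 0 < τ) :
    ∫⁻ w in Ioc 0 τ, ENNReal.ofReal (w ^ (a - 1)) = ENNReal.ofReal (τ ^ a / a) := by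
  have hi : IntervalIntegrable (fun w : ℝ => w ^ (a - 1)) volume 0 τ :=
    intervalIntegral.intervalIntegrable_rpow' (by linarith)
  rw [← ofReal_integral_eq_lintegral_ofReal
    ((intervalIntegrable_iff_integrableOn_Ioc_of_le hτ.le).1 hi),
    ← intervalIntegral.integral_of_le hτ.le, integral_rpow (Or.inl (by linarith)),
    sub_add_cancel, Real.zero_rpow ha.ne', sub_zero]
  filter_upwards [ae_restrict_mem measurableSet_Ioc] with w hw
  exact Real.rpow_nonneg hw.1.le _

lemma lintegral_Ioi_rpow_neg_sub_one {s τ : ℝ} (hs : 0 < s) (hτ : 0 < τ) :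
    ∫⁻ w in Ioi τ, ENNReal.ofReal (w ^ (-s - 1)) = ENNReal.ofReal (τ ^ (-s) / s) := by
  rw [← ofReal_integral_eq_lintegral_ofReal (integrableOn_Ioi_rpow_of_lt (by linarith) hτ),
    integral_Ioi_rpow_of_lt (by linarith) hτ, sub_add_cancel, div_neg, neg_div, neg_neg]
  filter_upwards [ae_restrict_mem measurableSet_Ioi] with w hw
  exact Real.rpow_nonneg (hτ.trans hw).le _

/-- If the density of the variances is at most `c w^{-s-1}`, then `∫ p_{2w+τ}(0) ν(dw)` is
`O(τ^{-s})`: bound the Gaussian by `(2πτ)^{-d/2}` for `w ≤ τ`, and by `(4πw)^{-d/2}` for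
`w > τ`. -/
lemma mixture_varianceMeasure_zero_le {g : ℝ → ℝ} (hg : Measurable g) {c s : ℝ} (hc : 0 ≤ c)
    (hs : 0 < s) (hsd : s < (d : ℝ) / 2) (hgc : ∀ w, 0 < w → g w ≤ c * w ^ (-s - 1))
    {τ : ℝ} (hτ : 0 < τ) :
    mixture d (varianceMeasure d g) τ 0 ≤
      ENNReal.ofReal (c * (2 ^ ((d : ℝ) / 2) / (d / 2 - s) + 1 / s) * τ ^ (-s)) := by
  have hds : 0 < (d : ℝ) / 2 - s := by linarith
  rw [mixture, lintegral_varianceMeasure hg (by fun_prop), ← Ioc_union_Ioi_eq_Ioi hτ.le,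
    lintegral_union measurableSet_Ioi (Ioc_disjoint_Ioi le_rfl)]
  have h0 (w : ℝ) : heatENN d (2 * w + τ) 0 =
      ENNReal.ofReal ((2 * Real.pi * (2 * w + τ)) ^ (-((d : ℝ) / 2))) := by
    simp [heatENN, heatDensity]
  have h1 : ∫⁻ w in Ioc 0 τ, ENNReal.ofReal (g w * (2 * Real.pi * (2 * w)) ^ ((d : ℝ) / 2))
      * heatENN d (2 * w + τ) 0 ≤
      ENNReal.ofReal (c * 2 ^ ((d : ℝ) / 2) * τ ^ (-((d : ℝ) / 2))) *
        ∫⁻ w in Ioc 0 τ, ENNReal.ofReal (w ^ (((d : ℝ) / 2 - s) - 1)) := by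
    rw [← lintegral_const_mul _ (by fun_prop)]
    refine setLIntegral_mono (by fun_prop) fun w hw => ?_
    have hw0 : 0 < w := hw.1
    rw [h0, ← ENNReal.ofReal_mul' (by positivity), ← ENNReal.ofReal_mul (by positivity)]
    refine ENNReal.ofReal_le_ofReal ?_
    calc g w * (2 * Real.pi * (2 * w)) ^ ((d : ℝ) / 2)
          * (2 * Real.pi * (2 * w + τ)) ^ (-((d : ℝ) / 2))
        ≤ (c * w ^ (-s - 1)) * (2 * Real.pi * (2 * w)) ^ ((d : ℝ) / 2)
          * (2 * Real.pi * τ) ^ (-((d : ℝ) / 2)) := by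
          refine mul_le_mul (mul_le_mul_of_nonneg_right (hgc w hw0) (by positivity))
            (Real.rpow_le_rpow_of_nonpos (by positivity) ?_ (by simp; positivity))
            (by positivity) (by positivity)
          gcongr; linarith
      _ = _ := by
          rw [Real.mul_rpow (by positivity) (by positivity), Real.mul_rpow (by positivity) hw0.le,
            Real.mul_rpow (by positivity) hτ.le, Real.rpow_neg (x := 2 * Real.pi) (by positivity),
            show (d : ℝ) / 2 - s - 1 = (-s - 1) + (d : ℝ) / 2 by ring, Real.rpow_add hw0]
          have : (2 * Real.pi) ^ ((d : ℝ) / 2) ≠ 0 := by positivity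
          field_simp
  have h2 : ∫⁻ w in Ioi τ, ENNReal.ofReal (g w * (2 * Real.pi * (2 * w)) ^ ((d : ℝ) / 2))
      * heatENN d (2 * w + τ) 0 ≤
      ENNReal.ofReal c * ∫⁻ w in Ioi τ, ENNReal.ofReal (w ^ (-s - 1)) := by
    rw [← lintegral_const_mul _ (by fun_prop)]
    refine setLIntegral_mono (by fun_prop) fun w (hw : τ < w) => ?_
    have hw0 : 0 < w := hτ.trans hw
    rw [h0, ← ENNReal.ofReal_mul' (by positivity), ← ENNReal.ofReal_mul (by positivity)]
    refine ENNReal.ofReal_le_ofReal ?_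
    calc g w * (2 * Real.pi * (2 * w)) ^ ((d : ℝ) / 2)
          * (2 * Real.pi * (2 * w + τ)) ^ (-((d : ℝ) / 2))
        ≤ (c * w ^ (-s - 1)) * (2 * Real.pi * (2 * w)) ^ ((d : ℝ) / 2)
          * (2 * Real.pi * (2 * w)) ^ (-((d : ℝ) / 2)) := by
          refine mul_le_mul (mul_le_mul_of_nonneg_right (hgc w hw0) (by positivity))
            (Real.rpow_le_rpow_of_nonpos (by positivity) ?_ (by simp; positivity))
            (by positivity) (by positivity)
          gcongr; linarith
      _ = _ := by
          rw [mul_assoc, ← Real.rpow_add (by positivity), add_neg_cancel, Real.rpow_zero, mul_one]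
  refine (add_le_add h1 h2).trans_eq ?_
  rw [lintegral_Ioc_rpow_sub_one hds hτ, lintegral_Ioi_rpow_neg_sub_one hs hτ,
    ← ENNReal.ofReal_mul (by positivity), ← ENNReal.ofReal_mul hc,
    ← ENNReal.ofReal_add (by positivity) (by positivity)]
  congr 1
  rw [Real.rpow_sub hτ, Real.rpow_neg hτ.le, Real.rpow_neg hτ.le]
  have : τ ^ ((d : ℝ) / 2) ≠ 0 := by positivity
  have : τ ^ s ≠ 0 := by positivity
  field_simp

lemma rieszKernel_eq_integral {α : ℝ} (hαd : α < d) {x : EuclideanSpace ℝ (Fin d)}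
    (hx : x ≠ 0) :
    rieszKernel d α x = ∫ w in Ioi (0 : ℝ),
      ((2 : ℝ) ^ (-(d : ℝ)) * Real.pi ^ (-((d : ℝ) / 2)) / Real.Gamma (α / 2)
        * w ^ (-(((d : ℝ) - α) / 2) - 1)) * Real.exp (-‖x‖ ^ 2 / (4 * w)) := by
  have hx' : 0 < ‖x‖ := norm_pos_iff.2 hx
  have h := integral_rpow_mul_exp_neg_div (s := ((d : ℝ) - α) / 2) (A := ‖x‖ ^ 2 / 4)
    (by linarith) (by positivity)
  have h4 : (4 : ℝ) = 2 ^ (2 : ℝ) := by norm_num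
  have hA : (‖x‖ ^ 2 / 4) ^ (-(((d : ℝ) - α) / 2)) = 2 ^ (d - α) * ‖x‖ ^ (-(d : ℝ) + α) := by
    rw [h4, Real.div_rpow (by positivity) (by positivity), ← Real.rpow_natCast,
      ← Real.rpow_mul hx'.le, ← Real.rpow_mul (by norm_num), div_eq_mul_inv, ← Real.rpow_neg
      (by norm_num), mul_comm]
    congr 2 <;> push_cast <;> ring
  have h2 : (2 : ℝ) ^ (-α) = 2 ^ (-(d : ℝ)) * 2 ^ (d - α) := by
    rw [← Real.rpow_add (by norm_num)]; congr 1; ring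
  have h' : ∫ w in Ioi (0 : ℝ), ((2 : ℝ) ^ (-(d : ℝ)) * Real.pi ^ (-((d : ℝ) / 2))
        / Real.Gamma (α / 2) * w ^ (-(((d : ℝ) - α) / 2) - 1)) * Real.exp (-‖x‖ ^ 2 / (4 * w)) =
      (2 : ℝ) ^ (-(d : ℝ)) * Real.pi ^ (-((d : ℝ) / 2)) / Real.Gamma (α / 2) *
      ∫ w in Ioi (0 : ℝ), w ^ (-(((d : ℝ) - α) / 2) - 1) * Real.exp (-(‖x‖ ^ 2 / 4) / w) := by
    rw [← integral_const_mul]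
    refine setIntegral_congr_fun measurableSet_Ioi fun w (hw : 0 < w) => ?_
    rw [mul_assoc]
    congr 3
    field_simp
  rw [h', h, hA, rieszKernel, h2]
  ring

lemma integrableOn_rpow_mul_exp_neg_sq {s c : ℝ} (hs : 0 < s) {x : EuclideanSpace ℝ (Fin d)}
    (hx : x ≠ 0) :
    IntegrableOn (fun w : ℝ => (c * w ^ (-s - 1)) * Real.exp (-‖x‖ ^ 2 / (4 * w))) (Ioi 0) := by
  have hx' : 0 < ‖x‖ := norm_pos_iff.2 hx
  have hA : 0 < ‖x‖ ^ 2 / 4 := by positivity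
  refine IntegrableOn.congr_fun ((integrableOn_rpow_mul_exp_neg_div hs hA).const_mul c)
    (fun w (hw : 0 < w) => ?_) measurableSet_Ioi
  rw [mul_assoc]
  congr 3
  field_simp

lemma IsRieszOrBessel.exists_mixture {α : ℝ} (hα : 0 < α) (hαd : α < d)
    {f : EuclideanSpace ℝ (Fin d) → ℝ} (hf : IsRieszOrBessel d α f) :
    ∃ ν, IsGaussianMixture d f ν ∧ ∃ D : ℝ, 0 < D ∧ ∀ τ : ℝ, 0 < τ →
      mixture d ν τ 0 ≤ ENNReal.ofReal (D * τ ^ (-(((d : ℝ) - α) / 2))) := by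
  have hs : 0 < ((d : ℝ) - α) / 2 := by linarith
  have hsd : ((d : ℝ) - α) / 2 < (d : ℝ) / 2 := by linarith
  have hds : 0 < (d : ℝ) / 2 - ((d : ℝ) - α) / 2 := by linarith
  have hΓ : 0 < Real.Gamma (((d : ℝ) - α) / 2) := Real.Gamma_pos_of_pos hs
  have hΓ' : 0 < Real.Gamma (α / 2) := Real.Gamma_pos_of_pos (by linarith)
  rcases hf with rfl | ⟨κ, hκ, rfl⟩
  · set c : ℝ := (2 : ℝ) ^ (-(d : ℝ)) * Real.pi ^ (-((d : ℝ) / 2)) / Real.Gamma (α / 2) with hc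
    have hc0 : 0 < c := by positivity
    have hg : Measurable fun w : ℝ => c * w ^ (-(((d : ℝ) - α) / 2) - 1) := by fun_prop
    have hg0 (w : ℝ) (hw : 0 < w) : 0 ≤ c * w ^ (-(((d : ℝ) - α) / 2) - 1) := by positivity
    refine ⟨varianceMeasure d fun w => c * w ^ (-(((d : ℝ) - α) / 2) - 1), ⟨inferInstance,
      varianceMeasure_pos _, by unfold rieszKernel; fun_prop, fun x => ?_, fun x hx => ?_⟩,
      _, ?_, fun τ hτ => mixture_varianceMeasure_zero_le hg hc0.le hs hsd (fun w _ => le_rfl) hτ⟩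
    · unfold rieszKernel; positivity
    · rw [rieszKernel_eq_integral hαd hx]
      exact mixture_varianceMeasure_of_integral hg hg0 x (integrableOn_rpow_mul_exp_neg_sq hs hx)
    · positivity
  · have hg : Measurable fun w : ℝ => κ * w ^ (-(((d : ℝ) - α) / 2) - 1) * Real.exp (-w) := by
      fun_prop
    have hg0 (w : ℝ) (hw : 0 < w) :
        0 ≤ κ * w ^ (-(((d : ℝ) - α) / 2) - 1) * Real.exp (-w) := by positivity
    have hf (x : EuclideanSpace ℝ (Fin d)) : besselKernel d α κ x = ∫ w in Ioi (0 : ℝ),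
        (κ * w ^ (-(((d : ℝ) - α) / 2) - 1) * Real.exp (-w)) *
          Real.exp (-‖x‖ ^ 2 / (4 * w)) := by
      rw [besselKernel, ← integral_const_mul]
      refine integral_congr_ae (ae_of_all _ fun w => ?_)
      simp only
      rw [show -(((d : ℝ) - α) / 2) - 1 = (α - d) / 2 - 1 by ring]
      ring
    have hle (w : ℝ) (hw : 0 < w) : κ * w ^ (-(((d : ℝ) - α) / 2) - 1) * Real.exp (-w) ≤
        κ * w ^ (-(((d : ℝ) - α) / 2) - 1) :=
      mul_le_of_le_one_right (by positivity) (by simpa using hw.le)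
    refine ⟨varianceMeasure d fun w => κ * w ^ (-(((d : ℝ) - α) / 2) - 1) * Real.exp (-w),
      ⟨inferInstance, varianceMeasure_pos _, ?_, fun x => ?_, fun x hx => ?_⟩,
      _, ?_, fun τ hτ => mixture_varianceMeasure_zero_le hg hκ.le hs hsd hle hτ⟩
    · rw [funext hf]
      refine (StronglyMeasurable.integral_prod_right (f := fun x w =>
        (κ * w ^ (-(((d : ℝ) - α) / 2) - 1) * Real.exp (-w)) * Real.exp (-‖x‖ ^ 2 / (4 * w)))
        (ν := volume.restrict (Ioi (0 : ℝ))) ?_).measurable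
      refine Measurable.stronglyMeasurable ?_
      simp only [Function.uncurry_def]; fun_prop
    · rw [hf]
      exact setIntegral_nonneg measurableSet_Ioi fun w hw =>
        mul_nonneg (hg0 w hw) (Real.exp_nonneg _)
    · rw [hf]
      refine mixture_varianceMeasure_of_integral hg hg0 x ?_
      refine Integrable.mono' (integrableOn_rpow_mul_exp_neg_sq (c := κ) hs hx)
        (by fun_prop) ?_
      filter_upwards [ae_restrict_mem measurableSet_Ioi] with w hw
      rw [Real.norm_of_nonneg (mul_nonneg (hg0 w hw) (Real.exp_nonneg _))]
      exact mul_le_mul_of_nonneg_right (hle w hw) (Real.exp_nonneg _)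
    · positivity

lemma poissonKernel_eq_integral {α : ℝ} (hα : 0 < α) (x : EuclideanSpace ℝ (Fin d)) :
    IntegrableOn (fun w : ℝ => ((2 : ℝ) ^ (-((d : ℝ) + 1)) * Real.pi ^ (-(((d : ℝ) + 1) / 2)) * α
        * w ^ (-(((d : ℝ) + 1) / 2) - 1) * Real.exp (-(α ^ 2 / 4) / w))
          * Real.exp (-‖x‖ ^ 2 / (4 * w))) (Ioi 0) ∧
    poissonKernel d α x = ∫ w in Ioi (0 : ℝ),
      ((2 : ℝ) ^ (-((d : ℝ) + 1)) * Real.pi ^ (-(((d : ℝ) + 1) / 2)) * α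
        * w ^ (-(((d : ℝ) + 1) / 2) - 1) * Real.exp (-(α ^ 2 / 4) / w))
          * Real.exp (-‖x‖ ^ 2 / (4 * w)) := by
  set c : ℝ := (2 : ℝ) ^ (-((d : ℝ) + 1)) * Real.pi ^ (-(((d : ℝ) + 1) / 2)) * α with hc
  have hs : 0 < ((d : ℝ) + 1) / 2 := by positivity
  have hA : 0 < (‖x‖ ^ 2 + α ^ 2) / 4 := by positivity
  have he : ∀ w ∈ Ioi (0 : ℝ), c * (w ^ (-(((d : ℝ) + 1) / 2) - 1)
      * Real.exp (-((‖x‖ ^ 2 + α ^ 2) / 4) / w)) =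
      c * w ^ (-(((d : ℝ) + 1) / 2) - 1) * Real.exp (-(α ^ 2 / 4) / w)
        * Real.exp (-‖x‖ ^ 2 / (4 * w)) := fun w (hw : 0 < w) => by
    have hexp : Real.exp (-((‖x‖ ^ 2 + α ^ 2) / 4) / w) =
        Real.exp (-(α ^ 2 / 4) / w) * Real.exp (-‖x‖ ^ 2 / (4 * w)) := by
      rw [← Real.exp_add]
      congr 1
      field_simp; ring
    rw [hexp]; ring
  refine ⟨IntegrableOn.congr_fun ((integrableOn_rpow_mul_exp_neg_div hs hA).const_mul c) he
    measurableSet_Ioi, ?_⟩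
  rw [← setIntegral_congr_fun measurableSet_Ioi he, integral_const_mul,
    integral_rpow_mul_exp_neg_div hs hA, poissonKernel]
  have h4 : (4 : ℝ) = 2 ^ (2 : ℝ) := by norm_num
  rw [Real.div_rpow (by positivity) (by norm_num), h4, ← Real.rpow_mul (by norm_num), hc,
    show (2 : ℝ) * -(((d : ℝ) + 1) / 2) = -((d : ℝ) + 1) by ring]
  have : (2 : ℝ) ^ (-((d : ℝ) + 1)) ≠ 0 := by positivity
  field_simp

lemma IsHeatOrPoisson.exists_mixture {α : ℝ} (hα : 0 < α)
    {f : EuclideanSpace ℝ (Fin d) → ℝ} (hf : IsHeatOrPoisson d α f) :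
    ∃ ν, IsGaussianMixture d f ν ∧ ∃ K : ℝ, 0 < K ∧ mixture d ν 0 0 ≤ ENNReal.ofReal K := by
  rcases hf with rfl | rfl
  · have h (x : EuclideanSpace ℝ (Fin d)) :
        mixture d (Measure.dirac (α / 2)) 0 x = ENNReal.ofReal (heatKernel d α x) := by
      rw [mixture, lintegral_dirac, show 2 * (α / 2) + 0 = α by ring]; rfl
    refine ⟨Measure.dirac (α / 2), ⟨inferInstance, ?_, by unfold heatKernel; fun_prop,
      fun x => by unfold heatKernel; positivity, fun x _ => (h x).symm⟩,
      heatKernel d α 0, by unfold heatKernel; positivity, (h 0).le⟩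
    rw [ae_dirac_eq]; exact half_pos hα
  · have hΓ : 0 < Real.Gamma (((d : ℝ) + 1) / 2) := Real.Gamma_pos_of_pos (by positivity)
    have h (x : EuclideanSpace ℝ (Fin d)) := mixture_varianceMeasure_of_integral
      (g := fun w : ℝ => (2 : ℝ) ^ (-((d : ℝ) + 1)) * Real.pi ^ (-(((d : ℝ) + 1) / 2)) * α
        * w ^ (-(((d : ℝ) + 1) / 2) - 1) * Real.exp (-(α ^ 2 / 4) / w))
      (by fun_prop) (fun w hw => by positivity) x (poissonKernel_eq_integral hα x).1
    simp_rw [← (poissonKernel_eq_integral hα _).2] at h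
    exact ⟨_, ⟨inferInstance, varianceMeasure_pos _, by unfold poissonKernel; fun_prop,
      fun x => by unfold poissonKernel; positivity, fun x _ => h x⟩,
      poissonKernel d α 0, by unfold poissonKernel; positivity, (h 0).ge⟩

end

/-! ### The Hardy–Littlewood–Sobolev inequality on the half-line -/

lemma lintegral_comp_abs (g : ℝ → ℝ≥0∞) : ∫⁻ x, g |x| = 2 * ∫⁻ x in Ioi 0, g x := by
  have h1 : ∫⁻ x in Ioi (0 : ℝ), g |x| = ∫⁻ x in Ioi 0, g x :=
    setLIntegral_congr_fun measurableSet_Ioi fun x (hx : 0 < x) => by rw [abs_of_pos hx]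
  have h2 : ∫⁻ x in Iio (0 : ℝ), g |x| = ∫⁻ x in Ioi 0, g x := by
    rw [← h1, ← (Measure.measurePreserving_neg (volume : Measure ℝ)).setLIntegral_comp_preimage_emb
      (MeasurableEquiv.neg ℝ).measurableEmbedding]
    simp
  rw [← lintegral_add_compl _ (measurableSet_Ioi (a := (0 : ℝ))), compl_Ioi,
    setLIntegral_congr Iio_ae_eq_Iic.symm, h1, h2, two_mul]

lemma lintegral_abs_sub_le {H R : ℝ} (hH : 1 / 2 < H) (hR : 0 < R) (s : ℝ) :
    ∫⁻ r in {r | |r - s| ≤ R}, ENNReal.ofReal (|r - s| ^ (2 * H - 2)) =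
      ENNReal.ofReal (2 * R ^ (2 * H - 1) / (2 * H - 1)) := by
  have hm : MeasurableSet {r | |r - s| ≤ R} := measurableSet_le (by fun_prop) (by fun_prop)
  have h := lintegral_sub_right_eq_self (μ := (volume : Measure ℝ))
    (fun x => (Iic R).indicator (fun x : ℝ => ENNReal.ofReal (x ^ (2 * H - 2))) |x|) s
  rw [lintegral_comp_abs, ← lintegral_indicator measurableSet_Ioi] at h
  rw [← lintegral_indicator hm]
  have h' : ∀ r, {r | |r - s| ≤ R}.indicator
      (fun r => ENNReal.ofReal (|r - s| ^ (2 * H - 2))) r =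
      (Iic R).indicator (fun x : ℝ => ENNReal.ofReal (x ^ (2 * H - 2))) |r - s| := fun r => by
    simp only [indicator, mem_ofPred_eq, mem_Iic]
  simp_rw [h', h, indicator_indicator, Ioi_inter_Iic]
  rw [lintegral_indicator measurableSet_Ioc, show 2 * H - 2 = (2 * H - 1) - 1 by ring,
    lintegral_Ioc_rpow_sub_one (by linarith) hR, ← ENNReal.ofReal_ofNat,
    ← ENNReal.ofReal_mul (by norm_num)]
  congr 1; ring

lemma lintegral_abs_sub_inv_sq {R : ℝ} (hR : 0 < R) (s : ℝ) :
    ∫⁻ r in {r | R < |r - s|}, ENNReal.ofReal (|r - s| ^ (-2 : ℝ)) =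
      ENNReal.ofReal (2 / R) := by
  have hm : MeasurableSet {r | R < |r - s|} := measurableSet_lt (by fun_prop) (by fun_prop)
  have h := lintegral_sub_right_eq_self (μ := (volume : Measure ℝ))
    (fun x => (Ioi R).indicator (fun x : ℝ => ENNReal.ofReal (x ^ (-2 : ℝ))) |x|) s
  rw [lintegral_comp_abs, ← lintegral_indicator measurableSet_Ioi] at h
  rw [← lintegral_indicator hm]
  have h' : ∀ r, {r | R < |r - s|}.indicator
      (fun r => ENNReal.ofReal (|r - s| ^ (-2 : ℝ))) r =
      (Ioi R).indicator (fun x : ℝ => ENNReal.ofReal (x ^ (-2 : ℝ))) |r - s| := fun r => by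
    simp only [indicator, mem_ofPred_eq, mem_Ioi]
  simp_rw [h', h, indicator_indicator, Ioi_inter_Ioi, max_eq_right hR.le]
  rw [lintegral_indicator measurableSet_Ioi, show (-2 : ℝ) = -1 - 1 by norm_num,
    lintegral_Ioi_rpow_neg_sub_one one_pos hR, ← ENNReal.ofReal_ofNat,
    ← ENNReal.ofReal_mul (by norm_num), Real.rpow_neg_one]
  congr 1; field_simp

/-- The potential of `φ` restricted to `{φ ≤ a}`. Splitting at distance `R` from `s`, the near
part is at most `a ∫_{|x| ≤ R} |x|^{2H-2}`, and the far part is estimated by Hölder's inequality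
with exponents `1/H` and `1/(1-H)`. -/
lemma lintegral_truncated_potential_le {H : ℝ} (hH : 1 / 2 < H) (hH1 : H < 1) {φ : ℝ → ℝ≥0∞}
    (hφ : Measurable φ) (μ : Measure ℝ) (hμ : μ ≤ volume) {a R : ℝ} (ha : 0 ≤ a) (hR : 0 < R)
    (s : ℝ) :
    ∫⁻ r, {r | φ r ≤ ENNReal.ofReal a}.indicator
        (fun r => φ r * ENNReal.ofReal (|r - s| ^ (2 * H - 2))) r ∂μ ≤
      ENNReal.ofReal (a * (2 * R ^ (2 * H - 1) / (2 * H - 1))) +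
        (∫⁻ r, φ r ^ (1 / H) ∂μ) ^ H * ENNReal.ofReal ((2 / R) ^ (1 - H)) := by
  have hm : MeasurableSet {r | |r - s| ≤ R} := measurableSet_le (by fun_prop) (by fun_prop)
  have hm' : MeasurableSet {r | R < |r - s|} := measurableSet_lt (by fun_prop) (by fun_prop)
  have hcompl : {r | |r - s| ≤ R}ᶜ = {r | R < |r - s|} := by ext; simp
  rw [← lintegral_add_compl _ hm, hcompl]
  refine add_le_add ?_ ?_
  · calc ∫⁻ r in {r | |r - s| ≤ R}, {r | φ r ≤ ENNReal.ofReal a}.indicator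
          (fun r => φ r * ENNReal.ofReal (|r - s| ^ (2 * H - 2))) r ∂μ
        ≤ ∫⁻ r in {r | |r - s| ≤ R}, ENNReal.ofReal a *
            ENNReal.ofReal (|r - s| ^ (2 * H - 2)) ∂μ := by
          refine lintegral_mono fun r => ?_
          by_cases hr : φ r ≤ ENNReal.ofReal a
          · rw [indicator_of_mem (by exact hr)]
            gcongr
          · rw [indicator_of_notMem (by exact hr)]
            exact zero_le
      _ ≤ ∫⁻ r in {r | |r - s| ≤ R}, ENNReal.ofReal a *
            ENNReal.ofReal (|r - s| ^ (2 * H - 2)) :=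
          lintegral_mono' (Measure.restrict_mono_measure hμ _) le_rfl
      _ = _ := by
          rw [lintegral_const_mul _ (by fun_prop), lintegral_abs_sub_le hH hR,
            ENNReal.ofReal_mul ha]
  · have hpq : (1 / H).HolderConjugate (1 / (1 - H)) := by
      rw [Real.holderConjugate_iff]
      constructor
      · rw [lt_div_iff₀] <;> linarith
      · simp
    have hexp (r : ℝ) : ENNReal.ofReal (|r - s| ^ (2 * H - 2)) ^ (1 / (1 - H)) =
        ENNReal.ofReal (|r - s| ^ (-2 : ℝ)) := by
      rw [ENNReal.ofReal_rpow_of_nonneg (by positivity)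
        (one_div_nonneg.2 (by linarith)), ← Real.rpow_mul (abs_nonneg _)]
      congr 2
      have : 1 - H ≠ 0 := by linarith
      field_simp; ring
    calc ∫⁻ r in {r | R < |r - s|}, {r | φ r ≤ ENNReal.ofReal a}.indicator
          (fun r => φ r * ENNReal.ofReal (|r - s| ^ (2 * H - 2))) r ∂μ
        ≤ ∫⁻ r in {r | R < |r - s|},
            φ r * ENNReal.ofReal (|r - s| ^ (2 * H - 2)) ∂μ :=
          lintegral_mono fun r => indicator_le_self _ _ _
      _ ≤ (∫⁻ r in {r | R < |r - s|}, φ r ^ (1 / H) ∂μ) ^ (1 / (1 / H)) *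
            (∫⁻ r in {r | R < |r - s|},
              ENNReal.ofReal (|r - s| ^ (2 * H - 2)) ^ (1 / (1 - H)) ∂μ) ^ (1 / (1 / (1 - H))) :=
          ENNReal.lintegral_mul_le_Lp_mul_Lq _ hpq hφ.aemeasurable (by fun_prop)
      _ ≤ (∫⁻ r, φ r ^ (1 / H) ∂μ) ^ H * (ENNReal.ofReal (2 / R)) ^ (1 - H) := by
          rw [one_div_one_div, one_div_one_div]
          simp_rw [hexp]
          refine mul_le_mul' (ENNReal.rpow_le_rpow (setLIntegral_le_lintegral _ _) (by linarith))
            (ENNReal.rpow_le_rpow ?_ (by linarith))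
          rw [← lintegral_abs_sub_inv_sq hR s]
          exact lintegral_mono' (Measure.restrict_mono_measure hμ _) le_rfl
      _ = _ := by rw [ENNReal.ofReal_rpow_of_nonneg (by positivity) (by linarith)]

/-- The diagonal case of the Hardy–Littlewood–Sobolev inequality. By symmetry it is enough to
integrate over `φ(r) ≤ φ(s)`; there the choice `R = I φ(s)^{-1/H}`, with `I = ∫ φ^{1/H}`,
balances the near and the far part of the potential. -/
lemma lintegral_lintegral_abs_sub_le {H : ℝ} (hH : 1 / 2 < H) (hH1 : H < 1) {φ : ℝ → ℝ≥0∞}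
    (hφ : Measurable φ) (μ : Measure ℝ) [SFinite μ] (hμ : μ ≤ volume) :
    ∫⁻ s, ∫⁻ r, φ s * φ r * ENNReal.ofReal (|r - s| ^ (2 * H - 2)) ∂μ ∂μ ≤
      ENNReal.ofReal (2 * (2 / (2 * H - 1) + 2 ^ (1 - H))) *
        (∫⁻ s, φ s ^ (1 / H) ∂μ) ^ (2 * H) := by
  have hH0 : 0 < H := by linarith
  set I := ∫⁻ s, φ s ^ (1 / H) ∂μ with hI
  have hc : 0 < 2 / (2 * H - 1) + (2 : ℝ) ^ (1 - H) := by
    have : 0 < 2 * H - 1 := by linarith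
    positivity
  rcases eq_or_ne I ⊤ with hItop | hItop
  · rw [hItop, ENNReal.top_rpow_of_pos (by linarith), ENNReal.mul_top]
    · exact le_top
    · simpa using hc
  rcases eq_or_ne I 0 with hI0 | hI0
  · have h0 : ∀ᵐ s ∂μ, φ s = 0 := by
      filter_upwards [(lintegral_eq_zero_iff (hφ.pow_const _)).1 hI0] with s hs
      simpa [hH0, hH0.not_gt] using hs
    refine le_of_eq_of_le ?_ zero_le
    rw [lintegral_eq_zero_iff' (by fun_prop)]
    filter_upwards [h0] with s hs
    simp [hs]
  set J := I.toReal with hJ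
  have hIJ : I = ENNReal.ofReal J := (ENNReal.ofReal_toReal hItop).symm
  have hJ0 : 0 < J := ENNReal.toReal_pos hI0 hItop
  -- the half of the double integral over `φ r ≤ φ s`
  set F : ℝ → ℝ → ℝ≥0∞ := fun s r => {q : ℝ × ℝ | φ q.2 ≤ φ q.1}.indicator
    (fun q => φ q.1 * φ q.2 * ENNReal.ofReal (|q.2 - q.1| ^ (2 * H - 2))) (s, r) with hF
  have hFm : Measurable (Function.uncurry F) := by
    refine Measurable.indicator (by fun_prop) (measurableSet_le (by fun_prop) (by fun_prop))
  have hsplit (s r : ℝ) : φ s * φ r * ENNReal.ofReal (|r - s| ^ (2 * H - 2)) ≤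
      F s r + F r s := by
    simp only [hF]
    rcases le_total (φ r) (φ s) with h | h
    · refine le_trans (le_of_eq ?_) le_self_add
      rw [indicator_of_mem (by exact h)]
    · refine le_trans (le_of_eq ?_) le_add_self
      rw [indicator_of_mem (by exact h), abs_sub_comm, mul_comm (φ s)]
  have hhalf : ∫⁻ s, ∫⁻ r, F s r ∂μ ∂μ ≤
      ENNReal.ofReal (2 / (2 * H - 1) + 2 ^ (1 - H)) * I ^ (2 * H) := by
    have hfin : ∀ᵐ s ∂μ, φ s ≠ ⊤ := by
      filter_upwards [ae_lt_top (hφ.pow_const (1 / H)) hItop] with s hs htop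
      rw [htop, ENNReal.top_rpow_of_pos (by positivity)] at hs
      exact lt_irrefl _ hs
    have hpt : ∀ᵐ s ∂μ, ∫⁻ r, F s r ∂μ ≤
        ENNReal.ofReal ((2 / (2 * H - 1) + 2 ^ (1 - H)) * J ^ (2 * H - 1)) * φ s ^ (1 / H) := by
      filter_upwards [hfin] with s hs
      rcases eq_or_ne (φ s) 0 with h0 | h0
      · refine le_of_eq_of_le ?_ zero_le
        simp [hF, h0, indicator]
      set a := (φ s).toReal with ha
      have hφa : φ s = ENNReal.ofReal a := (ENNReal.ofReal_toReal hs).symm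
      have ha0 : 0 < a := ENNReal.toReal_pos h0 hs
      have hR : 0 < J * a ^ (-(1 / H)) := by positivity
      have hFs : ∫⁻ r, F s r ∂μ = φ s * ∫⁻ r, {r | φ r ≤ ENNReal.ofReal a}.indicator
          (fun r => φ r * ENNReal.ofReal (|r - s| ^ (2 * H - 2))) r ∂μ := by
        rw [← lintegral_const_mul _ (Measurable.indicator (by fun_prop)
          (measurableSet_le hφ measurable_const))]
        refine lintegral_congr fun r => ?_
        simp only [hF, indicator, mem_ofPred_eq, ← hφa, mul_ite, mul_zero, mul_assoc]
      rw [hFs]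
      refine (mul_le_mul_right (lintegral_truncated_potential_le hH hH1 hφ μ hμ ha0.le hR s)
        _).trans_eq ?_
      have hH' : 0 < 2 * H - 1 := by linarith
      rw [← hI, hIJ, ENNReal.ofReal_rpow_of_pos hJ0, ← ENNReal.ofReal_mul (by positivity),
        ← ENNReal.ofReal_add (by positivity) (by positivity), hφa,
        ← ENNReal.ofReal_mul (by positivity), ENNReal.ofReal_rpow_of_pos ha0,
        ← ENNReal.ofReal_mul (by positivity)]
      congr 1
      have e1 : (J * a ^ (-(1 / H))) ^ (2 * H - 1) = J ^ (2 * H - 1) * a ^ (1 / H - 2) := by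
        rw [Real.mul_rpow hJ0.le (by positivity), ← Real.rpow_mul ha0.le]
        congr 2
        field_simp; ring
      have e2 : (2 / (J * a ^ (-(1 / H)))) ^ (1 - H) =
          2 ^ (1 - H) * (J ^ (H - 1) * a ^ (1 / H - 1)) := by
        rw [Real.div_rpow (by norm_num) (by positivity), Real.mul_rpow hJ0.le (by positivity),
          ← Real.rpow_mul ha0.le, div_eq_mul_inv, mul_inv, ← Real.rpow_neg hJ0.le,
          ← Real.rpow_neg ha0.le]
        congr 3
        · ring
        · field_simp
      have e3 : a ^ (1 / H) = a * a * a ^ (1 / H - 2) := by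
        nth_rw 2 3 [← Real.rpow_one a]
        rw [← Real.rpow_add ha0, ← Real.rpow_add ha0]; congr 1; ring
      have e4 : a ^ (1 / H - 1) = a * a ^ (1 / H - 2) := by
        nth_rw 2 [← Real.rpow_one a]
        rw [← Real.rpow_add ha0]; congr 1; ring
      have e5 : J ^ (2 * H - 1) = J ^ H * J ^ (H - 1) := by
        rw [← Real.rpow_add hJ0]; congr 1; ring
      rw [e1, e2, e4, e3, e5]
      ring
    calc ∫⁻ s, ∫⁻ r, F s r ∂μ ∂μ
        ≤ ∫⁻ s, ENNReal.ofReal ((2 / (2 * H - 1) + 2 ^ (1 - H)) * J ^ (2 * H - 1)) *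
            φ s ^ (1 / H) ∂μ := lintegral_mono_ae hpt
      _ = _ := by
          rw [lintegral_const_mul _ (by fun_prop), ← hI, hIJ, ENNReal.ofReal_rpow_of_pos hJ0,
            ← ENNReal.ofReal_mul (by positivity), ← ENNReal.ofReal_mul (by positivity), mul_assoc]
          congr 2
          nth_rw 2 [← Real.rpow_one J]
          rw [← Real.rpow_add hJ0]; congr 1; ring
  calc ∫⁻ s, ∫⁻ r, φ s * φ r * ENNReal.ofReal (|r - s| ^ (2 * H - 2)) ∂μ ∂μ
      ≤ ∫⁻ s, ∫⁻ r, (F s r + F r s) ∂μ ∂μ := lintegral_mono fun s => lintegral_mono (hsplit s)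
    _ = ∫⁻ s, ∫⁻ r, F s r ∂μ ∂μ + ∫⁻ s, ∫⁻ r, F r s ∂μ ∂μ := by
        rw [← lintegral_add_left (hFm.lintegral_prod_right (f := F))]
        refine lintegral_congr fun s => lintegral_add_left (hFm.comp measurable_prodMk_left) _
    _ = 2 * ∫⁻ s, ∫⁻ r, F s r ∂μ ∂μ := by
        rw [lintegral_lintegral_swap (f := fun s r => F r s)
          (hFm.comp measurable_swap).aemeasurable, two_mul]
    _ ≤ 2 * (ENNReal.ofReal (2 / (2 * H - 1) + 2 ^ (1 - H)) * I ^ (2 * H)) := by gcongr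
    _ = _ := by
        rw [ENNReal.ofReal_mul (by norm_num), ENNReal.ofReal_ofNat, mul_assoc]

lemma alphaH_pos {H : ℝ} (hH : 1 / 2 < H) : 0 < alphaH H :=
  mul_pos (by linarith) (by linarith)

lemma exists_isTimeConst {H : ℝ} (hH : 1 / 2 < H) (hH1 : H < 1) : ∃ β, IsTimeConst H β := by
  have hα := alphaH_pos hH
  have hc : 0 < 2 / (2 * H - 1) + (2 : ℝ) ^ (1 - H) := by
    have : 0 < 2 * H - 1 := by linarith
    positivity
  refine ⟨√(alphaH H * (2 * (2 / (2 * H - 1) + 2 ^ (1 - H)))), by positivity, fun φ hφ => ?_⟩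
  rw [Real.sq_sqrt (by positivity), ENNReal.ofReal_mul hα.le, mul_assoc]
  gcongr
  exact lintegral_lintegral_abs_sub_le hH hH1 hφ _ Measure.restrict_le_self

section

/-! ### Cauchy–Schwarz for kernels given by feature functions -/

section Feature

variable {X Y E : Type*} [MeasurableSpace X] [MeasurableSpace Y] [MeasurableSpace E]
  {μ : Measure X} {ρ : Measure Y} {m : Measure E} [SFinite μ] [SFinite ρ] [SFinite m]

lemma lintegral_lintegral_feature_eq {h₁ : X → E → ℝ≥0∞} {h₂ : Y → E → ℝ≥0∞}
    (hm₁ : Measurable (Function.uncurry h₁)) (hm₂ : Measurable (Function.uncurry h₂)) :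
    ∫⁻ x, ∫⁻ y, ∫⁻ e, h₁ x e * h₂ y e ∂m ∂ρ ∂μ =
      ∫⁻ e, (∫⁻ x, h₁ x e ∂μ) * (∫⁻ y, h₂ y e ∂ρ) ∂m := by
  have e1 (x : X) : ∫⁻ y, ∫⁻ e, h₁ x e * h₂ y e ∂m ∂ρ =
      ∫⁻ e, h₁ x e * ∫⁻ y, h₂ y e ∂ρ ∂m := by
    have hx : Measurable (h₁ x) := hm₁.comp measurable_prodMk_left
    rw [lintegral_lintegral_swap ((hx.comp measurable_snd).mul hm₂).aemeasurable]
    refine lintegral_congr fun e => lintegral_const_mul _ (hm₂.comp measurable_prodMk_right)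
  simp_rw [e1]
  have hm : Measurable fun e => ∫⁻ y, h₂ y e ∂ρ := hm₂.lintegral_prod_left (f := h₂)
  rw [lintegral_lintegral_swap (hm₁.mul (hm.comp measurable_snd)).aemeasurable]
  refine lintegral_congr fun e => lintegral_mul_const _ (hm₁.comp measurable_prodMk_right)

lemma lintegral_lintegral_feature_le {h₁ : X → E → ℝ≥0∞} {h₂ : Y → E → ℝ≥0∞}
    (hm₁ : Measurable (Function.uncurry h₁)) (hm₂ : Measurable (Function.uncurry h₂)) :
    ∫⁻ x, ∫⁻ y, ∫⁻ e, h₁ x e * h₂ y e ∂m ∂ρ ∂μ ≤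
      (∫⁻ x, ∫⁻ x', ∫⁻ e, h₁ x e * h₁ x' e ∂m ∂μ ∂μ) ^ (1 / 2 : ℝ) *
        (∫⁻ y, ∫⁻ y', ∫⁻ e, h₂ y e * h₂ y' e ∂m ∂ρ ∂ρ) ^ (1 / 2 : ℝ) := by
  rw [lintegral_lintegral_feature_eq hm₁ hm₂, lintegral_lintegral_feature_eq hm₁ hm₁,
    lintegral_lintegral_feature_eq hm₂ hm₂]
  have h := ENNReal.lintegral_mul_le_Lp_mul_Lq m Real.HolderConjugate.two_two
    (hm₁.lintegral_prod_left (f := h₁) (μ := μ)).aemeasurable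
    (hm₂.lintegral_prod_left (f := h₂) (μ := ρ)).aemeasurable
  simpa only [Pi.mul_apply, ENNReal.rpow_ofNat, sq] using h

end Feature

/-! ### The bilinear and the tensorized time inequality -/

/-- The kernel `|r - s|^{2H-2}` is positive definite, being a one-dimensional Riesz kernel. Hence
its bilinear form satisfies the Cauchy–Schwarz inequality. -/
lemma lintegral_abs_sub_bilinear_le {H : ℝ} (hH : 1 / 2 < H) (hH1 : H < 1) {φ ψ : ℝ → ℝ≥0∞}
    (hφ : Measurable φ) (hψ : Measurable ψ) (μ : Measure ℝ) [SFinite μ] (hμ : μ ≪ volume) :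
    ∫⁻ s, ∫⁻ r, φ s * ψ r * ENNReal.ofReal (|r - s| ^ (2 * H - 2)) ∂μ ∂μ ≤
      (∫⁻ s, ∫⁻ r, φ s * φ r * ENNReal.ofReal (|r - s| ^ (2 * H - 2)) ∂μ ∂μ) ^ (1 / 2 : ℝ) *
        (∫⁻ s, ∫⁻ r, ψ s * ψ r * ENNReal.ofReal (|r - s| ^ (2 * H - 2)) ∂μ ∂μ) ^ (1 / 2 : ℝ) := by
  obtain ⟨ν, hν, -⟩ := IsRieszOrBessel.exists_mixture (d := 1) (α := 2 * H - 1) (by linarith)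
    (by push_cast; linarith) (Or.inl rfl)
  have := hν.sigmaFinite
  set ι : ℝ → EuclideanSpace ℝ (Fin 1) := fun s => WithLp.toLp 2 fun _ => s with hι
  have hιm : Measurable ι := by fun_prop
  have hnorm (r s : ℝ) : ‖ι r - ι s‖ = |r - s| := by
    simp [EuclideanSpace.norm_eq, hι, Real.sqrt_sq_eq_abs]
  set c : ℝ := Real.Gamma (((1 : ℕ) - (2 * H - 1)) / 2) * 2 ^ (-(2 * H - 1)) *
    Real.pi ^ (-(((1 : ℕ) : ℝ) / 2)) / Real.Gamma ((2 * H - 1) / 2) with hc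
  have hc0 : 0 < c := by
    have h1 : 0 < Real.Gamma (((1 : ℕ) - (2 * H - 1)) / 2) :=
      Real.Gamma_pos_of_pos (by push_cast; linarith)
    have h2 : 0 < Real.Gamma ((2 * H - 1) / 2) := Real.Gamma_pos_of_pos (by linarith)
    positivity
  have hker (r s : ℝ) (hrs : r ≠ s) :
      ENNReal.ofReal c * ENNReal.ofReal (|r - s| ^ (2 * H - 2)) =
      ∫⁻ e, mixtureFactor 1 0 e (ι r) * mixtureFactor 1 0 e (ι s) ∂(ν.prod volume) := by
    have hne : ι r - ι s ≠ 0 := by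
      rw [← norm_ne_zero_iff, hnorm]
      exact abs_ne_zero.2 (sub_ne_zero.2 hrs)
    rw [← mixture_eq_lintegral_mixtureFactor hν.pos le_rfl, ← hν.eq_mixture _ hne, rieszKernel,
      hnorm, ← ENNReal.ofReal_mul hc0.le, hc]
    congr 3
    push_cast; ring
  have key (φ ψ : ℝ → ℝ≥0∞) (hφ : Measurable φ) (hψ : Measurable ψ) :
      ∫⁻ s, ∫⁻ r, ∫⁻ e, (φ s * mixtureFactor 1 0 e (ι s)) * (ψ r * mixtureFactor 1 0 e (ι r))
        ∂(ν.prod volume) ∂μ ∂μ =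
      ENNReal.ofReal c *
        ∫⁻ s, ∫⁻ r, φ s * ψ r * ENNReal.ofReal (|r - s| ^ (2 * H - 2)) ∂μ ∂μ := by
    rw [← lintegral_const_mul]
    swap
    · exact Measurable.lintegral_prod_right (f := fun s r : ℝ =>
        φ s * ψ r * ENNReal.ofReal (|r - s| ^ (2 * H - 2)))
        (by simp only [Function.uncurry_def]; fun_prop)
    refine lintegral_congr fun s => ?_
    rw [← lintegral_const_mul _ (by fun_prop)]
    refine lintegral_congr_ae ?_
    filter_upwards [hμ.ae_le (Measure.ae_ne volume s)] with r hr
    rw [mul_left_comm, hker r s hr, ← lintegral_const_mul _ (by fun_prop)]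
    exact lintegral_congr fun e => by ring
  have h := lintegral_lintegral_feature_le (μ := μ) (ρ := μ) (m := ν.prod volume)
    (h₁ := fun s e => φ s * mixtureFactor 1 0 e (ι s))
    (h₂ := fun r e => ψ r * mixtureFactor 1 0 e (ι r))
    (by simp only [Function.uncurry_def]; fun_prop) (by simp only [Function.uncurry_def]; fun_prop)
  rw [key φ ψ hφ hψ, key φ φ hφ hφ, key ψ ψ hψ hψ, ENNReal.mul_rpow_of_nonneg _ _ (by norm_num),
    ENNReal.mul_rpow_of_nonneg _ _ (by norm_num), mul_mul_mul_comm, ← ENNReal.rpow_add _ _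
    (by simpa using hc0) ENNReal.ofReal_ne_top, add_halves, ENNReal.rpow_one] at h
  exact (ENNReal.mul_le_mul_iff_right (by simpa using hc0) ENNReal.ofReal_ne_top).1 h

lemma IsTimeConst.bilinear_le {H β : ℝ} (hH : 1 / 2 < H) (hH1 : H < 1) (hβ : IsTimeConst H β)
    {φ ψ : ℝ → ℝ≥0∞} (hφ : Measurable φ) (hψ : Measurable ψ) :
    ENNReal.ofReal (alphaH H) * (∫⁻ s in Ioi (0 : ℝ), ∫⁻ r in Ioi (0 : ℝ),
        φ s * ψ r * ENNReal.ofReal (|r - s| ^ (2 * H - 2))) ≤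
      ENNReal.ofReal (β ^ 2) * ((∫⁻ s in Ioi (0 : ℝ), φ s ^ (1 / H)) ^ H *
        (∫⁻ s in Ioi (0 : ℝ), ψ s ^ (1 / H)) ^ H) := by
  have hα := alphaH_pos hH
  have hα0 : ENNReal.ofReal (alphaH H) ≠ 0 := by simpa using hα
  have hβ0 : ENNReal.ofReal (β ^ 2) ≠ 0 := by
    have := hβ.1
    simp only [ne_eq, ENNReal.ofReal_eq_zero, not_le]; positivity
  have hroot (x : ℝ≥0∞) (hx0 : x ≠ 0) (hx : x ≠ ⊤) : x = x ^ (1 / 2 : ℝ) * x ^ (1 / 2 : ℝ) := by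
    rw [← ENNReal.rpow_add _ _ hx0 hx, add_halves, ENNReal.rpow_one]
  have hsq (φ : ℝ → ℝ≥0∞) (hφ : Measurable φ) :
      (ENNReal.ofReal (alphaH H) * ∫⁻ s in Ioi (0 : ℝ), ∫⁻ r in Ioi (0 : ℝ),
        φ s * φ r * ENNReal.ofReal (|r - s| ^ (2 * H - 2))) ^ (1 / 2 : ℝ) ≤
      ENNReal.ofReal (β ^ 2) ^ (1 / 2 : ℝ) * (∫⁻ s in Ioi (0 : ℝ), φ s ^ (1 / H)) ^ H := by
    refine (ENNReal.rpow_le_rpow (hβ.2 φ hφ) (by norm_num)).trans_eq ?_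
    rw [ENNReal.mul_rpow_of_nonneg _ _ (by norm_num), ← ENNReal.rpow_mul]
    congr 2; ring
  refine (mul_le_mul_right (lintegral_abs_sub_bilinear_le hH hH1 hφ hψ _
    Measure.absolutelyContinuous_restrict) _).trans ?_
  rw [hroot _ hα0 ENNReal.ofReal_ne_top, hroot _ hβ0 ENNReal.ofReal_ne_top, mul_mul_mul_comm,
    mul_mul_mul_comm (ENNReal.ofReal (β ^ 2) ^ (1 / 2 : ℝ)),
    ← ENNReal.mul_rpow_of_nonneg _ _ (by norm_num), ← ENNReal.mul_rpow_of_nonneg _ _ (by norm_num)]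
  exact mul_le_mul' (hsq φ hφ) (hsq ψ hψ)

/-- A bilinear `L^{1/H}` bound for a kernel passes to the tensor powers of the kernel: for fixed
first coordinates it is applied to the remaining ones, and then to the partial norms so obtained. -/
lemma lintegral_tensor_le {X : Type*} [MeasurableSpace X] {μ : Measure X} [SigmaFinite μ]
    {k : X × X → ℝ≥0∞} (hk : Measurable k) {C : ℝ≥0∞} {H : ℝ} (hH : 0 < H)
    (hC : ∀ φ ψ : X → ℝ≥0∞, Measurable φ → Measurable ψ →
      ∫⁻ q, φ q.1 * ψ q.2 * k q ∂(μ.prod μ) ≤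
        C * ((∫⁻ x, φ x ^ (1 / H) ∂μ) ^ H * (∫⁻ x, ψ x ^ (1 / H) ∂μ) ^ H))
    (n : ℕ) (φ ψ : (Fin n → X) → ℝ≥0∞) (hφ : Measurable φ) (hψ : Measurable ψ) :
    ∫⁻ q, φ (fun i => (q i).1) * ψ (fun i => (q i).2) * ∏ i, k (q i)
        ∂(Measure.pi fun _ : Fin n => μ.prod μ) ≤
      C ^ n * ((∫⁻ x, φ x ^ (1 / H) ∂(Measure.pi fun _ : Fin n => μ)) ^ H *
        (∫⁻ x, ψ x ^ (1 / H) ∂(Measure.pi fun _ : Fin n => μ)) ^ H) := by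
  induction n with
  | zero =>
    simp only [lintegral_pi_zero, ← ENNReal.rpow_mul, one_div_mul_cancel hH.ne', ENNReal.rpow_one]
    simp [Subsingleton.elim _ (Fin.elim0 : Fin 0 → X)]
  | succ n ih =>
    have hkn (n : ℕ) : Measurable fun q : Fin n → X × X => ∏ i, k (q i) :=
      Finset.measurable_fun_prod _ fun i _ => hk.comp (measurable_pi_apply i)
    have hcons (x : X) : Measurable fun y : Fin n → X => (Fin.cons x y : Fin (n + 1) → X) :=
      measurable_finCons measurable_const measurable_id
    have hcons' : Measurable fun p : X × (Fin n → X) => (Fin.cons p.1 p.2 : Fin (n + 1) → X) :=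
      measurable_finCons measurable_fst measurable_snd
    have hm : Measurable fun q : Fin (n + 1) → X × X =>
        φ (fun i => (q i).1) * ψ (fun i => (q i).2) * ∏ i, k (q i) :=
      ((hφ.comp (by fun_prop)).mul (hψ.comp (by fun_prop))).mul (hkn _)
    have hc1 (a : X × X) (q : Fin n → X × X) :
        (fun i => ((Fin.cons a q : Fin (n + 1) → X × X) i).1) =
          (Fin.cons a.1 fun i => (q i).1 : Fin (n + 1) → X) := by
      funext i; refine Fin.cases ?_ (fun j => ?_) i <;> simp
    have hc2 (a : X × X) (q : Fin n → X × X) :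
        (fun i => ((Fin.cons a q : Fin (n + 1) → X × X) i).2) =
          (Fin.cons a.2 fun i => (q i).2 : Fin (n + 1) → X) := by
      funext i; refine Fin.cases ?_ (fun j => ?_) i <;> simp
    set φ' : X → ℝ≥0∞ := fun x =>
      (∫⁻ y, φ (Fin.cons x y) ^ (1 / H) ∂(Measure.pi fun _ : Fin n => μ)) ^ H with hφ'
    set ψ' : X → ℝ≥0∞ := fun x =>
      (∫⁻ y, ψ (Fin.cons x y) ^ (1 / H) ∂(Measure.pi fun _ : Fin n => μ)) ^ H with hψ'
    have hint (φ : (Fin (n + 1) → X) → ℝ≥0∞) (hφ : Measurable φ) : ∫⁻ x, ((∫⁻ y,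
        φ (Fin.cons x y) ^ (1 / H) ∂(Measure.pi fun _ : Fin n => μ)) ^ H) ^ (1 / H) ∂μ =
        ∫⁻ x, φ x ^ (1 / H) ∂(Measure.pi fun _ : Fin (n + 1) => μ) := by
      rw [lintegral_pi_succ _ _ _ (hφ.pow_const _)]
      simp only [← ENNReal.rpow_mul, mul_one_div_cancel hH.ne', ENNReal.rpow_one]
    have hφm : Measurable φ' := Measurable.pow_const (Measurable.lintegral_prod_right
      (f := fun x y => φ (Fin.cons x y) ^ (1 / H)) ((hφ.comp hcons').pow_const _)) _
    have hψm : Measurable ψ' := Measurable.pow_const (Measurable.lintegral_prod_right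
      (f := fun x y => ψ (Fin.cons x y) ^ (1 / H)) ((hψ.comp hcons').pow_const _)) _
    rw [lintegral_pi_succ _ _ _ hm]
    simp only [hc1, hc2, Fin.prod_univ_succ, Fin.cons_zero, Fin.cons_succ]
    calc ∫⁻ a, ∫⁻ q, φ (Fin.cons a.1 fun i => (q i).1) * ψ (Fin.cons a.2 fun i => (q i).2) *
          (k a * ∏ i, k (q i)) ∂(Measure.pi fun _ : Fin n => μ.prod μ) ∂(μ.prod μ)
        ≤ ∫⁻ a, C ^ n * (φ' a.1 * ψ' a.2 * k a) ∂(μ.prod μ) := by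
          refine lintegral_mono fun a => ?_
          have := ih (fun y => φ (Fin.cons a.1 y)) (fun y => ψ (Fin.cons a.2 y))
            (hφ.comp (hcons _)) (hψ.comp (hcons _))
          calc _ = k a * ∫⁻ q, φ (Fin.cons a.1 fun i => (q i).1) *
                ψ (Fin.cons a.2 fun i => (q i).2) * ∏ i, k (q i)
                  ∂(Measure.pi fun _ : Fin n => μ.prod μ) := by
                have hmq : Measurable fun q : Fin n → X × X => φ (Fin.cons a.1 fun i => (q i).1) *
                    ψ (Fin.cons a.2 fun i => (q i).2) * ∏ i, k (q i) :=
                  (((hφ.comp (hcons _)).comp (by fun_prop)).mul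
                    ((hψ.comp (hcons _)).comp (by fun_prop))).mul (hkn _)
                rw [← lintegral_const_mul _ hmq]
                exact lintegral_congr fun q => by ring
            _ ≤ k a * (C ^ n * (φ' a.1 * ψ' a.2)) := by gcongr
            _ = _ := by ring
      _ = C ^ n * ∫⁻ a, φ' a.1 * ψ' a.2 * k a ∂(μ.prod μ) :=
          lintegral_const_mul _ (((hφm.comp measurable_fst).mul (hψm.comp measurable_snd)).mul hk)
      _ ≤ C ^ n * (C * ((∫⁻ x, φ' x ^ (1 / H) ∂μ) ^ H * (∫⁻ x, ψ' x ^ (1 / H) ∂μ) ^ H)) := by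
          gcongr
          exact hC φ' ψ' hφm hψm
      _ = _ := by
          rw [hφ', hψ', hint φ hφ, hint ψ hψ, pow_succ, mul_assoc]

end

/-! ### Dirichlet integrals over ordered times -/

lemma lintegral_beta_scaled {b c T : ℝ} (hb : 0 < b) (hc : 0 < c) (hT : 0 < T) :
    ∫⁻ x in Ioo 0 T, ENNReal.ofReal (x ^ (b - 1) * (T - x) ^ (c - 1)) =
      ENNReal.ofReal (T ^ (b + c - 1) * beta b c) := by
  have hβ := beta_pos hb hc
  rw [← lintegral_indicator measurableSet_Ioo]
  have hscale : ∀ g : ℝ → ℝ≥0∞, Measurable g →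
      ∫⁻ x, g x = ENNReal.ofReal T * ∫⁻ x, g (T * x) := fun g hg => by
    conv_lhs => rw [← Real.smul_map_volume_mul_left hT.ne']
    rw [lintegral_smul_measure, lintegral_map hg (measurable_const_mul T), abs_of_pos hT,
      smul_eq_mul]
  rw [hscale _ (Measurable.indicator (by fun_prop) measurableSet_Ioo)]
  have hpt (x : ℝ) : (Ioo 0 T).indicator
      (fun x => ENNReal.ofReal (x ^ (b - 1) * (T - x) ^ (c - 1))) (T * x) ≤
      ENNReal.ofReal (T ^ (b + c - 2) * beta b c) * betaPDF b c x ∧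
      ENNReal.ofReal (T ^ (b + c - 2) * beta b c) * betaPDF b c x ≤ (Ioo 0 T).indicator
      (fun x => ENNReal.ofReal (x ^ (b - 1) * (T - x) ^ (c - 1))) (T * x) := by
    rw [← le_antisymm_iff]
    by_cases hx : x ∈ Ioo (0 : ℝ) 1
    · have hx0 := hx.1
      have hx1 : 0 < 1 - x := by linarith [hx.2]
      rw [indicator_of_mem (show T * x ∈ Ioo 0 T from ⟨by positivity, by nlinarith [hx.2]⟩),
        betaPDF_of_pos_lt_one hx.1 hx.2, ← ENNReal.ofReal_mul (by positivity)]
      congr 1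
      rw [show T - T * x = T * (1 - x) by ring, Real.mul_rpow hT.le hx0.le,
        Real.mul_rpow hT.le hx1.le, show b + c - 2 = (b - 1) + (c - 1) by ring,
        Real.rpow_add hT]
      field_simp
    · rw [indicator_of_notMem]
      · rcases not_and_or.1 hx with h | h
        · rw [betaPDF_eq_zero_of_nonpos (not_lt.1 h), mul_zero]
        · rw [betaPDF_eq_zero_of_one_le (not_lt.1 h), mul_zero]
      · contrapose! hx
        refine ⟨pos_of_mul_pos_right hx.1 hT.le, ?_⟩
        have := hx.2
        by_contra! h
        nlinarith
  simp_rw [fun x => le_antisymm (hpt x).1 (hpt x).2]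
  have hm : Measurable (betaPDF b c) := (measurable_betaPDFReal b c).ennreal_ofReal
  rw [lintegral_const_mul _ hm, lintegral_betaPDF_eq_one hb hc, mul_one,
    ← ENNReal.ofReal_mul hT.le]
  congr 1
  rw [show b + c - 1 = 1 + (b + c - 2) by ring, Real.rpow_add hT, Real.rpow_one, mul_assoc]

/-- The weight `x^{-a}` of an increment `x ≥ 0`, extended by `0` to negative increments, so that
a product of such weights vanishes unless the times are ordered. For `a > 0` the weight of a zero
increment is `∞`. -/
def incrementWeight (a x : ℝ) : ℝ≥0∞ :=
  (Ici 0).indicator (fun x => ENNReal.ofReal x ^ (-a)) x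

@[fun_prop]
lemma measurable_incrementWeight (a : ℝ) : Measurable (incrementWeight a) :=
  Measurable.indicator (by fun_prop) measurableSet_Ici

/-- The product of the weights of the increments of `s, r₀, …, r_{n-1}`. -/
def orderedWeight (a : ℝ) {n : ℕ} (s : ℝ) (r : Fin n → ℝ) : ℝ≥0∞ :=
  ∏ i : Fin n, incrementWeight a (r i - (Fin.cons s r : Fin (n + 1) → ℝ) i.castSucc)

lemma orderedWeight_cons (a : ℝ) {n : ℕ} (s r₀ : ℝ) (r : Fin n → ℝ) :
    orderedWeight a s (Fin.cons r₀ r : Fin (n + 1) → ℝ) =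
      incrementWeight a (r₀ - s) * orderedWeight a r₀ r := by
  simp [orderedWeight, Fin.prod_univ_succ]

lemma measurable_orderedWeight (a : ℝ) (n : ℕ) :
    Measurable fun p : ℝ × (Fin n → ℝ) => orderedWeight a p.1 p.2 := by
  refine Finset.measurable_fun_prod _ fun i _ => (measurable_incrementWeight a).comp ?_
  exact ((measurable_pi_apply i).comp measurable_snd).sub
    ((measurable_pi_apply _).comp (measurable_finCons measurable_fst measurable_snd))

/-- The Dirichlet integral, by induction on the number of times, integrating out the first time
with the beta integral. -/
lemma lintegral_orderedWeight_le {a t : ℝ} (ha : a < 1) (n : ℕ) {s : ℝ} (hs : 0 ≤ s)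
    (hst : s ≤ t) :
    ∫⁻ r, orderedWeight a s r ∂(Measure.pi fun _ : Fin n => volume.restrict (Icc 0 t)) ≤
      ENNReal.ofReal (Real.Gamma (1 - a) ^ n * (t - s) ^ (n * (1 - a)) /
        Real.Gamma (n * (1 - a) + 1)) := by
  have hb : 0 < 1 - a := by linarith
  have hΓ : 0 < Real.Gamma (1 - a) := Real.Gamma_pos_of_pos hb
  induction n generalizing s with
  | zero => simp [orderedWeight]
  | succ n ih =>
    have hc : 0 < n * (1 - a) + 1 := by positivity
    have hΓn : 0 < Real.Gamma (n * (1 - a) + 1) := Real.Gamma_pos_of_pos hc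
    have hm : Measurable fun r : Fin (n + 1) → ℝ => orderedWeight a s r :=
      (measurable_orderedWeight a (n + 1)).comp measurable_prodMk_left
    have hm' (r₀ : ℝ) : Measurable fun r : Fin n → ℝ => orderedWeight a r₀ r :=
      (measurable_orderedWeight a n).comp measurable_prodMk_left
    rw [lintegral_pi_succ _ _ _ hm]
    simp_rw [orderedWeight_cons, lintegral_const_mul _ (hm' _)]
    calc ∫⁻ r₀ in Icc 0 t, incrementWeight a (r₀ - s) *
          ∫⁻ r, orderedWeight a r₀ r ∂(Measure.pi fun _ : Fin n => volume.restrict (Icc 0 t))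
        ≤ ∫⁻ r₀ in Icc 0 t, incrementWeight a (r₀ - s) *
          ENNReal.ofReal (Real.Gamma (1 - a) ^ n * (t - r₀) ^ (n * (1 - a)) /
            Real.Gamma (n * (1 - a) + 1)) :=
          setLIntegral_mono' measurableSet_Icc fun r₀ hr => by
            gcongr
            exact ih hr.1 hr.2
      _ ≤ ∫⁻ r₀ in Icc s t, incrementWeight a (r₀ - s) *
          ENNReal.ofReal (Real.Gamma (1 - a) ^ n * (t - r₀) ^ (n * (1 - a)) /
            Real.Gamma (n * (1 - a) + 1)) := by
          rw [← lintegral_indicator measurableSet_Icc, ← lintegral_indicator measurableSet_Icc]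
          refine lintegral_mono fun r => ?_
          by_cases hr : s ≤ r
          · by_cases h : r ∈ Icc 0 t
            · rw [indicator_of_mem h, indicator_of_mem (show r ∈ Icc s t from ⟨hr, h.2⟩)]
            · rw [indicator_of_notMem h]; exact zero_le
          · refine le_of_eq_of_le ?_ zero_le
            simp [incrementWeight, indicator, hr]
      _ = ∫⁻ r₀ in Ioo s t, ENNReal.ofReal (Real.Gamma (1 - a) ^ n /
            Real.Gamma (n * (1 - a) + 1)) * ENNReal.ofReal ((r₀ - s) ^ ((1 - a) - 1) *
              ((t - s) - (r₀ - s)) ^ ((n * (1 - a) + 1) - 1)) := by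
          rw [setLIntegral_congr Ioo_ae_eq_Icc.symm]
          refine setLIntegral_congr_fun measurableSet_Ioo fun r hr => ?_
          have h1 : 0 < r - s := sub_pos.2 hr.1
          have h2 : 0 < t - r := sub_pos.2 hr.2
          simp only [incrementWeight]
          rw [indicator_of_mem (show r - s ∈ Ici 0 from h1.le),
            ENNReal.ofReal_rpow_of_pos h1, ← ENNReal.ofReal_mul (by positivity),
            ← ENNReal.ofReal_mul (by positivity)]
          congr 1
          rw [sub_sub_sub_cancel_right, add_sub_cancel_right, sub_sub_cancel_left]
          ring
      _ = ENNReal.ofReal (Real.Gamma (1 - a) ^ n / Real.Gamma (n * (1 - a) + 1)) *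
            ∫⁻ x in Ioo 0 (t - s), ENNReal.ofReal (x ^ ((1 - a) - 1) *
              ((t - s) - x) ^ ((n * (1 - a) + 1) - 1)) := by
          rw [lintegral_const_mul _ (by fun_prop)]
          congr 1
          rw [← lintegral_indicator measurableSet_Ioo, ← lintegral_indicator measurableSet_Ioo,
            ← lintegral_sub_right_eq_self ((Ioo 0 (t - s)).indicator _) s]
          refine lintegral_congr fun r => ?_
          simp [indicator]
      _ ≤ _ := by
          rcases hst.eq_or_lt with rfl | hlt
          · simp
          rw [lintegral_beta_scaled hb hc (sub_pos.2 hlt), ← ENNReal.ofReal_mul (by positivity)]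
          refine (congrArg ENNReal.ofReal ?_).le
          rw [beta, show 1 - a + (n * (1 - a) + 1) - 1 = ((n + 1 : ℕ) : ℝ) * (1 - a) by
            push_cast; ring, show 1 - a + (n * (1 - a) + 1) = ((n + 1 : ℕ) : ℝ) * (1 - a) + 1 by
            push_cast; ring, pow_succ]
          field_simp

/-- Integrals of symmetric functions are bounded by `n!` times the integral over increasing
times. -/
lemma lintegral_symmetric_le {n : ℕ} (μ : Measure ℝ) [SigmaFinite μ] {S : (Fin n → ℝ) → ℝ≥0∞}
    (hS : Measurable S) (hsymm : ∀ (σ : Equiv.Perm (Fin n)) r, S (r ∘ σ) = S r) :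
    ∫⁻ r, S r ∂(Measure.pi fun _ => μ) ≤
      n.factorial * ∫⁻ r, {r | Monotone r}.indicator S r ∂(Measure.pi fun _ => μ) := by
  have hmono : MeasurableSet {r : Fin n → ℝ | Monotone r} := by
    simp only [Monotone, ofPred_forall]
    refine MeasurableSet.iInter fun i => MeasurableSet.iInter fun j => MeasurableSet.iInter
      fun _ => measurableSet_le (measurable_pi_apply i) (measurable_pi_apply j)
  have hperm (σ : Equiv.Perm (Fin n)) :
      ∫⁻ r, {r | Monotone r}.indicator S (r ∘ σ) ∂(Measure.pi fun _ => μ) =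
      ∫⁻ r, {r | Monotone r}.indicator S r ∂(Measure.pi fun _ => μ) := by
    have h := measurePreserving_arrowCongr' (fun _ : Fin n => μ) (fun _ : Fin n => μ) σ.symm
      (MeasurableEquiv.refl ℝ) fun _ => MeasurePreserving.id μ
    exact h.lintegral_comp_emb (MeasurableEquiv.measurableEmbedding _) _
  calc ∫⁻ r, S r ∂(Measure.pi fun _ => μ)
      ≤ ∫⁻ r, ∑ σ : Equiv.Perm (Fin n), {r | Monotone r}.indicator S (r ∘ σ)
          ∂(Measure.pi fun _ => μ) := by
        refine lintegral_mono fun r => ?_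
        refine le_trans (le_of_eq ?_)
          (Finset.single_le_sum (fun _ _ => zero_le) (Finset.mem_univ (Tuple.sort r)))
        rw [indicator_of_mem (show r ∘ Tuple.sort r ∈ {r | Monotone r} from
          Tuple.monotone_sort r), hsymm]
    _ = ∑ σ : Equiv.Perm (Fin n), ∫⁻ r, {r | Monotone r}.indicator S (r ∘ σ)
          ∂(Measure.pi fun _ => μ) := by
        refine lintegral_finsetSum _ fun σ _ => (hS.indicator hmono).comp ?_
        exact measurable_pi_lambda _ fun i => measurable_pi_apply _
    _ = _ := by
        simp_rw [hperm]
        rw [Finset.sum_const, Finset.card_univ, Fintype.card_perm, Fintype.card_fin, nsmul_eq_mul]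

/-- By log-convexity of `Γ`, the quotient `Γ(nb+1) / (n!^b b^{nb})` is nondecreasing in `n`. -/
lemma factorial_rpow_mul_le_Gamma {b : ℝ} (hb : 0 < b) (hb1 : b < 1) (n : ℕ) :
    (n.factorial : ℝ) ^ b * b ^ (n * b) ≤ Real.Gamma (n * b + 1) := by
  induction n with
  | zero => simp
  | succ n ih =>
    have hx : 0 < (n + 1) * b := by positivity
    have hΓ1 : 0 < Real.Gamma ((n + 1) * b) := Real.Gamma_pos_of_pos hx
    have hΓ2 : 0 < Real.Gamma ((n + 1) * b + 1) := Real.Gamma_pos_of_pos (by linarith)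
    have hconv := Real.Gamma_mul_add_mul_le_rpow_Gamma_mul_rpow_Gamma
      (s := (n + 1) * b + 1) (t := (n + 1) * b) (a := 1 - b) (b := b) (by linarith) hx
      (by linarith) hb (by ring)
    have harg : (1 - b) * ((n + 1) * b + 1) + b * ((n + 1) * b) = n * b + 1 := by ring
    rw [harg] at hconv
    have hΓ : Real.Gamma ((n + 1) * b) = Real.Gamma ((n + 1) * b + 1) / ((n + 1) * b) := by
      rw [Real.Gamma_add_one hx.ne']; field_simp
    rw [hΓ, Real.div_rpow hΓ2.le hx.le, ← mul_div_assoc, ← Real.rpow_add hΓ2, sub_add_cancel,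
      Real.rpow_one, le_div_iff₀ (by positivity)] at hconv
    push_cast [Nat.factorial_succ]
    refine le_trans (le_of_eq ?_) ((mul_le_mul_of_nonneg_right ih (by positivity)).trans hconv)
    rw [Real.mul_rpow (by positivity) (by positivity), Real.mul_rpow (by positivity) hb.le,
      add_mul, one_mul, Real.rpow_add hb]
    ring

section

/-! ### Brownian motion: measurable versions and the Markov property -/

section Independence

variable {Ω : Type*} [MeasurableSpace Ω] {P : Measure Ω} [IsProbabilityMeasure P]

lemma lintegral_indepFun {α β : Type*} [MeasurableSpace α] [MeasurableSpace β] {X : Ω → α}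
    {Y : Ω → β} (hX : Measurable X) (hY : Measurable Y) (hXY : IndepFun X Y P)
    {F : α → β → ℝ≥0∞} (hF : Measurable (Function.uncurry F)) :
    ∫⁻ ω, F (X ω) (Y ω) ∂P = ∫⁻ ω, ∫⁻ ω', F (X ω) (Y ω') ∂P ∂P := by
  have h := (indepFun_iff_map_prod_eq_prod_map_map hX.aemeasurable hY.aemeasurable).1 hXY
  have h1 : ∫⁻ ω, F (X ω) (Y ω) ∂P =
      ∫⁻ p, Function.uncurry F p ∂(P.map fun ω => (X ω, Y ω)) := by
    rw [lintegral_map hF (hX.prodMk hY)]; rfl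
  have := Measure.isProbabilityMeasure_map (μ := P) hX.aemeasurable
  have := Measure.isProbabilityMeasure_map (μ := P) hY.aemeasurable
  rw [h1, h, lintegral_prod _ hF.aemeasurable, lintegral_map _ hX]
  · refine lintegral_congr fun ω => ?_
    exact lintegral_map (hF.comp measurable_prodMk_left) hY
  · exact hF.lintegral_prod_right'

lemma iIndepFun_bool {α : Type*} [MeasurableSpace α] {X : Bool → Ω → α}
    (h : IndepFun (X false) (X true) P) : iIndepFun X P := by
  rw [iIndepFun_iff_measure_inter_preimage_eq_mul]
  intro S sets hsets
  have hS : S = ∅ ∨ S = {false} ∨ S = {true} ∨ S = {false, true} := by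
    clear hsets; revert S; decide
  rcases hS with rfl | rfl | rfl | rfl
  · simp
  · simp
  · simp
  · have := h.measure_inter_preimage_eq_mul _ _ (hsets false (by simp)) (hsets true (by simp))
    rw [Finset.prod_pair (by decide), ← this]
    congr 1
    ext ω
    simp

/-- Independence of two components passes from the members of an independent family to the
vectors of all first and of all second components. -/
lemma indepFun_pi_of_iIndepFun {ι α : Type*} [Fintype ι] [MeasurableSpace α]
    {X Y : ι → Ω → α} (hX : ∀ i, Measurable (X i)) (hY : ∀ i, Measurable (Y i))
    (h : iIndepFun (fun i ω => (X i ω, Y i ω)) P) (hXY : ∀ i, IndepFun (X i) (Y i) P) :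
    IndepFun (fun ω i => X i ω) (fun ω i => Y i ω) P := by
  classical
  have hm : ∀ i (b : Bool), Measurable fun ω => bif b then Y i ω else X i ω := fun i b => by
    cases b
    · exact hX i
    · exact hY i
  have h1 : iIndepFun (fun i ω (b : Bool) => bif b then Y i ω else X i ω) P :=
    h.comp (fun _ p (b : Bool) => bif b then p.2 else p.1) fun _ =>
      measurable_pi_lambda _ fun b => by
        cases b
        · exact measurable_fst
        · exact measurable_snd
  have h2 := iIndepFun_uncurry' (P := P) (X := fun i (b : Bool) ω => bif b then Y i ω else X i ω)
    hm h1 fun i => iIndepFun_bool (hXY i)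
  have h3 := h2.indepFun_finset (Finset.univ.filter fun p : ι × Bool => p.2 = false)
    (Finset.univ.filter fun p : ι × Bool => p.2 = true)
    (Finset.disjoint_filter.2 fun p _ h => by simp [h]) fun p => hm p.1 p.2
  exact h3.comp
    (φ := fun g i => g ⟨(i, false), by simp⟩) (ψ := fun g i => g ⟨(i, true), by simp⟩)
    (measurable_pi_lambda _ fun i => measurable_pi_apply _)
    (measurable_pi_lambda _ fun i => measurable_pi_apply _)

end Independence

variable {Ω : Type*} [MeasurableSpace Ω] {P : Measure Ω} {d : ℕ}

/-- A jointly measurable process started at the origin with the Markov property of Brownian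
motion: conditionally on the path up to time `s`, the position at time `u ≥ s` is Gaussian with mean
the position at time `s` and variance `u - s`. It is stated only for Gaussian test functions, for
which conditioning just adds `u - s` to the variance. -/
structure IsHeatMarkov (P : Measure Ω) (d : ℕ) (W : ℝ≥0 → Ω → EuclideanSpace ℝ (Fin d)) :
    Prop where
  measurable : Measurable (Function.uncurry W)
  zero : ∀ᵐ ω ∂P, W 0 ω = 0
  markov : ∀ (m : ℕ) (τ : Fin m → ℝ≥0) (s u : ℝ≥0), (∀ k, τ k ≤ s) → s ≤ u →
    ∀ (v : ℝ), 0 < v → ∀ G : (Fin m → EuclideanSpace ℝ (Fin d)) → ℝ≥0∞, Measurable G →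
    ∀ y : EuclideanSpace ℝ (Fin d),
      ∫⁻ ω, G (fun k => W (τ k) ω) * heatENN d v (W u ω - y) ∂P =
        ∫⁻ ω, G (fun k => W (τ k) ω) * heatENN d (v + (u - s)) (W s ω - y) ∂P

/-- Continuous paths and measurability at a dense sequence of times, both valid outside one null
set, give joint measurability after the process has been set to `0` on that null set. -/
lemma IsStdBrownian.exists_measurable_version [IsProbabilityMeasure P]
    {B : ℝ≥0 → Ω → EuclideanSpace ℝ (Fin d)} (hB : IsStdBrownian P d B) :
    ∃ W : ℝ≥0 → Ω → EuclideanSpace ℝ (Fin d),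
      Measurable (Function.uncurry W) ∧ ∀ᵐ ω ∂P, ∀ t, W t ω = B t ω := by
  classical
  have hBm (t : ℝ≥0) : AEMeasurable (B t) P := by
    have : AEMeasurable (fun ω i => B t ω i) P :=
      aemeasurable_pi_lambda _ fun i => (hB.coord i).toIsPreBrownianReal.aemeasurable t
    exact (MeasurableEquiv.toLp 2 (Fin d → ℝ)).measurable.comp_aemeasurable this
  have hcont : ∀ᵐ ω ∂P, Continuous fun t => B t ω := by
    filter_upwards [ae_all_iff.2 fun i => (hB.coord i).cont] with ω hω
    exact (PiLp.continuous_toLp 2 _).comp (continuous_pi hω)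
  have hdense : ∀ᵐ ω ∂P, ∀ k, B (TopologicalSpace.denseSeq ℝ≥0 k) ω =
      (hBm (TopologicalSpace.denseSeq ℝ≥0 k)).mk _ ω :=
    ae_all_iff.2 fun k => (hBm _).ae_eq_mk
  obtain ⟨S, hSsub, hSm, hS0⟩ := exists_measurable_superset_of_null
    (ae_iff.1 (hcont.and hdense))
  have hgood (ω : Ω) (hω : ω ∉ S) := not_not.1 fun h => hω (hSsub h)
  set W : ℝ≥0 → Ω → EuclideanSpace ℝ (Fin d) := fun t => Sᶜ.indicator (B t) with hW
  have hWcont (ω : Ω) : Continuous fun t => W t ω := by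
    by_cases hω : ω ∈ S
    · have (t : ℝ≥0) : W t ω = 0 := indicator_of_notMem (show ω ∉ Sᶜ from fun h => h hω) _
      simp only [this]
      exact continuous_const
    · have (t : ℝ≥0) : W t ω = B t ω := indicator_of_mem (show ω ∈ Sᶜ from hω) _
      simp only [this]
      exact (hgood ω hω).1
  have hWdense (k : ℕ) : Measurable (W (TopologicalSpace.denseSeq ℝ≥0 k)) := by
    have : W (TopologicalSpace.denseSeq ℝ≥0 k) =
        Sᶜ.indicator ((hBm (TopologicalSpace.denseSeq ℝ≥0 k)).mk _) := by
      funext ω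
      by_cases hω : ω ∈ Sᶜ
      · simp only [hW, indicator_of_mem hω]
        exact (hgood ω hω).2 k
      · simp only [hW, indicator_of_notMem hω]
    rw [this]
    exact (hBm _).measurable_mk.indicator hSm.compl
  have hWm (t : ℝ≥0) : Measurable (W t) := by
    obtain ⟨x, hx, hxt⟩ := mem_closure_iff_seq_limit.1
      ((TopologicalSpace.denseRange_denseSeq ℝ≥0) t)
    refine measurable_of_tendsto_metrizable (f := fun n => W (x n)) (fun n => ?_)
      (tendsto_pi_nhds.2 fun ω => ((hWcont ω).tendsto t).comp hxt)
    obtain ⟨k, hk⟩ := hx n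
    rw [← hk]
    exact hWdense k
  refine ⟨W, measurable_uncurry_of_continuous_of_measurable hWcont hWm, ?_⟩
  have : ∀ᵐ ω ∂P, ω ∉ S := measure_eq_zero_iff_ae_notMem.1 hS0
  filter_upwards [this] with ω hω t
  simp only [hW, indicator_of_mem (show ω ∈ Sᶜ from hω)]

lemma lintegral_heatENN_add_gaussian [IsProbabilityMeasure P]
    {Z : Ω → EuclideanSpace ℝ (Fin d)} (hZ : Measurable Z) {σ : ℝ≥0}
    (hlaw : ∀ i, P.map (fun ω => Z ω i) = gaussianReal 0 σ)
    (hind : iIndepFun (fun i ω => Z ω i) P) {v : ℝ} (hv : 0 < v)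
    (x : EuclideanSpace ℝ (Fin d)) :
    ∫⁻ ω, heatENN d v (x + Z ω) ∂P = heatENN d (v + σ) x := by
  have hv' := Real.toNNReal_pos.2 hv
  have hZi (i : Fin d) : Measurable fun ω => Z ω i := by fun_prop
  have hg (i : Fin d) : Measurable fun y => gaussianPDF 0 v.toNNReal (x i + y) :=
    (measurable_gaussianPDF _ _).comp (measurable_const_add _)
  rw [heatENN_eq_prod (by positivity), Real.toNNReal_add hv.le σ.coe_nonneg, Real.toNNReal_coe]
  simp_rw [heatENN_eq_prod hv, ← lintegral_gaussianPDF_gaussianReal hv']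
  have h := lintegral_prod_eq_prod_lintegral_of_indepFun Finset.univ
    (fun i ω => gaussianPDF 0 v.toNNReal (x i + Z ω i))
    (hind.comp (fun i y => gaussianPDF 0 v.toNNReal (x i + y)) hg)
    fun i => (hg i).comp (hZi i)
  refine h.trans (Finset.prod_congr rfl fun i _ => ?_)
  rw [← hlaw i, lintegral_map (hg i) (hZi i)]

lemma IsStdBrownian.isHeatMarkov_of_version [IsProbabilityMeasure P]
    {B W : ℝ≥0 → Ω → EuclideanSpace ℝ (Fin d)} (hB : IsStdBrownian P d B)
    (hW : Measurable (Function.uncurry W)) (hWB : ∀ᵐ ω ∂P, ∀ t, W t ω = B t ω) :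
    IsHeatMarkov P d W where
  measurable := hW
  zero := by
    filter_upwards [hWB,
      ae_all_iff.2 fun i => (hB.coord i).toIsPreBrownianReal.eval_zero_ae_eq_zero]
      with ω h1 h2
    rw [h1]
    exact PiLp.ext h2
  markov m τ s u hτ hsu v hv G hG y := by
    have hWt (t : ℝ≥0) : Measurable (W t) := hW.comp measurable_prodMk_left
    have hpre (i : Fin d) : IsPreBrownianReal (fun t ω => W t ω i) P :=
      (hB.coord i).toIsPreBrownianReal.congr fun t => by
        filter_upwards [hWB] with ω hω
        rw [hω]
    have hindW : iIndepFun (fun (i : Fin d) ω (t : ℝ≥0) => W t ω i) P := by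
      refine (iIndepFun_congr fun i => ?_).1 hB.indep
      filter_upwards [hWB] with ω hω
      funext t
      rw [hω]
    set τ' : Fin (m + 1) → ℝ≥0 := Fin.cons s τ with hτ'
    have hτs (k : Fin (m + 1)) : τ' k ≤ s := by
      refine Fin.cases ?_ (fun j => ?_) k
      · simp [hτ']
      · simpa [hτ'] using hτ j
    -- the past and the increment, coordinate by coordinate, with values in a common space
    have hpast : IndepFun (fun ω (i : Fin d) (k : Fin (m + 1)) => W (τ' k) ω i)
        (fun ω (i : Fin d) (_ : Fin (m + 1)) => W u ω i - W s ω i) P := by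
      refine indepFun_pi_of_iIndepFun (X := fun i ω (k : Fin (m + 1)) => W (τ' k) ω i)
        (Y := fun i ω (_ : Fin (m + 1)) => W u ω i - W s ω i) (fun i => by fun_prop)
        (fun i => by fun_prop) ?_ fun i => ?_
      · exact hindW.comp (fun _ w => (fun k => w (τ' k), fun _ => w u - w s))
          fun _ => by fun_prop
      · have h := (hpre i).indepFun_shift s
        have h' := h.symm.comp (φ := fun w (k : Fin (m + 1)) => w ⟨τ' k, hτs k⟩)
          (ψ := fun w (_ : Fin (m + 1)) => w (u - s)) (by fun_prop) (by fun_prop)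
        simpa only [Function.comp_def, add_tsub_cancel_of_le hsu] using h'
    have hind : IndepFun (fun ω (k : Fin (m + 1)) => W (τ' k) ω) (fun ω => W u ω - W s ω) P := by
      have h := hpast.comp
        (φ := fun w (k : Fin (m + 1)) =>
          (WithLp.toLp 2 fun i => w i k : EuclideanSpace ℝ (Fin d)))
        (ψ := fun w => (WithLp.toLp 2 fun i => w i 0 : EuclideanSpace ℝ (Fin d)))
        (by fun_prop) (by fun_prop)
      exact h
    have hgauss (x : EuclideanSpace ℝ (Fin d)) :
        ∫⁻ ω, heatENN d v (x + (W u ω - W s ω)) ∂P = heatENN d (v + (u - s)) x := by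
      have h := lintegral_heatENN_add_gaussian (P := P) (Z := fun ω => W u ω - W s ω) (σ := u - s)
        (by fun_prop) (fun i => ?_) ?_ hv x
      · rwa [NNReal.coe_sub hsu] at h
      · have h := ((hpre i).hasLaw_sub u s).map_eq
        have hn : nndist (u : ℝ) (s : ℝ) = u - s := by
          ext
          rw [coe_nndist, Real.dist_eq, NNReal.coe_sub hsu, abs_of_nonneg]
          exact sub_nonneg.2 (by exact_mod_cast hsu)
        rw [← hn]
        exact h
      · exact hindW.comp (fun _ w => w u - w s) fun _ => by fun_prop
    have hGm : Measurable fun w : Fin (m + 1) → EuclideanSpace ℝ (Fin d) =>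
        G fun k => w k.succ := hG.comp (by fun_prop)
    have h := lintegral_indepFun (P := P) (X := fun ω (k : Fin (m + 1)) => W (τ' k) ω)
      (Y := fun ω => W u ω - W s ω) (by fun_prop) (by fun_prop) hind
      (F := fun w δ => (G fun k => w k.succ) * heatENN d v ((w 0 - y) + δ))
      ((hGm.comp measurable_fst).mul (by fun_prop))
    simp only [hτ', Fin.cons_succ, Fin.cons_zero] at h
    calc ∫⁻ ω, G (fun k => W (τ k) ω) * heatENN d v (W u ω - y) ∂P
        = ∫⁻ ω, G (fun k => W (τ k) ω) * heatENN d v (W s ω - y + (W u ω - W s ω)) ∂P := by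
          refine lintegral_congr fun ω => ?_
          congr 2; abel
      _ = _ := h
      _ = _ := by
          refine lintegral_congr fun ω => ?_
          rw [lintegral_const_mul _ (by fun_prop), hgauss]

end

section

/-! ### Separating and ordering the times -/

variable {Ω : Type*} [MeasurableSpace Ω] {P : Measure Ω} {d : ℕ}
  {ν : Measure ℝ} {W W' : ℝ≥0 → Ω → EuclideanSpace ℝ (Fin d)}

lemma IsHeatMarkov.measurable_comp (hW : IsHeatMarkov P d W) {Y : Type*} [MeasurableSpace Y]
    {τ : Y → ℝ≥0} {ω : Y → Ω} (hτ : Measurable τ) (hω : Measurable ω) :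
    Measurable fun y => W (τ y) (ω y) :=
  hW.measurable.comp (hτ.prodMk hω)

lemma IsHeatMarkov.measurable_eval (hW : IsHeatMarkov P d W) (t : ℝ≥0) : Measurable (W t) :=
  hW.measurable.comp measurable_prodMk_left

lemma IsHeatMarkov.markov_mixture [SFinite P] [SFinite ν] (hW : IsHeatMarkov P d W)
    (hν : ∀ᵐ w ∂ν, 0 < w) {ε : ℝ} (hε : 0 ≤ ε) {m : ℕ} (τ : Fin m → ℝ≥0) {s u : ℝ≥0}
    (hτ : ∀ k, τ k ≤ s) (hsu : s ≤ u) {G : (Fin m → EuclideanSpace ℝ (Fin d)) → ℝ≥0∞}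
    (hG : Measurable G) (y : EuclideanSpace ℝ (Fin d)) :
    ∫⁻ ω, G (fun k => W (τ k) ω) * mixture d ν ε (W u ω - y) ∂P =
      ∫⁻ ω, G (fun k => W (τ k) ω) * mixture d ν (ε + (u - s)) (W s ω - y) ∂P := by
  have hWm := hW.measurable_eval
  have hGm : Measurable fun ω => G (fun k => W (τ k) ω) := hG.comp (by fun_prop)
  have h (ε : ℝ) (u : ℝ≥0) :
      ∫⁻ ω, G (fun k => W (τ k) ω) * mixture d ν ε (W u ω - y) ∂P =
      ∫⁻ w, ∫⁻ ω, G (fun k => W (τ k) ω) * heatENN d (2 * w + ε) (W u ω - y) ∂P ∂ν := by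
    rw [← lintegral_lintegral_swap]
    · refine lintegral_congr fun ω => ?_
      rw [lintegral_const_mul _ (by fun_prop), mixture]
    · exact ((hGm.comp measurable_fst).mul (by fun_prop)).aemeasurable
  rw [h, h]
  refine lintegral_congr_ae ?_
  filter_upwards [hν] with w hw
  rw [hW.markov m τ s u hτ hsu _ (by positivity) G hG, add_assoc]

/-- The expectation of `∏ᵢ f_ε(W_{τᵢ} - W̃_{τᵢ})`, where `W̃` is an independent copy of `W` and
`f_ε` is the mixture with parameter `ε`. -/
def copyMoment (P : Measure Ω) (d : ℕ) (ν : Measure ℝ) (W : ℝ≥0 → Ω → EuclideanSpace ℝ (Fin d))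
    (ε : ℝ) {n : ℕ} (τ : Fin n → ℝ≥0) : ℝ≥0∞ :=
  ∫⁻ ω, ∫⁻ ω', ∏ i, mixture d ν ε (W (τ i) ω - W (τ i) ω') ∂P ∂P

lemma copyMoment_comp_perm (ε : ℝ) {n : ℕ} (τ : Fin n → ℝ≥0) (σ : Equiv.Perm (Fin n)) :
    copyMoment P d ν W ε (τ ∘ σ) = copyMoment P d ν W ε τ := by
  unfold copyMoment
  refine lintegral_congr fun ω => lintegral_congr fun ω' => ?_
  exact Equiv.prod_comp σ fun i => mixture d ν ε (W (τ i) ω - W (τ i) ω')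

/-- For ordered times, condition successively on the past, starting from the last time: the last
increments of the two independent copies add up to a Gaussian of twice the variance. -/
lemma IsHeatMarkov.copyMoment_le [IsProbabilityMeasure P] [SFinite ν] (hW : IsHeatMarkov P d W)
    (hν : ∀ᵐ w ∂ν, 0 < w) {ε : ℝ} (hε : 0 ≤ ε) (n : ℕ) (τ : Fin (n + 1) → ℝ≥0)
    (hτ : Monotone τ) :
    copyMoment P d ν W ε (fun i : Fin n => τ i.succ) ≤
      ∏ i : Fin n, mixture d ν (ε + 2 * (τ i.succ - τ i.castSucc)) 0 := by
  have hWm := hW.measurable_eval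
  induction n with
  | zero => simp [copyMoment]
  | succ n ih =>
    unfold copyMoment at ih ⊢
    set s := τ (Fin.last n).castSucc with hs
    set u := τ (Fin.last n).succ with hu
    set σ : Fin n → ℝ≥0 := fun i => τ i.castSucc.succ with hσ
    have hsu : s ≤ u := hτ (Fin.castSucc_lt_succ).le
    have hσs (i : Fin n) : σ i ≤ s := hτ (by
      rw [Fin.le_def]; simp only [Fin.val_succ, Fin.val_castSucc, Fin.val_last]; omega)
    have hδ : (0 : ℝ) ≤ u - s := sub_nonneg.2 (by exact_mod_cast hsu)
    set A : Ω → Ω → ℝ≥0∞ := fun ω ω' => ∏ i : Fin n, mixture d ν ε (W (σ i) ω - W (σ i) ω')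
      with hA
    have hAm : Measurable (Function.uncurry A) :=
      Finset.measurable_fun_prod _ fun i _ => by fun_prop
    have hconst (B : Ω → Ω → ℝ≥0∞) (hB : Measurable (Function.uncurry B)) (K : ℝ≥0∞) :
        ∫⁻ ω', ∫⁻ ω, B ω ω' * K ∂P ∂P = (∫⁻ ω, ∫⁻ ω', B ω ω' ∂P ∂P) * K := by
      have h1 (ω' : Ω) : ∫⁻ ω, B ω ω' * K ∂P = (∫⁻ ω, B ω ω' ∂P) * K :=
        lintegral_mul_const K (hB.comp measurable_prodMk_right)
      simp_rw [h1]
      rw [lintegral_mul_const K (hB.lintegral_prod_left (f := B)),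
        lintegral_lintegral_swap hB.aemeasurable]
    simp only [Fin.prod_univ_castSucc]
    -- replace `W u` by `W s`, in the copy and then in the process itself
    calc ∫⁻ ω, ∫⁻ ω', A ω ω' * mixture d ν ε (W u ω - W u ω') ∂P ∂P
        = ∫⁻ ω, ∫⁻ ω', A ω ω' * mixture d ν (ε + (u - s)) (W s ω' - W u ω) ∂P ∂P := by
          refine lintegral_congr fun ω => ?_
          simp_rw [mixture_sub_comm ε (W u ω)]
          exact hW.markov_mixture hν hε σ hσs hsu
            (G := fun w => ∏ i : Fin n, mixture d ν ε (W (σ i) ω - w i))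
            (Finset.measurable_fun_prod _ fun i _ => by fun_prop) (W u ω)
      _ = ∫⁻ ω', ∫⁻ ω, A ω ω' * mixture d ν (ε + (u - s)) (W s ω' - W u ω) ∂P ∂P :=
          lintegral_lintegral_swap (hAm.mul (by fun_prop)).aemeasurable
      _ = ∫⁻ ω', ∫⁻ ω, A ω ω' * mixture d ν (ε + (u - s) + (u - s)) (W s ω - W s ω') ∂P ∂P := by
          refine lintegral_congr fun ω' => ?_
          simp_rw [mixture_sub_comm (ε + (u - s)) (W s ω')]
          exact hW.markov_mixture hν (by positivity) σ hσs hsu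
            (G := fun w => ∏ i : Fin n, mixture d ν ε (w i - W (σ i) ω'))
            (Finset.measurable_fun_prod _ fun i _ => by fun_prop) (W s ω')
      _ ≤ ∫⁻ ω', ∫⁻ ω, A ω ω' * mixture d ν (ε + 2 * (u - s)) 0 ∂P ∂P := by
          refine lintegral_mono fun ω' => lintegral_mono fun ω => ?_
          gcongr
          rw [add_assoc, ← two_mul]
          exact mixture_le_zero hν (by positivity) _
      _ = (∫⁻ ω, ∫⁻ ω', A ω ω' ∂P ∂P) * mixture d ν (ε + 2 * (u - s)) 0 := hconst A hAm _
      _ ≤ _ := by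
          gcongr
          exact ih (fun i => τ i.castSucc) (hτ.comp Fin.strictMono_castSucc.monotone)

/-- Since the mixture is a positive definite kernel, the Cauchy–Schwarz inequality separates the
two processes, and with them the two families of times, which may be ordered differently. -/
lemma lintegral_prod_mixture_le [IsProbabilityMeasure P] [SigmaFinite ν] (hW : IsHeatMarkov P d W)
    (hW' : IsHeatMarkov P d W')
    (hind : IndepFun (fun ω (t : ℝ≥0) => W t ω) (fun ω (t : ℝ≥0) => W' t ω) P)
    (hν : ∀ᵐ w ∂ν, 0 < w) {ε : ℝ} (hε : 0 ≤ ε) {n : ℕ} (r s : Fin n → ℝ≥0) :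
    ∫⁻ ω, ∏ i, mixture d ν ε (W (r i) ω - W' (s i) ω) ∂P ≤
      copyMoment P d ν W ε r ^ (1 / 2 : ℝ) * copyMoment P d ν W' ε s ^ (1 / 2 : ℝ) := by
  have hWm := hW.measurable_eval
  have hWm' := hW'.measurable_eval
  have hprod (x x' : Fin n → EuclideanSpace ℝ (Fin d)) :
      ∏ i, mixture d ν ε (x i - x' i) = ∫⁻ e, (∏ i, mixtureFactor d ε (e i) (x i)) *
        ∏ i, mixtureFactor d ε (e i) (x' i) ∂(Measure.pi fun _ => ν.prod volume) := by
    simp_rw [← Finset.prod_mul_distrib, mixture_eq_lintegral_mixtureFactor hν hε]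
    exact (lintegral_pi_prod (ν.prod volume) n
      (fun i e => mixtureFactor d ε e (x i) * mixtureFactor d ε e (x' i))
      fun i => by fun_prop).symm
  have hindn : IndepFun (fun ω (i : Fin n) => W (r i) ω) (fun ω (i : Fin n) => W' (s i) ω) P :=
    hind.comp (φ := fun (w : ℝ≥0 → EuclideanSpace ℝ (Fin d)) (i : Fin n) => w (r i))
      (ψ := fun (w : ℝ≥0 → EuclideanSpace ℝ (Fin d)) (i : Fin n) => w (s i))
      (by fun_prop) (by fun_prop)
  have h := lintegral_indepFun (P := P) (by fun_prop) (by fun_prop) hindn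
    (F := fun x x' => ∏ i, mixture d ν ε (x i - x' i))
    (Finset.measurable_fun_prod _ fun i _ => by fun_prop)
  rw [h]
  unfold copyMoment
  simp_rw [fun ω ω' => hprod (fun i => W (r i) ω) (fun i => W' (s i) ω'),
    fun ω ω' => hprod (fun i => W (r i) ω) (fun i => W (r i) ω'),
    fun ω ω' => hprod (fun i => W' (s i) ω) (fun i => W' (s i) ω')]
  exact lintegral_lintegral_feature_le
    (h₁ := fun ω (e : Fin n → ℝ × EuclideanSpace ℝ (Fin d)) =>
      ∏ i, mixtureFactor d ε (e i) (W (r i) ω))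
    (h₂ := fun ω (e : Fin n → ℝ × EuclideanSpace ℝ (Fin d)) =>
      ∏ i, mixtureFactor d ε (e i) (W' (s i) ω))
    (Finset.measurable_fun_prod _ fun i _ => by fun_prop)
    (Finset.measurable_fun_prod _ fun i _ => by fun_prop)

lemma IsHeatMarkov.measurable_copyMoment [SFinite P] [SFinite ν] (hW : IsHeatMarkov P d W)
    (ε : ℝ) (n : ℕ) :
    Measurable fun r : Fin n → ℝ => copyMoment P d ν W ε (fun i => (r i).toNNReal) := by
  have h1 : Measurable fun p : ((Fin n → ℝ) × Ω) × Ω =>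
      ∏ i, mixture d ν ε (W (p.1.1 i).toNNReal p.1.2 - W (p.1.1 i).toNNReal p.2) :=
    Finset.measurable_fun_prod _ fun i _ => measurable_mixture measurable_const
      ((hW.measurable_comp (by fun_prop) (by fun_prop)).sub
        (hW.measurable_comp (by fun_prop) (by fun_prop)))
  exact h1.lintegral_prod_right'.lintegral_prod_right'

/-- Integrating a power of `copyMoment` over all times reduces, by symmetry, to the Dirichlet
integral over ordered times. -/
lemma IsHeatMarkov.lintegral_copyMoment_le [IsProbabilityMeasure P] [SFinite ν]
    (hW : IsHeatMarkov P d W)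
    (hν : ∀ᵐ w ∂ν, 0 < w) {ε : ℝ} (hε : 0 ≤ ε) {A : ℝ≥0∞} {κ : ℝ}
    (hA : ∀ τ : ℝ, 0 ≤ τ → mixture d ν (2 * τ) 0 ≤ A * ENNReal.ofReal τ ^ (-κ))
    {θ : ℝ} (hθ : 0 ≤ θ) (hκθ : κ * θ < 1) {t : ℝ} (ht : 0 ≤ t) (n : ℕ) :
    ∫⁻ r, copyMoment P d ν W ε (fun i => (r i).toNNReal) ^ θ
        ∂(Measure.pi fun _ : Fin n => volume.restrict (Icc 0 t)) ≤
      n.factorial * ((A ^ θ) ^ n * ENNReal.ofReal (Real.Gamma (1 - κ * θ) ^ n *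
        t ^ (n * (1 - κ * θ)) / Real.Gamma (n * (1 - κ * θ) + 1))) := by
  refine (lintegral_symmetric_le _ ((hW.measurable_copyMoment ε n).pow_const _)
    fun σ r => ?_).trans ?_
  · rw [← copyMoment_comp_perm ε (fun i => (r i).toNNReal) σ]
    rfl
  have hmem : ∀ᵐ r ∂(Measure.pi fun _ : Fin n => (volume : Measure ℝ).restrict (Icc 0 t)),
      ∀ i, r i ∈ Icc 0 t :=
    ae_all_iff.2 fun i => Measure.tendsto_eval_ae_ae.eventually
      (ae_restrict_mem measurableSet_Icc)
  gcongr
  calc ∫⁻ r, {r | Monotone r}.indicator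
        (fun r => copyMoment P d ν W ε (fun i => (r i).toNNReal) ^ θ) r
        ∂(Measure.pi fun _ : Fin n => volume.restrict (Icc 0 t))
      ≤ ∫⁻ r, (A ^ θ) ^ n * orderedWeight (κ * θ) 0 r
        ∂(Measure.pi fun _ : Fin n => volume.restrict (Icc 0 t)) := by
        refine lintegral_mono_ae ?_
        filter_upwards [hmem] with r hr
        by_cases hmono : Monotone r
        swap
        · rw [indicator_of_notMem (by exact hmono)]; exact zero_le
        rw [indicator_of_mem (by exact hmono)]
        set τ : Fin (n + 1) → ℝ≥0 := Fin.cons 0 fun i => (r i).toNNReal with hτ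
        have hτmono : Monotone τ := by
          refine Fin.monotone_iff_le_succ.2 fun i => ?_
          cases n with
          | zero => exact i.elim0
          | succ n =>
            refine Fin.cases ?_ (fun j => ?_) i
            · simp [hτ]
            · simp only [hτ, ← Fin.succ_castSucc, Fin.cons_succ]
              exact Real.toNNReal_le_toNNReal (hmono Fin.castSucc_lt_succ.le)
        have hτr (i : Fin (n + 1)) : (τ i : ℝ) = (Fin.cons 0 r : Fin (n + 1) → ℝ) i := by
          refine Fin.cases ?_ (fun j => ?_) i
          · simp [hτ]
          · simp [hτ, (hr j).1]
        have h := hW.copyMoment_le hν hε n τ hτmono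
        simp only [hτ, Fin.cons_succ] at h
        rw [← hτ] at h
        refine (ENNReal.rpow_le_rpow h hθ).trans ?_
        have hAn : (A ^ θ) ^ n = ∏ _i : Fin n, A ^ θ := by simp
        rw [← ENNReal.prod_rpow_of_nonneg hθ, orderedWeight, hAn, ← Finset.prod_mul_distrib]
        refine Finset.prod_le_prod' fun i _ => ?_
        set Δ : ℝ := r i - (Fin.cons 0 r : Fin (n + 1) → ℝ) i.castSucc with hΔ
        have hΔ' : ((r i).toNNReal : ℝ) - τ i.castSucc = Δ := by
          rw [hτr, Real.coe_toNNReal _ (hr i).1]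
        have hΔ0 : 0 ≤ Δ := by
          have h1 := hτmono (Fin.castSucc_lt_succ (i := i)).le
          have h2 : (τ i.castSucc : ℝ) ≤ τ i.succ := by exact_mod_cast h1
          rw [hτr, hτr, Fin.cons_succ] at h2
          exact sub_nonneg.2 h2
        rw [hΔ', incrementWeight, indicator_of_mem (show Δ ∈ Ici 0 from hΔ0), ← neg_mul,
          ENNReal.rpow_mul, ← ENNReal.mul_rpow_of_nonneg _ _ hθ]
        refine ENNReal.rpow_le_rpow (le_trans ?_ (hA Δ hΔ0)) hθ
        exact mixture_zero_anti hν (by positivity) (by linarith)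
    _ ≤ _ := by
        have hm : Measurable fun r : Fin n → ℝ => orderedWeight (κ * θ) 0 r :=
          (measurable_orderedWeight _ n).comp measurable_prodMk_left
        rw [lintegral_const_mul _ hm]
        gcongr
        have h := lintegral_orderedWeight_le hκθ n le_rfl ht
        rwa [sub_zero] at h

end

section

/-! ### The time weight -/

section Weight

variable {H γ t : ℝ} {η : ℝ → ℝ → ℝ}

lemma IsWeight.ofReal_le (hη : IsWeight H γ t η) (hγ : 0 < γ) {r s : ℝ} (hr : r ∈ Icc 0 t)
    (hs : s ∈ Icc 0 t) (hrs : r ≠ s) :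
    ENNReal.ofReal (η r s) ≤ ENNReal.ofReal γ * ENNReal.ofReal (|r - s| ^ (2 * H - 2)) := by
  rw [← ENNReal.ofReal_mul hγ.le]
  exact ENNReal.ofReal_le_ofReal (hη.bound r hr s hs hrs)

/-- For a function of the two times, the bound on the weight may be used under the integral
sign, the diagonal being negligible. -/
lemma IsWeight.lintegral_mul_le (hη : IsWeight H γ t η) (hγ : 0 < γ) {F : ℝ × ℝ → ℝ≥0∞}
    (hF : Measurable F) :
    ∫⁻ q, F q * ENNReal.ofReal (η q.1 q.2)
        ∂((volume.restrict (Icc 0 t)).prod (volume.restrict (Icc 0 t))) ≤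
      ENNReal.ofReal γ * ∫⁻ r in Ioc 0 t, ∫⁻ s in Ioc 0 t,
        F (r, s) * ENNReal.ofReal (|s - r| ^ (2 * H - 2)) := by
  have hηm := hη.measurable
  have hμ : (volume : Measure ℝ).restrict (Icc 0 t) = volume.restrict (Ioc 0 t) :=
    Measure.restrict_congr_set Ioc_ae_eq_Icc.symm
  rw [hμ, lintegral_prod _ (by fun_prop), ← lintegral_const_mul _ (Measurable.lintegral_prod_right
    (f := fun r s : ℝ => F (r, s) * ENNReal.ofReal (|s - r| ^ (2 * H - 2)))
    (by simp only [Function.uncurry_def]; fun_prop))]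
  refine setLIntegral_mono' measurableSet_Ioc fun r hr => ?_
  rw [← lintegral_const_mul _ (by fun_prop)]
  refine lintegral_mono_ae ?_
  filter_upwards [ae_restrict_mem measurableSet_Ioc,
    ae_restrict_of_ae (Measure.ae_ne volume r)] with s hs hsr
  rw [abs_sub_comm, mul_left_comm]
  gcongr
  exact hη.ofReal_le hγ (Ioc_subset_Icc_self hr) (Ioc_subset_Icc_self hs) hsr.symm

lemma IsWeight.bilinear_le {β : ℝ} (hη : IsWeight H γ t η) (hγ : 0 < γ) (hH : 1 / 2 < H)
    (hH1 : H < 1) (hβ : IsTimeConst H β) {φ ψ : ℝ → ℝ≥0∞} (hφ : Measurable φ)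
    (hψ : Measurable ψ) :
    ∫⁻ q, φ q.1 * ψ q.2 * ENNReal.ofReal (η q.1 q.2)
        ∂((volume.restrict (Icc 0 t)).prod (volume.restrict (Icc 0 t))) ≤
      ENNReal.ofReal (γ / alphaH H * β ^ 2) *
        ((∫⁻ x in Icc 0 t, φ x ^ (1 / H)) ^ H * (∫⁻ x in Icc 0 t, ψ x ^ (1 / H)) ^ H) := by
  have hα := alphaH_pos hH
  have hH0 : 0 < 1 / H := by positivity
  have hμ : (volume : Measure ℝ).restrict (Icc 0 t) = volume.restrict (Ioc 0 t) :=
    Measure.restrict_congr_set Ioc_ae_eq_Icc.symm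
  refine (hη.lintegral_mul_le hγ (F := fun q => φ q.1 * ψ q.2) (by fun_prop)).trans ?_
  -- apply the inequality on the half-line to the functions extended by `0` outside `(0,t]`
  have hsub : Ioc 0 t ⊆ Ioi 0 := fun x hx => hx.1
  have hind (φ : ℝ → ℝ≥0∞) : ∫⁻ x in Ioi 0, (Ioc 0 t).indicator φ x ^ (1 / H) =
      ∫⁻ x in Icc 0 t, φ x ^ (1 / H) := by
    have h (x : ℝ) : (Ioc 0 t).indicator φ x ^ (1 / H) =
        (Ioc 0 t).indicator (fun x => φ x ^ (1 / H)) x := by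
      by_cases hx : x ∈ Ioc 0 t
      · rw [indicator_of_mem hx, indicator_of_mem hx]
      · rw [indicator_of_notMem hx, indicator_of_notMem hx, ENNReal.zero_rpow_of_pos hH0]
    simp_rw [h]
    rw [setLIntegral_indicator measurableSet_Ioc, inter_eq_left.2 hsub, hμ]
  have hdouble : ∫⁻ r in Ioi 0, ∫⁻ s in Ioi 0, (Ioc 0 t).indicator φ r *
        (Ioc 0 t).indicator ψ s * ENNReal.ofReal (|s - r| ^ (2 * H - 2)) =
      ∫⁻ r in Ioc 0 t, ∫⁻ s in Ioc 0 t,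
        φ r * ψ s * ENNReal.ofReal (|s - r| ^ (2 * H - 2)) := by
    have h1 (r : ℝ) : ∫⁻ s in Ioi 0, (Ioc 0 t).indicator φ r *
        (Ioc 0 t).indicator ψ s * ENNReal.ofReal (|s - r| ^ (2 * H - 2)) =
        (Ioc 0 t).indicator (fun r => ∫⁻ s in Ioc 0 t,
          φ r * ψ s * ENNReal.ofReal (|s - r| ^ (2 * H - 2))) r := by
      by_cases hr : r ∈ Ioc 0 t
      · rw [indicator_of_mem hr, indicator_of_mem hr]
        have h2 (s : ℝ) : φ r * (Ioc 0 t).indicator ψ s *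
            ENNReal.ofReal (|s - r| ^ (2 * H - 2)) = (Ioc 0 t).indicator
            (fun s => φ r * ψ s * ENNReal.ofReal (|s - r| ^ (2 * H - 2))) s := by
          by_cases hs : s ∈ Ioc 0 t
          · rw [indicator_of_mem hs, indicator_of_mem hs]
          · rw [indicator_of_notMem hs, indicator_of_notMem hs, mul_zero, zero_mul]
        simp_rw [h2]
        rw [setLIntegral_indicator measurableSet_Ioc, inter_eq_left.2 hsub]
      · rw [indicator_of_notMem hr, indicator_of_notMem hr]
        simp
    simp_rw [h1]
    rw [setLIntegral_indicator measurableSet_Ioc, inter_eq_left.2 hsub]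
  have h := hβ.bilinear_le hH hH1 (hφ.indicator (measurableSet_Ioc (a := 0) (b := t)))
    (hψ.indicator (measurableSet_Ioc (a := 0) (b := t)))
  rw [hind, hind, hdouble] at h
  calc _ = ENNReal.ofReal (γ / alphaH H) * (ENNReal.ofReal (alphaH H) *
        ∫⁻ r in Ioc 0 t, ∫⁻ s in Ioc 0 t,
          φ r * ψ s * ENNReal.ofReal (|s - r| ^ (2 * H - 2))) := by
        rw [← mul_assoc, ← ENNReal.ofReal_mul (by positivity), div_mul_cancel₀ _ hα.ne']
    _ ≤ _ := by
        rw [ENNReal.ofReal_mul (by positivity), mul_assoc]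
        gcongr

lemma lintegral_Ioc_sub_left (g : ℝ → ℝ≥0∞) (s : ℝ) :
    ∫⁻ r in Ioc 0 s, g (s - r) = ∫⁻ r in Ioc 0 s, g r := by
  rw [setLIntegral_congr Ioo_ae_eq_Ioc.symm, setLIntegral_congr Ioo_ae_eq_Ioc.symm,
    ← lintegral_indicator measurableSet_Ioo, ← lintegral_indicator measurableSet_Ioo,
    ← lintegral_sub_left_eq_self ((Ioo 0 s).indicator g) s]
  refine lintegral_congr fun r => ?_
  have : s - r ∈ Ioo 0 s ↔ r ∈ Ioo 0 s := by
    simp only [mem_Ioo]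
    constructor <;> rintro ⟨h1, h2⟩ <;> constructor <;> linarith
  simp only [indicator, this]

lemma lintegral_Ioc_sub_right (g : ℝ → ℝ≥0∞) (s t : ℝ) :
    ∫⁻ r in Ioc s t, g (r - s) = ∫⁻ r in Ioc 0 (t - s), g r := by
  rw [← lintegral_indicator measurableSet_Ioc, ← lintegral_indicator measurableSet_Ioc,
    ← lintegral_sub_right_eq_self ((Ioc 0 (t - s)).indicator g) s]
  refine lintegral_congr fun r => ?_
  have : r - s ∈ Ioc 0 (t - s) ↔ r ∈ Ioc s t := by
    simp only [mem_Ioc]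
    constructor <;> rintro ⟨h1, h2⟩ <;> constructor <;> linarith
  simp only [indicator, this]

lemma lintegral_Ioc_abs_sub_le (hH : 1 / 2 < H) (ht : 0 < t) :
    ∫⁻ r in Ioc 0 t, ∫⁻ s in Ioc 0 t, ENNReal.ofReal (|s - r| ^ (2 * H - 2)) ≤
      ENNReal.ofReal (t ^ (2 * H) / alphaH H) := by
  have hH' : 0 < 2 * H - 1 := by linarith
  have hone (s : ℝ) (hs : 0 ≤ s) : ∫⁻ x in Ioc 0 s, ENNReal.ofReal (|x| ^ (2 * H - 2)) =
      ENNReal.ofReal ((2 * H - 1)⁻¹) * ENNReal.ofReal (s ^ (2 * H - 1)) := by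
    rcases hs.eq_or_lt with rfl | hs
    · simp [Real.zero_rpow hH'.ne']
    · rw [← ENNReal.ofReal_mul (by positivity), inv_mul_eq_div,
        ← lintegral_Ioc_rpow_sub_one hH' hs]
      refine setLIntegral_congr_fun measurableSet_Ioc fun x hx => ?_
      rw [abs_of_pos hx.1, show 2 * H - 1 - 1 = 2 * H - 2 by ring]
  have hin (r : ℝ) (hr : r ∈ Ioc 0 t) :
      ∫⁻ s in Ioc 0 t, ENNReal.ofReal (|s - r| ^ (2 * H - 2)) =
      ENNReal.ofReal ((2 * H - 1)⁻¹) * (ENNReal.ofReal (r ^ (2 * H - 1)) +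
        ENNReal.ofReal ((t - r) ^ (2 * H - 1))) := by
    rw [← Ioc_union_Ioc_eq_Ioc hr.1.le hr.2, lintegral_union measurableSet_Ioc
      (Ioc_disjoint_Ioc_of_le le_rfl), mul_add, ← hone r hr.1.le,
      ← hone (t - r) (by linarith [hr.2]),
      ← lintegral_Ioc_sub_right _ r t,
      ← lintegral_Ioc_sub_left (fun x => ENNReal.ofReal (|x| ^ (2 * H - 2))) r]
    congr 1
    exact lintegral_congr fun s => by rw [abs_sub_comm]
  have hpow : ∫⁻ r in Ioc 0 t, ENNReal.ofReal (r ^ (2 * H - 1)) =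
      ENNReal.ofReal (t ^ (2 * H) / (2 * H)) := lintegral_Ioc_rpow_sub_one (by linarith) ht
  rw [setLIntegral_congr_fun measurableSet_Ioc hin, lintegral_const_mul _ (by fun_prop),
    lintegral_add_left (by fun_prop),
    lintegral_Ioc_sub_left (fun x => ENNReal.ofReal (x ^ (2 * H - 1))) t, hpow,
    ← ENNReal.ofReal_add (by positivity) (by positivity), ← ENNReal.ofReal_mul (by positivity)]
  refine (congrArg ENNReal.ofReal ?_).le
  rw [alphaH]
  have : H ≠ 0 := by linarith
  field_simp
  ring

lemma IsWeight.lintegral_le (hη : IsWeight H γ t η) (hγ : 0 < γ) (hH : 1 / 2 < H) (ht : 0 < t) :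
    ∫⁻ q, ENNReal.ofReal (η q.1 q.2)
        ∂((volume.restrict (Icc 0 t)).prod (volume.restrict (Icc 0 t))) ≤
      ENNReal.ofReal (γ * t ^ (2 * H) / alphaH H) := by
  have h := hη.lintegral_mul_le hγ (F := fun _ => 1) measurable_const
  simp only [one_mul] at h
  refine h.trans ?_
  rw [mul_div_assoc, ENNReal.ofReal_mul hγ.le]
  gcongr
  exact lintegral_Ioc_abs_sub_le hH ht

end Weight

/-! ### Moments of the local time -/

variable {Ω : Type*} [MeasurableSpace Ω] {P : Measure Ω} {d : ℕ} {ν : Measure ℝ}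
  {W W' : ℝ≥0 → Ω → EuclideanSpace ℝ (Fin d)} {H γ t : ℝ} {η : ℝ → ℝ → ℝ}

/-- The local time with the mixture of parameter `ε` as kernel, with values in `[0,∞]`. For
`ε > 0` it is `L_{t,ε}(η)`, and for `ε = 0` it is the limit. -/
def mixtureLocalTime (d : ℕ) (ν : Measure ℝ) (η : ℝ → ℝ → ℝ)
    (W W' : ℝ≥0 → Ω → EuclideanSpace ℝ (Fin d)) (t ε : ℝ) (ω : Ω) : ℝ≥0∞ :=
  ∫⁻ q, mixture d ν ε (W q.1.toNNReal ω - W' q.2.toNNReal ω) * ENNReal.ofReal (η q.1 q.2)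
    ∂((volume.restrict (Icc 0 t)).prod (volume.restrict (Icc 0 t)))

lemma measurable_mixture_path [SFinite ν] (hW : IsHeatMarkov P d W)
    (hW' : IsHeatMarkov P d W') (ε : ℝ) :
    Measurable fun p : Ω × (ℝ × ℝ) => mixture d ν ε
      (W p.2.1.toNNReal p.1 - W' p.2.2.toNNReal p.1) :=
  measurable_mixture measurable_const ((hW.measurable_comp (by fun_prop) (by fun_prop)).sub
    (hW'.measurable_comp (by fun_prop) (by fun_prop)))

lemma measurable_mixtureLocalTime [SFinite ν] (hW : IsHeatMarkov P d W)
    (hW' : IsHeatMarkov P d W') (hη : IsWeight H γ t η) (ε : ℝ) :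
    Measurable (mixtureLocalTime d ν η W W' t ε) :=
  Measurable.lintegral_prod_right (f := fun ω (q : ℝ × ℝ) =>
    mixture d ν ε (W q.1.toNNReal ω - W' q.2.toNNReal ω) * ENNReal.ofReal (η q.1 q.2))
    ((measurable_mixture_path hW hW' ε).mul (hη.measurable.comp measurable_snd).ennreal_ofReal)

omit [MeasurableSpace Ω] in
lemma mixtureLocalTime_le (hν : ∀ᵐ w ∂ν, 0 < w) (hη : IsWeight H γ t η) (hγ : 0 < γ)
    (hH : 1 / 2 < H) (ht : 0 < t) {ε : ℝ} (hε : 0 ≤ ε) (ω : Ω) :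
    mixtureLocalTime d ν η W W' t ε ω ≤
      mixture d ν ε 0 * ENNReal.ofReal (γ * t ^ (2 * H) / alphaH H) := by
  calc mixtureLocalTime d ν η W W' t ε ω
      ≤ ∫⁻ q, mixture d ν ε 0 * ENNReal.ofReal (η q.1 q.2)
          ∂((volume.restrict (Icc 0 t)).prod (volume.restrict (Icc 0 t))) :=
        lintegral_mono fun q => by
          gcongr
          exact mixture_le_zero hν hε _
    _ = mixture d ν ε 0 * ∫⁻ q, ENNReal.ofReal (η q.1 q.2)
          ∂((volume.restrict (Icc 0 t)).prod (volume.restrict (Icc 0 t))) :=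
        lintegral_const_mul _ hη.measurable.ennreal_ofReal
    _ ≤ _ := by
        gcongr
        exact hη.lintegral_le hγ hH ht

lemma mixtureLocalTime_pow [SFinite ν] (hW : IsHeatMarkov P d W) (hW' : IsHeatMarkov P d W')
    (hη : IsWeight H γ t η) (ε : ℝ) (n : ℕ) (ω : Ω) :
    mixtureLocalTime d ν η W W' t ε ω ^ n =
      ∫⁻ q, (∏ i, mixture d ν ε (W (q i).1.toNNReal ω - W' (q i).2.toNNReal ω)) *
        ∏ i, ENNReal.ofReal (η (q i).1 (q i).2)
      ∂(Measure.pi fun _ : Fin n =>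
        ((volume : Measure ℝ).restrict (Icc 0 t)).prod (volume.restrict (Icc 0 t))) := by
  simp_rw [← Finset.prod_mul_distrib]
  have h := lintegral_pi_prod
    (((volume : Measure ℝ).restrict (Icc 0 t)).prod (volume.restrict (Icc 0 t))) n
    (fun _ q => mixture d ν ε (W q.1.toNNReal ω - W' q.2.toNNReal ω) *
      ENNReal.ofReal (η q.1 q.2))
    fun _ => ((measurable_mixture_path hW hW' ε).comp measurable_prodMk_left).mul
      hη.measurable.ennreal_ofReal
  rw [h, Finset.prod_const, Finset.card_univ, Fintype.card_fin, mixtureLocalTime]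

lemma measurable_prod_mixture_path [SFinite ν] (hW : IsHeatMarkov P d W)
    (hW' : IsHeatMarkov P d W') (ε : ℝ) (n : ℕ) :
    Measurable fun p : Ω × (Fin n → ℝ × ℝ) =>
      ∏ i, mixture d ν ε (W (p.2 i).1.toNNReal p.1 - W' (p.2 i).2.toNNReal p.1) := by
  refine Finset.measurable_fun_prod Finset.univ fun i _ => ?_
  exact measurable_mixture measurable_const ((hW.measurable_comp (by fun_prop) (by fun_prop)).sub
    (hW'.measurable_comp (by fun_prop) (by fun_prop)))

lemma lintegral_mixtureLocalTime_pow_le_copyMoment [IsProbabilityMeasure P] [SigmaFinite ν]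
    (hW : IsHeatMarkov P d W) (hW' : IsHeatMarkov P d W')
    (hind : IndepFun (fun ω (t : ℝ≥0) => W t ω) (fun ω (t : ℝ≥0) => W' t ω) P)
    (hν : ∀ᵐ w ∂ν, 0 < w) (hη : IsWeight H γ t η) {ε : ℝ} (hε : 0 ≤ ε) (n : ℕ) :
    ∫⁻ ω, mixtureLocalTime d ν η W W' t ε ω ^ n ∂P ≤
      ∫⁻ q, copyMoment P d ν W ε (fun i => (q i).1.toNNReal) ^ (1 / 2 : ℝ) *
        copyMoment P d ν W' ε (fun i => (q i).2.toNNReal) ^ (1 / 2 : ℝ) *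
        ∏ i, ENNReal.ofReal (η (q i).1 (q i).2)
      ∂(Measure.pi fun _ : Fin n =>
        ((volume : Measure ℝ).restrict (Icc 0 t)).prod (volume.restrict (Icc 0 t))) := by
  have hprodm := measurable_prod_mixture_path (ν := ν) hW hW' ε n
  have hηprod : Measurable fun q : Fin n → ℝ × ℝ => ∏ i, ENNReal.ofReal (η (q i).1 (q i).2) :=
    Finset.measurable_fun_prod Finset.univ fun i _ =>
      (hη.measurable.comp (measurable_pi_apply i)).ennreal_ofReal
  simp_rw [mixtureLocalTime_pow hW hW' hη]
  rw [lintegral_lintegral_swap (hprodm.mul (hηprod.comp measurable_snd)).aemeasurable]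
  refine lintegral_mono fun q => ?_
  have hm : Measurable fun ω =>
      ∏ i, mixture d ν ε (W (q i).1.toNNReal ω - W' (q i).2.toNNReal ω) :=
    Finset.measurable_fun_prod Finset.univ fun i _ => measurable_mixture measurable_const
      ((hW.measurable_eval _).sub (hW'.measurable_eval _))
  have h := lintegral_prod_mixture_le hW hW' hind hν hε
    (fun i => (q i).1.toNNReal) fun i => (q i).2.toNNReal
  rw [lintegral_mul_const _ hm]
  gcongr

/-- The moments of the local time: after separating the two families of times, the tensorized
time inequality with the weight as kernel reduces them to Dirichlet integrals. -/
lemma lintegral_mixtureLocalTime_pow_le [IsProbabilityMeasure P] [SigmaFinite ν]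
    (hW : IsHeatMarkov P d W) (hW' : IsHeatMarkov P d W')
    (hind : IndepFun (fun ω (t : ℝ≥0) => W t ω) (fun ω (t : ℝ≥0) => W' t ω) P)
    (hν : ∀ᵐ w ∂ν, 0 < w) {A : ℝ≥0∞} {κ : ℝ}
    (hA : ∀ τ : ℝ, 0 ≤ τ → mixture d ν (2 * τ) 0 ≤ A * ENNReal.ofReal τ ^ (-κ))
    (hH : 1 / 2 < H) (hH1 : H < 1) (hκ : κ * (1 / (2 * H)) < 1) {β : ℝ} (hβ : IsTimeConst H β)
    (hη : IsWeight H γ t η) (hγ : 0 < γ) (ht : 0 < t) {ε : ℝ} (hε : 0 ≤ ε) (n : ℕ) :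
    ∫⁻ ω, mixtureLocalTime d ν η W W' t ε ω ^ n ∂P ≤
      ENNReal.ofReal (γ / alphaH H * β ^ 2) ^ n *
        (n.factorial * ((A ^ (1 / (2 * H))) ^ n * ENNReal.ofReal
          (Real.Gamma (1 - κ * (1 / (2 * H))) ^ n * t ^ (n * (1 - κ * (1 / (2 * H)))) /
            Real.Gamma (n * (1 - κ * (1 / (2 * H))) + 1)))) ^ (2 * H) := by
  have hH0 : 0 < H := by linarith
  have hθ : 0 ≤ 1 / (2 * H) := by positivity
  have h1 := hW.lintegral_copyMoment_le hν hε hA hθ hκ ht.le n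
  have h2 := hW'.lintegral_copyMoment_le hν hε hA hθ hκ ht.le n
  generalize (n.factorial : ℝ≥0∞) * ((A ^ (1 / (2 * H))) ^ n * ENNReal.ofReal
    (Real.Gamma (1 - κ * (1 / (2 * H))) ^ n * t ^ (n * (1 - κ * (1 / (2 * H)))) /
      Real.Gamma (n * (1 - κ * (1 / (2 * H))) + 1))) = X at h1 h2 ⊢
  have hhalf (x : ℝ≥0∞) : (x ^ (1 / 2 : ℝ)) ^ (1 / H) = x ^ (1 / (2 * H)) := by
    rw [← ENNReal.rpow_mul]; congr 1; field_simp
  refine (lintegral_mixtureLocalTime_pow_le_copyMoment hW hW' hind hν hη hε n).trans ?_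
  refine (lintegral_tensor_le (k := fun q => ENNReal.ofReal (η q.1 q.2))
    hη.measurable.ennreal_ofReal hH0
    (fun φ ψ hφ hψ => hη.bilinear_le hγ hH hH1 hβ hφ hψ) n
    (fun r => copyMoment P d ν W ε (fun i => (r i).toNNReal) ^ (1 / 2 : ℝ))
    (fun r => copyMoment P d ν W' ε (fun i => (r i).toNNReal) ^ (1 / 2 : ℝ))
    ((hW.measurable_copyMoment ε n).pow_const _)
    ((hW'.measurable_copyMoment ε n).pow_const _)).trans ?_
  simp_rw [hhalf]
  have hX : X ^ (2 * H) = X ^ H * X ^ H := by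
    rw [two_mul, ENNReal.rpow_add_of_nonneg _ _ hH0.le hH0.le]
  rw [hX]
  gcongr

end

section

/-! ### Convergence in all `Lᵖ` -/

section General

variable {Ω : Type*} [MeasurableSpace Ω] {P : Measure Ω}

lemma enorm_toReal_sub_toReal_le {a b : ℝ≥0∞} (ha : a ≠ ∞) (hb : b ≠ ∞) :
    ‖a.toReal - b.toReal‖ₑ ≤ (a - b) + (b - a) := by
  rcases le_total a b with h | h
  · rw [enorm_sub_rev, ← ENNReal.toReal_sub_of_le h hb, Real.enorm_eq_ofReal ENNReal.toReal_nonneg,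
      ENNReal.ofReal_toReal (ENNReal.sub_ne_top hb)]
    exact le_add_self
  · rw [← ENNReal.toReal_sub_of_le h ha, Real.enorm_eq_ofReal ENNReal.toReal_nonneg,
      ENNReal.ofReal_toReal (ENNReal.sub_ne_top ha)]
    exact le_self_add

lemma lintegral_sub_add_sub_le {f g : Ω → ℝ≥0∞} (hf : Measurable f) (hg : Measurable g)
    (hfg : ∫⁻ ω, f ω ∂P ≤ ∫⁻ ω, g ω ∂P) (hgi : ∫⁻ ω, g ω ∂P ≠ ∞) :
    ∫⁻ ω, ((f ω - g ω) + (g ω - f ω)) ∂P ≤ 2 * ∫⁻ ω, (g ω - f ω) ∂P := by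
  -- `(f - g) + g` and `(g - f) + f` are both the maximum of `f` and `g`
  have h : ∫⁻ ω, (f ω - g ω) ∂P + ∫⁻ ω, g ω ∂P ≤ ∫⁻ ω, (g ω - f ω) ∂P + ∫⁻ ω, g ω ∂P := by
    calc _ = ∫⁻ ω, (g ω - f ω) ∂P + ∫⁻ ω, f ω ∂P := by
          rw [← lintegral_add_right _ hg, ← lintegral_add_right _ hf]
          refine lintegral_congr fun ω => ?_
          rw [tsub_add_eq_max, tsub_add_eq_max, max_comm]
      _ ≤ _ := by gcongr
  have hm : Measurable fun ω => f ω - g ω := hf.sub hg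
  rw [lintegral_add_left hm, two_mul]
  exact add_le_add_left ((ENNReal.add_le_add_iff_right hgi).1 h) _

/-- A converse of Fatou's lemma: if the integrals do not exceed that of the lower bound `g` of
the inferior limit, convergence holds in mean. -/
lemma tendsto_lintegral_of_le_liminf {ι : Type*} {l : Filter ι} [l.IsCountablyGenerated]
    {f : ι → Ω → ℝ≥0∞} {g : Ω → ℝ≥0∞} (hf : ∀ i, Measurable (f i)) (hg : Measurable g)
    (hgi : ∫⁻ ω, g ω ∂P ≠ ∞) (hfg : ∀ᶠ i in l, ∫⁻ ω, f i ω ∂P ≤ ∫⁻ ω, g ω ∂P)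
    (hlim : ∀ ω, g ω ≤ liminf (fun i => f i ω) l) :
    Tendsto (fun i => ∫⁻ ω, ((f i ω - g ω) + (g ω - f i ω)) ∂P) l (𝓝 0) := by
  -- the truncated difference `g - f i` is dominated by `g`
  have hpt : ∀ᵐ ω ∂P, Tendsto (fun i => g ω - f i ω) l (𝓝 0) := by
    filter_upwards [ae_lt_top hg hgi] with ω hω
    refine ENNReal.tendsto_nhds_zero.2 fun δ hδ => ?_
    rcases eq_or_ne (g ω) 0 with h0 | h0
    · simp [h0]
    · have h1 : g ω - δ < liminf (fun i => f i ω) l :=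
        (ENNReal.sub_lt_self hω.ne h0 hδ.ne').trans_le (hlim ω)
      filter_upwards [eventually_lt_of_lt_liminf h1] with i hi
      rw [tsub_le_iff_right, add_comm, ← tsub_le_iff_right]
      exact hi.le
  have h2 : Tendsto (fun i => ∫⁻ ω, (g ω - f i ω) ∂P) l (𝓝 0) := by
    have h := tendsto_lintegral_filter_of_dominated_convergence (μ := P) g
      (Eventually.of_forall fun i => hg.sub (hf i))
      (Eventually.of_forall fun i => Eventually.of_forall fun ω => tsub_le_self) hgi hpt
    simpa using h
  refine tendsto_of_tendsto_of_tendsto_of_le_of_le' tendsto_const_nhds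
    (g := fun _ => 0) (h := fun i => 2 * ∫⁻ ω, (g ω - f i ω) ∂P) ?_
    (Eventually.of_forall fun _ => zero_le) ?_
  · simpa using ENNReal.Tendsto.const_mul h2 (Or.inr (by simp))
  · filter_upwards [hfg] with i hi using lintegral_sub_add_sub_le (hf i) hg hi hgi

/-- The Cauchy–Schwarz inequality for `D^{n+1} = D^{1/2} D^{n+1/2}`. -/
lemma lintegral_pow_le_sqrt_mul_sqrt {D : Ω → ℝ≥0∞} (hD : Measurable D) (n : ℕ) :
    ∫⁻ ω, D ω ^ (n + 1) ∂P ≤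
      (∫⁻ ω, D ω ∂P) ^ (1 / 2 : ℝ) * (∫⁻ ω, D ω ^ (2 * n + 1) ∂P) ^ (1 / 2 : ℝ) := by
  have h := ENNReal.lintegral_mul_le_Lp_mul_Lq P Real.HolderConjugate.two_two
    (f := fun ω => D ω ^ (1 / 2 : ℝ)) (g := fun ω => D ω ^ (n + 1 / 2 : ℝ))
    (by fun_prop) (by fun_prop)
  have h1 (ω : Ω) : D ω ^ (1 / 2 : ℝ) * D ω ^ (n + 1 / 2 : ℝ) = D ω ^ (n + 1) := by
    rw [← ENNReal.rpow_add_of_nonneg _ _ (by positivity) (by positivity), ← ENNReal.rpow_natCast]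
    congr 1; push_cast; ring
  have h2 (ω : Ω) : (D ω ^ (1 / 2 : ℝ)) ^ (2 : ℝ) = D ω := by
    rw [← ENNReal.rpow_mul]; norm_num
  have h3 (ω : Ω) : (D ω ^ (n + 1 / 2 : ℝ)) ^ (2 : ℝ) = D ω ^ (2 * n + 1) := by
    rw [← ENNReal.rpow_mul, ← ENNReal.rpow_natCast]
    congr 1; push_cast; ring
  simpa only [Pi.mul_apply, h1, h2, h3] using h

/-- Convergence in mean with uniformly bounded moments is convergence in every `Lᵖ`, `p < ∞`. -/
lemma tendsto_lintegral_sub_pow [IsProbabilityMeasure P] {ι : Type*} {l : Filter ι}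
    {f : ι → Ω → ℝ≥0∞} {g : Ω → ℝ≥0∞} (hf : ∀ i, Measurable (f i)) (hg : Measurable g)
    (hlim : Tendsto (fun i => ∫⁻ ω, ((f i ω - g ω) + (g ω - f i ω)) ∂P) l (𝓝 0))
    (hM : ∀ n : ℕ, ∃ M : ℝ≥0∞, M ≠ ∞ ∧ ∫⁻ ω, g ω ^ n ∂P ≤ M ∧
      ∀ᶠ i in l, ∫⁻ ω, f i ω ^ n ∂P ≤ M) (n : ℕ) :
    Tendsto (fun i => ∫⁻ ω, ((f i ω - g ω) + (g ω - f i ω)) ^ (n + 1) ∂P) l (𝓝 0) := by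
  obtain ⟨M, hMt, hMg, hMf⟩ := hM (2 * n + 1)
  have hD (i : ι) : Measurable fun ω => (f i ω - g ω) + (g ω - f i ω) :=
    ((hf i).sub hg).add (hg.sub (hf i))
  set K : ℝ≥0∞ := 2 ^ (2 * n) * (M + M) with hK
  have hKt : K ≠ ∞ := ENNReal.mul_ne_top (by simp) (by simp [hMt])
  refine tendsto_of_tendsto_of_tendsto_of_le_of_le' tendsto_const_nhds (g := fun _ => 0)
    (h := fun i => (∫⁻ ω, ((f i ω - g ω) + (g ω - f i ω)) ∂P) ^ (1 / 2 : ℝ) * K ^ (1 / 2 : ℝ))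
    ?_ (Eventually.of_forall fun _ => zero_le) ?_
  · have h := (ENNReal.continuous_rpow_const (y := 1 / 2)).tendsto 0 |>.comp hlim
    rw [ENNReal.zero_rpow_of_pos (by norm_num)] at h
    have h' := ENNReal.Tendsto.mul_const (b := K ^ (1 / 2 : ℝ)) h
      (Or.inr (ENNReal.rpow_ne_top_of_nonneg (by norm_num) hKt))
    rw [zero_mul] at h'
    exact h'
  · filter_upwards [hMf] with i hi
    refine (lintegral_pow_le_sqrt_mul_sqrt (hD i) n).trans ?_
    gcongr
    calc ∫⁻ ω, ((f i ω - g ω) + (g ω - f i ω)) ^ (2 * n + 1) ∂P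
        ≤ ∫⁻ ω, 2 ^ (2 * n) * (f i ω ^ (2 * n + 1) + g ω ^ (2 * n + 1)) ∂P := by
          refine lintegral_mono fun ω => ?_
          have h := ENNReal.rpow_add_le_mul_rpow_add_rpow (f i ω) (g ω)
            (p := ((2 * n + 1 : ℕ) : ℝ)) (by exact_mod_cast Nat.le_add_left 1 _)
          have h2 : (((2 * n + 1 : ℕ) : ℝ) - 1) = ((2 * n : ℕ) : ℝ) := by push_cast; ring
          rw [h2] at h
          simp only [ENNReal.rpow_natCast] at h
          refine le_trans ?_ h
          gcongr <;> exact tsub_le_self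
      _ = 2 ^ (2 * n) * (∫⁻ ω, f i ω ^ (2 * n + 1) ∂P + ∫⁻ ω, g ω ^ (2 * n + 1) ∂P) := by
          rw [lintegral_const_mul _ (by fun_prop), lintegral_add_left (by fun_prop)]
      _ ≤ K := by rw [hK]; gcongr

lemma eLpNorm_natCast_eq {g : Ω → ℝ} (n : ℕ) :
    eLpNorm g ((n + 1 : ℕ) : ℝ≥0∞) P =
      (∫⁻ ω, ‖g ω‖ₑ ^ (n + 1) ∂P) ^ (1 / ((n + 1 : ℕ) : ℝ)) := by
  rw [eLpNorm_eq_lintegral_rpow_enorm_toReal (by simp) (by simp)]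
  simp only [ENNReal.toReal_natCast, ENNReal.rpow_natCast]

lemma memLp_toReal_of_lintegral_pow_ne_top [IsProbabilityMeasure P] {f : Ω → ℝ≥0∞}
    (hf : Measurable f) (hM : ∀ n : ℕ, ∫⁻ ω, f ω ^ n ∂P ≠ ∞) {p : ℝ≥0∞} (hp : p ≠ ∞) :
    MemLp (fun ω => (f ω).toReal) p P := by
  have hm : AEStronglyMeasurable (fun ω => (f ω).toReal) P :=
    hf.ennreal_toReal.aestronglyMeasurable
  obtain ⟨n, hn⟩ := ENNReal.exists_nat_gt hp
  have hpn : p ≤ ((n + 1 : ℕ) : ℝ≥0∞) := hn.le.trans (by exact_mod_cast n.le_succ)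
  refine MemLp.mono_exponent (q := ((n + 1 : ℕ) : ℝ≥0∞)) ⟨hm, ?_⟩ hpn
  rw [eLpNorm_natCast_eq]
  refine ENNReal.rpow_lt_top_of_nonneg (by positivity)
    (((lintegral_mono fun ω => ?_).trans_lt (hM (n + 1)).lt_top).ne)
  gcongr
  rw [Real.enorm_eq_ofReal ENNReal.toReal_nonneg]
  exact ENNReal.ofReal_toReal_le

lemma convergesInAllLp_of_tendsto [IsProbabilityMeasure P] {X : ℝ → Ω → ℝ}
    {f : ℝ → Ω → ℝ≥0∞} (hf : ∀ ε, Measurable (f ε))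
    (hX : ∀ ε, 0 < ε → X ε =ᵐ[P] fun ω => (f ε ω).toReal)
    (hlim : Tendsto (fun ε => ∫⁻ ω, ((f ε ω - f 0 ω) + (f 0 ω - f ε ω)) ∂P) (𝓝[>] 0) (𝓝 0))
    (hM : ∀ n : ℕ, ∃ M : ℝ≥0∞, M ≠ ∞ ∧ ∀ ε, 0 ≤ ε → ∫⁻ ω, f ε ω ^ n ∂P ≤ M) :
    ConvergesInAllLp P X := by
  have hMf (ε : ℝ) (hε : 0 ≤ ε) (n : ℕ) : ∫⁻ ω, f ε ω ^ n ∂P ≠ ∞ := by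
    obtain ⟨M, hMt, hM⟩ := hM n
    exact ne_top_of_le_ne_top hMt (hM ε hε)
  have hfin (ε : ℝ) (hε : 0 ≤ ε) : ∀ᵐ ω ∂P, f ε ω < ∞ :=
    ae_lt_top (hf ε) (by simpa using hMf ε hε 1)
  have hmem (ε : ℝ) (hε : 0 ≤ ε) {p : ℝ≥0∞} (hp : p ≠ ∞) :
      MemLp (fun ω => (f ε ω).toReal) p P :=
    memLp_toReal_of_lintegral_pow_ne_top (hf ε) (hMf ε hε) hp
  refine ⟨fun ω => (f 0 ω).toReal, fun p _ hp => ⟨fun ε hε => ?_, hmem 0 le_rfl hp, ?_⟩⟩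
  · exact (memLp_congr_ae (hX ε hε)).2 (hmem ε hε.le hp)
  · obtain ⟨n, hn⟩ := ENNReal.exists_nat_gt hp
    have hpn : p ≤ ((n + 1 : ℕ) : ℝ≥0∞) := hn.le.trans (by exact_mod_cast n.le_succ)
    have hpow := tendsto_lintegral_sub_pow hf (hf 0) hlim (fun m => by
      obtain ⟨M, hMt, hM⟩ := hM m
      exact ⟨M, hMt, hM 0 le_rfl, by
        filter_upwards [self_mem_nhdsWithin] with ε hε using hM ε (le_of_lt hε)⟩) n
    have hroot : Tendsto (fun ε => (∫⁻ ω, ((f ε ω - f 0 ω) + (f 0 ω - f ε ω)) ^ (n + 1) ∂P) ^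
        (1 / ((n + 1 : ℕ) : ℝ))) (𝓝[>] 0) (𝓝 0) := by
      have h := (ENNReal.continuous_rpow_const (y := 1 / ((n + 1 : ℕ) : ℝ))).tendsto 0
        |>.comp hpow
      rwa [ENNReal.zero_rpow_of_pos (by positivity)] at h
    refine tendsto_of_tendsto_of_tendsto_of_le_of_le' tendsto_const_nhds hroot
      (Eventually.of_forall fun _ => zero_le) ?_
    filter_upwards [self_mem_nhdsWithin] with ε hε
    have hε' : 0 < ε := hε
    have hae : (fun ω => X ε ω - (f 0 ω).toReal) =ᵐ[P]
        fun ω => (f ε ω).toReal - (f 0 ω).toReal := by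
      filter_upwards [hX ε hε'] with ω hω
      rw [hω]
    rw [eLpNorm_congr_ae hae]
    refine (eLpNorm_le_eLpNorm_of_exponent_le hpn
      ((hf ε).ennreal_toReal.sub (hf 0).ennreal_toReal).aestronglyMeasurable).trans ?_
    rw [eLpNorm_natCast_eq]
    refine ENNReal.rpow_le_rpow (lintegral_mono_ae ?_) (by positivity)
    filter_upwards [hfin ε hε'.le, hfin 0 le_rfl] with ω h1 h2
    gcongr
    exact enorm_toReal_sub_toReal_le h1.ne h2.ne

end General

variable {Ω : Type*} [MeasurableSpace Ω] {P : Measure Ω} {d : ℕ} {ν : Measure ℝ}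
  {W W' : ℝ≥0 → Ω → EuclideanSpace ℝ (Fin d)} {H γ t : ℝ} {η : ℝ → ℝ → ℝ}

lemma tendsto_heatENN {v : ℝ} (hv : 0 < v) (x : EuclideanSpace ℝ (Fin d)) :
    Tendsto (fun ε => heatENN d (v + ε) x) (𝓝[>] 0) (𝓝 (heatENN d v x)) := by
  refine tendsto_nhdsWithin_of_tendsto_nhds ?_
  refine (ENNReal.continuous_ofReal.tendsto _).comp ?_
  have h : ContinuousAt (fun ε => heatDensity d (v + ε) x) 0 := by
    unfold heatDensity
    refine ContinuousAt.mul (ContinuousAt.rpow_const (by fun_prop) (Or.inl ?_))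
      (Real.continuous_exp.continuousAt.comp (ContinuousAt.div₀ (by fun_prop) (by fun_prop) ?_))
    · rw [add_zero]; positivity
    · rw [add_zero]; positivity
  simpa [ContinuousAt] using h

lemma mixture_zero_mul_le_liminf (hν : ∀ᵐ w ∂ν, 0 < w) (x : EuclideanSpace ℝ (Fin d))
    {c : ℝ≥0∞} (hc : c ≠ ∞) :
    mixture d ν 0 x * c ≤ liminf (fun ε => mixture d ν ε x * c) (𝓝[>] 0) := by
  have h (ε : ℝ) : mixture d ν ε x * c = ∫⁻ w, heatENN d (2 * w + ε) x * c ∂ν := by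
    rw [lintegral_mul_const _ (by fun_prop), mixture]
  simp_rw [h]
  refine le_trans (lintegral_mono_ae ?_) (lintegral_liminf_le fun ε => by fun_prop)
  filter_upwards [hν] with w hw
  have := ENNReal.Tendsto.mul_const (tendsto_heatENN (d := d) (v := 2 * w) (by positivity) x)
    (b := c) (Or.inr hc)
  rw [this.liminf_eq, add_zero]

/-- The law of `W_r - W'_s` is the centred Gaussian of variance `r + s`. -/
lemma lintegral_mixture_path [IsProbabilityMeasure P] [SFinite ν] (hW : IsHeatMarkov P d W)
    (hW' : IsHeatMarkov P d W')
    (hind : IndepFun (fun ω (t : ℝ≥0) => W t ω) (fun ω (t : ℝ≥0) => W' t ω) P)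
    (hν : ∀ᵐ w ∂ν, 0 < w) {ε : ℝ} (hε : 0 ≤ ε) (r s : ℝ≥0) :
    ∫⁻ ω, mixture d ν ε (W r ω - W' s ω) ∂P = mixture d ν (ε + r + s) 0 := by
  have hone {V : ℝ≥0 → Ω → EuclideanSpace ℝ (Fin d)} (hV : IsHeatMarkov P d V) {ε : ℝ}
      (hε : 0 ≤ ε) (u : ℝ≥0) (y : EuclideanSpace ℝ (Fin d)) :
      ∫⁻ ω, mixture d ν ε (V u ω - y) ∂P = mixture d ν (ε + u) y := by
    have h := hV.markov_mixture hν hε (m := 0) Fin.elim0 (s := 0) (u := u) (fun k => k.elim0)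
      zero_le (G := fun _ => 1) measurable_const y
    simp only [one_mul, NNReal.coe_zero, sub_zero] at h
    rw [h]
    have h0 : ∀ᵐ ω ∂P, mixture d ν (ε + u) (V 0 ω - y) = mixture d ν (ε + u) y := by
      filter_upwards [hV.zero] with ω hω
      rw [hω, zero_sub, mixture_neg]
    rw [lintegral_congr_ae h0]
    simp
  have hindr : IndepFun (W r) (W' s) P :=
    hind.comp (φ := fun (w : ℝ≥0 → EuclideanSpace ℝ (Fin d)) => w r)
      (ψ := fun (w : ℝ≥0 → EuclideanSpace ℝ (Fin d)) => w s) (by fun_prop) (by fun_prop)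
  rw [lintegral_indepFun (hW.measurable_eval r) (hW'.measurable_eval s) hindr
    (F := fun x x' => mixture d ν ε (x - x')) (by fun_prop)]
  simp_rw [mixture_sub_comm ε (W r _), hone hW' hε s]
  have h := hone hW (ε := ε + s) (by positivity) r 0
  simp only [sub_zero] at h
  rw [h]
  congr 1; ring

/-- The expectation of the local time decreases with the mollification. -/
lemma lintegral_mixtureLocalTime_anti [IsProbabilityMeasure P] [SFinite ν]
    (hW : IsHeatMarkov P d W) (hW' : IsHeatMarkov P d W')
    (hind : IndepFun (fun ω (t : ℝ≥0) => W t ω) (fun ω (t : ℝ≥0) => W' t ω) P)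
    (hν : ∀ᵐ w ∂ν, 0 < w) (hη : IsWeight H γ t η) {ε : ℝ} (hε : 0 ≤ ε) :
    ∫⁻ ω, mixtureLocalTime d ν η W W' t ε ω ∂P ≤
      ∫⁻ ω, mixtureLocalTime d ν η W W' t 0 ω ∂P := by
  have h (ε : ℝ) (hε : 0 ≤ ε) : ∫⁻ ω, mixtureLocalTime d ν η W W' t ε ω ∂P =
      ∫⁻ q, mixture d ν (ε + q.1.toNNReal + q.2.toNNReal) 0 * ENNReal.ofReal (η q.1 q.2)
        ∂((volume.restrict (Icc 0 t)).prod (volume.restrict (Icc 0 t))) := by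
    unfold mixtureLocalTime
    rw [lintegral_lintegral_swap ((measurable_mixture_path hW hW' ε).mul
      (hη.measurable.comp measurable_snd).ennreal_ofReal).aemeasurable]
    refine lintegral_congr fun q => ?_
    have hm : Measurable fun ω => mixture d ν ε (W q.1.toNNReal ω - W' q.2.toNNReal ω) :=
      measurable_mixture measurable_const ((hW.measurable_eval _).sub (hW'.measurable_eval _))
    rw [lintegral_mul_const _ hm,
      lintegral_mixture_path hW hW' hind hν hε]
  rw [h ε hε, h 0 le_rfl]
  refine lintegral_mono fun q => ?_
  gcongr
  exact mixture_zero_anti hν (by positivity) (by gcongr)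

lemma mixtureLocalTime_zero_le_liminf [SFinite ν] (hW : IsHeatMarkov P d W)
    (hW' : IsHeatMarkov P d W') (hν : ∀ᵐ w ∂ν, 0 < w) (hη : IsWeight H γ t η) (ω : Ω) :
    mixtureLocalTime d ν η W W' t 0 ω ≤
      liminf (fun ε => mixtureLocalTime d ν η W W' t ε ω) (𝓝[>] 0) := by
  refine le_trans (lintegral_mono fun q => mixture_zero_mul_le_liminf hν _ ENNReal.ofReal_ne_top)
    (lintegral_liminf_le fun ε => ?_)
  have h := ((measurable_mixture_path (ν := ν) hW hW' ε).comp (measurable_prodMk_left (x := ω))).mul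
    hη.measurable.ennreal_ofReal
  exact h

lemma tendsto_mixtureLocalTime [IsProbabilityMeasure P] [SFinite ν]
    (hW : IsHeatMarkov P d W) (hW' : IsHeatMarkov P d W')
    (hind : IndepFun (fun ω (t : ℝ≥0) => W t ω) (fun ω (t : ℝ≥0) => W' t ω) P)
    (hν : ∀ᵐ w ∂ν, 0 < w) (hη : IsWeight H γ t η)
    (hfin : ∫⁻ ω, mixtureLocalTime d ν η W W' t 0 ω ∂P ≠ ∞) :
    Tendsto (fun ε => ∫⁻ ω,
      ((mixtureLocalTime d ν η W W' t ε ω - mixtureLocalTime d ν η W W' t 0 ω) +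
        (mixtureLocalTime d ν η W W' t 0 ω - mixtureLocalTime d ν η W W' t ε ω)) ∂P)
      (𝓝[>] 0) (𝓝 0) := by
  refine tendsto_lintegral_of_le_liminf (fun ε => measurable_mixtureLocalTime hW hW' hη ε)
    (measurable_mixtureLocalTime hW hW' hη 0) hfin ?_
    (mixtureLocalTime_zero_le_liminf hW hW' hν hη)
  filter_upwards [self_mem_nhdsWithin] with ε hε
  exact lintegral_mixtureLocalTime_anti hW hW' hind hν hη (le_of_lt hε)

end

section

/-! ### The approximate local time as a mixture local time -/

variable {Ω : Type*} [MeasurableSpace Ω] {P : Measure Ω} {d : ℕ} {ν : Measure ℝ}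
  {f : EuclideanSpace ℝ (Fin d) → ℝ}
  {W W' B₁ B₂ : ℝ≥0 → Ω → EuclideanSpace ℝ (Fin d)} {H γ t : ℝ} {η : ℝ → ℝ → ℝ}

lemma IsIndepBrownianPair.exists_version [IsProbabilityMeasure P]
    (hB : IsIndepBrownianPair P d B₁ B₂) :
    ∃ W W' : ℝ≥0 → Ω → EuclideanSpace ℝ (Fin d), IsHeatMarkov P d W ∧ IsHeatMarkov P d W' ∧
      IndepFun (fun ω (t : ℝ≥0) => W t ω) (fun ω (t : ℝ≥0) => W' t ω) P ∧
      ∀ᵐ ω ∂P, ∀ t, B₁ t ω = W t ω ∧ B₂ t ω = W' t ω := by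
  obtain ⟨W, hW, hWB⟩ := hB.left.exists_measurable_version
  obtain ⟨W', hW', hWB'⟩ := hB.right.exists_measurable_version
  refine ⟨W, W', hB.left.isHeatMarkov_of_version hW hWB,
    hB.right.isHeatMarkov_of_version hW' hWB', hB.indep.congr ?_ ?_, ?_⟩
  · filter_upwards [hWB] with ω h using funext fun t => (h t).symm
  · filter_upwards [hWB'] with ω h using funext fun t => (h t).symm
  · filter_upwards [hWB, hWB'] with ω h h' t using ⟨(h t).symm, (h' t).symm⟩

lemma measurable_integrand (hf : Measurable f) (hW : IsHeatMarkov P d W)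
    (hW' : IsHeatMarkov P d W') (hη : IsWeight H γ t η) (ε : ℝ) (ω : Ω) :
    Measurable fun q : (ℝ × ℝ) × EuclideanSpace ℝ (Fin d) =>
      integrand d f η W W' ε ω q.1.1 q.1.2 q.2 := by
  have h1 : Measurable fun q : (ℝ × ℝ) × EuclideanSpace ℝ (Fin d) => W q.1.1.toNNReal ω :=
    hW.measurable_comp (by fun_prop) (by fun_prop)
  have h2 : Measurable fun q : (ℝ × ℝ) × EuclideanSpace ℝ (Fin d) => W' q.1.2.toNNReal ω :=
    hW'.measurable_comp (by fun_prop) (by fun_prop)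
  have h3 : Measurable fun q : (ℝ × ℝ) × EuclideanSpace ℝ (Fin d) => η q.1.1 q.1.2 :=
    hη.measurable.comp measurable_fst
  exact (h3.mul (measurable_heatDensity measurable_const ((h1.sub h2).sub measurable_snd))).mul
    (hf.comp measurable_snd)

omit [MeasurableSpace Ω] in
lemma integrand_nonneg_ae (hf : ∀ x, 0 ≤ f x) (hη : IsWeight H γ t η) {ε : ℝ} (hε : 0 < ε)
    (ω : Ω) :
    ∀ᵐ q ∂((((volume : Measure ℝ).restrict (Icc 0 t)).prod
        ((volume : Measure ℝ).restrict (Icc 0 t))).prod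
          (volume : Measure (EuclideanSpace ℝ (Fin d)))),
      0 ≤ integrand d f η W W' ε ω q.1.1 q.1.2 q.2 := by
  rw [Measure.prod_restrict]
  have h : ∀ᵐ q ∂(((volume : Measure ℝ).prod (volume : Measure ℝ)).restrict
      (Icc 0 t ×ˢ Icc 0 t)), q ∈ Icc 0 t ×ˢ Icc 0 t :=
    ae_restrict_mem (measurableSet_Icc.prod measurableSet_Icc)
  filter_upwards [Measure.quasiMeasurePreserving_fst.ae h] with q hq
  exact mul_nonneg (mul_nonneg (hη.nonneg _ hq.1 _ hq.2) (heatDensity_nonneg hε.le _)) (hf _)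

lemma lintegral_integrand (hf : IsGaussianMixture d f ν) (hd : 0 < d) (hW : IsHeatMarkov P d W)
    (hW' : IsHeatMarkov P d W') (hη : IsWeight H γ t η) {ε : ℝ} (hε : 0 < ε) (ω : Ω) :
    ∫⁻ q, ENNReal.ofReal (integrand d f η W W' ε ω q.1.1 q.1.2 q.2)
      ∂((((volume : Measure ℝ).restrict (Icc 0 t)).prod
        ((volume : Measure ℝ).restrict (Icc 0 t))).prod
          (volume : Measure (EuclideanSpace ℝ (Fin d)))) =
      mixtureLocalTime d ν η W W' t ε ω := by
  have hfm := hf.measurable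
  rw [lintegral_prod _
    (measurable_integrand hf.measurable hW hW' hη ε ω).ennreal_ofReal.aemeasurable,
    mixtureLocalTime]
  refine lintegral_congr_ae ?_
  have h : ∀ᵐ q ∂(((volume : Measure ℝ).prod (volume : Measure ℝ)).restrict
      (Icc 0 t ×ˢ Icc 0 t)), q ∈ Icc 0 t ×ˢ Icc 0 t :=
    ae_restrict_mem (measurableSet_Icc.prod measurableSet_Icc)
  rw [← Measure.prod_restrict] at h
  filter_upwards [h] with q hq
  have hq' := hη.nonneg _ hq.1 _ hq.2
  have h1 (y : EuclideanSpace ℝ (Fin d)) :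
      ENNReal.ofReal (integrand d f η W W' ε ω q.1 q.2 y) =
      heatENN d ε (W q.1.toNNReal ω - W' q.2.toNNReal ω - y) * ENNReal.ofReal (f y) *
        ENNReal.ofReal (η q.1 q.2) := by
    rw [integrand, mul_assoc, ENNReal.ofReal_mul hq', mul_comm,
      ENNReal.ofReal_mul (heatDensity_nonneg hε.le _), heatENN]
  have h2 := hf.lintegral_heatENN_mul hd hε (W q.1.toNNReal ω - W' q.2.toNNReal ω) 0
  simp only [sub_zero] at h2
  simp_rw [h1]
  rw [lintegral_mul_const _ (by fun_prop), h2]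

lemma integrable_integrand (hf : IsGaussianMixture d f ν) (hd : 0 < d) (hW : IsHeatMarkov P d W)
    (hW' : IsHeatMarkov P d W') (hη : IsWeight H γ t η) {ε : ℝ} (hε : 0 < ε) {ω : Ω}
    (hfin : mixtureLocalTime d ν η W W' t ε ω ≠ ∞) :
    Integrable (fun q : (ℝ × ℝ) × EuclideanSpace ℝ (Fin d) =>
      integrand d f η W W' ε ω q.1.1 q.1.2 q.2)
      ((((volume : Measure ℝ).restrict (Icc 0 t)).prod
        ((volume : Measure ℝ).restrict (Icc 0 t))).prod volume) := by
  refine ⟨(measurable_integrand hf.measurable hW hW' hη ε ω).aestronglyMeasurable, ?_⟩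
  rw [hasFiniteIntegral_iff_ofReal (integrand_nonneg_ae hf.nonneg hη hε ω),
    lintegral_integrand hf hd hW hW' hη hε]
  exact hfin.lt_top

lemma approxLocalTime_eq_toReal (hf : IsGaussianMixture d f ν) (hd : 0 < d)
    (hW : IsHeatMarkov P d W) (hW' : IsHeatMarkov P d W') (hη : IsWeight H γ t η) (ht : 0 < t)
    {ε : ℝ} (hε : 0 < ε) {ω : Ω} (hfin : mixtureLocalTime d ν η W W' t ε ω ≠ ∞) :
    approxLocalTime d f η W W' t ε ω = (mixtureLocalTime d ν η W W' t ε ω).toReal := by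
  have hint := integrable_integrand hf hd hW hW' hη hε hfin
  have h := integral_eq_lintegral_of_nonneg_ae (integrand_nonneg_ae hf.nonneg hη hε ω)
    hint.aestronglyMeasurable
  rw [lintegral_integrand hf hd hW hW' hη hε] at h
  rw [← h, integral_prod _ hint, integral_prod_symm _ hint.integral_prod_left]
  simp only [approxLocalTime, intervalIntegral.integral_of_le ht.le,
    integral_Icc_eq_integral_Ioc]

lemma approxWellDefined_of_version (hf : IsGaussianMixture d f ν) (hd : 0 < d)
    (hW : IsHeatMarkov P d W) (hW' : IsHeatMarkov P d W') (hη : IsWeight H γ t η)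
    (hWB : ∀ᵐ ω ∂P, ∀ t, B₁ t ω = W t ω ∧ B₂ t ω = W' t ω)
    (hfin : ∀ ε, 0 < ε → ∀ ω, mixtureLocalTime d ν η W W' t ε ω ≠ ∞) :
    ApproxWellDefined P d f η B₁ B₂ t := by
  intro ε hε
  filter_upwards [hWB] with ω hω
  have h := integrable_integrand hf hd hW hW' hη hε (hfin ε hε ω)
  rw [Measure.prod_restrict] at h
  refine h.congr (Eventually.of_forall fun q => ?_)
  simp only [integrand, (hω _).1, (hω _).2]

lemma approxLocalTime_ae_eq (hf : IsGaussianMixture d f ν) (hd : 0 < d)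
    (hW : IsHeatMarkov P d W) (hW' : IsHeatMarkov P d W') (hη : IsWeight H γ t η) (ht : 0 < t)
    (hWB : ∀ᵐ ω ∂P, ∀ t, B₁ t ω = W t ω ∧ B₂ t ω = W' t ω)
    (hfin : ∀ ε, 0 < ε → ∀ ω, mixtureLocalTime d ν η W W' t ε ω ≠ ∞) {ε : ℝ} (hε : 0 < ε) :
    approxLocalTime d f η B₁ B₂ t ε =ᵐ[P]
      fun ω => (mixtureLocalTime d ν η W W' t ε ω).toReal := by
  filter_upwards [hWB] with ω hω
  rw [← approxLocalTime_eq_toReal hf hd hW hW' hη ht hε (hfin ε hε ω)]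
  simp only [approxLocalTime, integrand, (hω _).1, (hω _).2]

lemma mixture_zero_ne_top {A : ℝ≥0∞} {κ : ℝ} (hAt : A ≠ ∞)
    (hA : ∀ τ : ℝ, 0 ≤ τ → mixture d ν (2 * τ) 0 ≤ A * ENNReal.ofReal τ ^ (-κ)) {ε : ℝ}
    (hε : 0 < ε) : mixture d ν ε 0 ≠ ∞ := by
  have h := hA (ε / 2) (by positivity)
  rw [mul_div_cancel₀ _ two_ne_zero, ENNReal.ofReal_rpow_of_pos (by positivity)] at h
  exact ne_top_of_le_ne_top (ENNReal.mul_ne_top hAt ENNReal.ofReal_ne_top) h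

omit [MeasurableSpace Ω] in
lemma mixtureLocalTime_ne_top (hν : ∀ᵐ w ∂ν, 0 < w) (hη : IsWeight H γ t η) (hγ : 0 < γ)
    (hH : 1 / 2 < H) (ht : 0 < t) {ε : ℝ} (hε : 0 ≤ ε) (hfin : mixture d ν ε 0 ≠ ∞) (ω : Ω) :
    mixtureLocalTime d ν η W W' t ε ω ≠ ∞ :=
  ne_top_of_le_ne_top (ENNReal.mul_ne_top hfin ENNReal.ofReal_ne_top)
    (mixtureLocalTime_le hν hη hγ hH ht hε ω)

/-- The convergence statements common to all kernels: the kernel is only required to be a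
Gaussian mixture whose values `f_ε(0)` have a singularity of order `ε^{-κ}`, `κ < 2H`, as
`ε ↓ 0`. -/
lemma IsIndepBrownianPair.exists_mixtureLocalTime [IsProbabilityMeasure P]
    (hB : IsIndepBrownianPair P d B₁ B₂) (hf : IsGaussianMixture d f ν) (hd : 0 < d)
    {A : ℝ≥0∞} {κ : ℝ} (hAt : A ≠ ∞)
    (hA : ∀ τ : ℝ, 0 ≤ τ → mixture d ν (2 * τ) 0 ≤ A * ENNReal.ofReal τ ^ (-κ))
    (hH : 1 / 2 < H) (hH1 : H < 1) (hκ : κ * (1 / (2 * H)) < 1)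
    (hη : IsWeight H γ t η) (hγ : 0 < γ) (ht : 0 < t) :
    ApproxWellDefined P d f η B₁ B₂ t ∧
      ConvergesInAllLp P (approxLocalTime d f η B₁ B₂ t) ∧
      ∃ W W' : ℝ≥0 → Ω → EuclideanSpace ℝ (Fin d), IsHeatMarkov P d W ∧ IsHeatMarkov P d W' ∧
        IndepFun (fun ω (t : ℝ≥0) => W t ω) (fun ω (t : ℝ≥0) => W' t ω) P ∧
        ∀ ε, 0 < ε → approxLocalTime d f η B₁ B₂ t ε =ᵐ[P]
          fun ω => (mixtureLocalTime d ν η W W' t ε ω).toReal := by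
  have := hf.sigmaFinite
  obtain ⟨W, W', hW, hW', hind, hWB⟩ := hB.exists_version
  obtain ⟨β, hβ⟩ := exists_isTimeConst hH hH1
  have hfin (ε : ℝ) (hε : 0 < ε) (ω : Ω) : mixtureLocalTime d ν η W W' t ε ω ≠ ∞ :=
    mixtureLocalTime_ne_top hf.pos hη hγ hH ht hε.le (mixture_zero_ne_top hAt hA hε) ω
  have heq (ε : ℝ) (hε : 0 < ε) :=
    approxLocalTime_ae_eq hf hd hW hW' hη ht hWB hfin hε
  have hmom (n : ℕ) : ∃ M : ℝ≥0∞, M ≠ ∞ ∧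
      ∀ ε, 0 ≤ ε → ∫⁻ ω, mixtureLocalTime d ν η W W' t ε ω ^ n ∂P ≤ M := by
    refine ⟨_, ?_, fun ε hε => lintegral_mixtureLocalTime_pow_le hW hW' hind hf.pos hA hH hH1 hκ
      hβ hη hγ ht hε n⟩
    refine ENNReal.mul_ne_top (ENNReal.pow_ne_top ENNReal.ofReal_ne_top)
      (ENNReal.rpow_ne_top_of_nonneg (by linarith) (ENNReal.mul_ne_top (by simp)
        (ENNReal.mul_ne_top (ENNReal.pow_ne_top ?_) ENNReal.ofReal_ne_top)))
    exact ENNReal.rpow_ne_top_of_nonneg (by positivity) hAt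
  refine ⟨approxWellDefined_of_version hf hd hW hW' hη hWB hfin, ?_, W, W', hW, hW', hind, heq⟩
  refine convergesInAllLp_of_tendsto (fun ε => measurable_mixtureLocalTime hW hW' hη ε) heq
    (tendsto_mixtureLocalTime hW hW' hind hf.pos hη ?_) hmom
  obtain ⟨M, hMt, hM⟩ := hmom 1
  simpa using ne_top_of_le_ne_top hMt (hM 0 le_rfl)

end

section

/-! ### Exponential moments -/

lemma ofReal_exp_toReal_le {l : ℝ} (hl : 0 ≤ l) (x : ℝ≥0∞) :
    ENNReal.ofReal (Real.exp (l * x.toReal)) ≤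
      ∑' n : ℕ, ENNReal.ofReal (l ^ n / n.factorial) * x ^ n := by
  -- at `x = ∞` the left side is `exp 0`, the term `n = 0` of the series
  rcases eq_or_ne x ∞ with rfl | hx
  · refine le_trans ?_ (ENNReal.le_tsum 0)
    simp
  · have h := NormedSpace.expSeries_div_hasSum_exp (l * x.toReal)
    rw [← Real.exp_eq_exp_ℝ] at h
    rw [← h.tsum_eq, ENNReal.ofReal_tsum_of_nonneg (fun n => by positivity) h.summable]
    refine ENNReal.tsum_le_tsum fun n => ?_
    rw [mul_pow, mul_div_right_comm, ENNReal.ofReal_mul (by positivity),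
      ENNReal.ofReal_pow ENNReal.toReal_nonneg, ENNReal.ofReal_toReal hx]

section Series

variable {Ω : Type*} [MeasurableSpace Ω] {P : Measure Ω}

lemma lintegral_exp_le_seriesPhi {X : Ω → ℝ≥0∞} (hX : Measurable X) {l G κ : ℝ} (hl : 0 ≤ l)
    (hmom : ∀ n : ℕ, ∫⁻ ω, X ω ^ n ∂P ≤ ENNReal.ofReal (G ^ n * (n.factorial : ℝ) ^ κ)) :
    ∫⁻ ω, ENNReal.ofReal (Real.exp (l * (X ω).toReal)) ∂P ≤ seriesPhi (l * G) (1 - κ) := by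
  calc ∫⁻ ω, ENNReal.ofReal (Real.exp (l * (X ω).toReal)) ∂P
      ≤ ∫⁻ ω, ∑' n : ℕ, ENNReal.ofReal (l ^ n / n.factorial) * X ω ^ n ∂P :=
        lintegral_mono fun ω => ofReal_exp_toReal_le hl _
    _ = ∑' n : ℕ, ENNReal.ofReal (l ^ n / n.factorial) * ∫⁻ ω, X ω ^ n ∂P := by
        rw [lintegral_tsum fun n => by fun_prop]
        refine tsum_congr fun n => ?_
        rw [lintegral_const_mul _ (by fun_prop)]
    _ ≤ seriesPhi (l * G) (1 - κ) := by
        refine ENNReal.tsum_le_tsum fun n => ?_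
        refine (mul_le_mul_right (hmom n) _).trans ?_
        rw [← ENNReal.ofReal_mul (by positivity)]
        have hn : (0 : ℝ) < n.factorial := by exact_mod_cast n.factorial_pos
        rw [Real.rpow_sub hn, Real.rpow_one, mul_pow]
        refine (congrArg ENNReal.ofReal ?_).le
        have : (n.factorial : ℝ) ^ κ ≠ 0 := (Real.rpow_pos_of_pos hn _).ne'
        field_simp

end Series

lemma seriesPhi_lt_top_of_pos {x a : ℝ} (hx : 0 < x) (ha : 0 < a) : seriesPhi x a < ∞ := by
  refine (Summable.tsum_ofReal_ne_top ?_).lt_top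
  refine summable_of_ratio_test_tendsto_lt_one (l := 0) one_pos
    (Eventually.of_forall fun n => by positivity) ?_
  have h : Tendsto (fun n : ℕ => x / ((n : ℝ) + 1) ^ a) atTop (𝓝 0) :=
    ((tendsto_rpow_atTop ha).comp
      (tendsto_atTop_add_const_right _ 1 tendsto_natCast_atTop_atTop)).const_div_atTop x
  refine h.congr fun n => ?_
  rw [Real.norm_of_nonneg (by positivity), Real.norm_of_nonneg (by positivity),
    Nat.factorial_succ, Nat.cast_mul, Real.mul_rpow (by positivity) (by positivity), pow_succ]
  push_cast
  have h1 : ((n : ℝ) + 1) ^ a ≠ 0 := by positivity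
  have h2 : (n.factorial : ℝ) ^ a ≠ 0 := by positivity
  field_simp

lemma seriesPhi_zero_lt_top {x : ℝ} (hx : 0 ≤ x) (hx1 : x < 1) : seriesPhi x 0 < ∞ := by
  refine (Summable.tsum_ofReal_ne_top ?_).lt_top
  simpa using summable_geometric_of_lt_one hx hx1

lemma growthConst_pos {d : ℕ} {α H γ D β t : ℝ} (hH : 1 / 2 < H) (hD : 0 < D) (hγ : 0 < γ)
    (hβ : 0 < β) (ht : 0 < t) (hb : 0 < 1 - ((d : ℝ) - α) / (4 * H)) :
    0 < growthConst d α H γ D β t := by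
  have h1 := alphaH_pos hH
  have h2 := Real.Gamma_pos_of_pos hb
  unfold growthConst
  positivity

lemma mul_growthConst_lt_one {d : ℕ} {α H γ D β t l : ℝ} (hH : 1 / 2 < H) (hD : 0 < D)
    (hγ : 0 < γ) (hβ : 0 < β) (ht : 0 < t) (hd : (d : ℝ) = 2 + α)
    (hl : ENNReal.ofReal l < lambdaZero d α H γ D β t) : l * growthConst d α H γ D β t < 1 := by
  have hα := alphaH_pos hH
  have h2H : 1 / (2 * H) < 1 := by rw [div_lt_one (by linarith)]; linarith
  have hb : 0 < 1 - 1 / (2 * H) := by linarith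
  have hΓ := Real.Gamma_pos_of_pos hb
  have hdα : (d : ℝ) - α = 2 := by linarith
  have hb' : 1 - ((d : ℝ) - α) / (4 * H) = 1 - 1 / (2 * H) := by
    rw [hdα]; congr 1; field_simp; norm_num
  have hG := growthConst_pos (d := d) (α := α) hH hD hγ hβ ht (by rw [hb']; exact hb)
  rw [lambdaZero, if_pos hd] at hl
  set Λ : ℝ := (1 - 1 / (2 * H)) ^ (2 * H - 1) * D⁻¹ * 2 * alphaH H * γ⁻¹ * β ^ (-2 : ℝ)
    * Real.Gamma (1 - 1 / (2 * H)) ^ (-(2 * H)) * t ^ (1 - 2 * H) with hΛ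
  have hl' : l < Λ := (ENNReal.ofReal_lt_ofReal_iff'.1 hl).1
  have hone : Λ * growthConst d α H γ D β t = 1 := by
    rw [hΛ, growthConst, hb', hdα, div_self two_ne_zero, Real.rpow_neg hb.le, Real.rpow_neg hβ.le,
      Real.rpow_neg hΓ.le, Real.rpow_neg two_pos.le, show 1 - 2 * H = -(2 * H - 1) by ring,
      Real.rpow_neg ht.le, Real.rpow_one, Real.rpow_two]
    have h1 : (1 - 1 / (2 * H)) ^ (2 * H - 1) ≠ 0 := (Real.rpow_pos_of_pos hb _).ne'
    have h2 : Real.Gamma (1 - 1 / (2 * H)) ^ (2 * H) ≠ 0 := (Real.rpow_pos_of_pos hΓ _).ne'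
    have h3 : t ^ (2 * H - 1) ≠ 0 := (Real.rpow_pos_of_pos ht _).ne'
    generalize (1 - 1 / (2 * H)) ^ (2 * H - 1) = x at *
    generalize Real.Gamma (1 - 1 / (2 * H)) ^ (2 * H) = y at *
    generalize t ^ (2 * H - 1) = z at *
    have h4 := hα.ne'
    have h5 := hγ.ne'
    have h6 := hβ.ne'
    have h7 := hD.ne'
    field_simp
  calc l * growthConst d α H γ D β t < Λ * growthConst d α H γ D β t := by gcongr
    _ = 1 := hone

/-- Log-convexity of the Gamma function, in the form of `factorial_rpow_mul_le_Gamma`, turns the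
Dirichlet integrals into powers of the factorial. -/
lemma moment_bound_le {c A κ H t : ℝ} (hc : 0 ≤ c) (hA : 0 < A) (hH : 0 < H) (ht : 0 < t)
    (hb : 0 < 1 - κ * (1 / (2 * H))) (hb1 : 1 - κ * (1 / (2 * H)) < 1) (n : ℕ) :
    c ^ n * (n.factorial * ((A ^ (1 / (2 * H))) ^ n *
        (Real.Gamma (1 - κ * (1 / (2 * H))) ^ n * t ^ (n * (1 - κ * (1 / (2 * H)))) /
          Real.Gamma (n * (1 - κ * (1 / (2 * H))) + 1)))) ^ (2 * H) ≤
      (A * c * Real.Gamma (1 - κ * (1 / (2 * H))) ^ (2 * H) *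
        (1 - κ * (1 / (2 * H))) ^ (-(2 * H - κ)) * t ^ (2 * H - κ)) ^ n *
        (n.factorial : ℝ) ^ κ := by
  have hn : (0 : ℝ) < n.factorial := by exact_mod_cast n.factorial_pos
  have h2H : 2 * H - κ = (1 - κ * (1 / (2 * H))) * (2 * H) := by field_simp
  have hκ : κ = (1 - (1 - κ * (1 / (2 * H)))) * (2 * H) := by field_simp; ring
  rw [h2H]
  nth_rewrite 8 [hκ]
  generalize 1 - κ * (1 / (2 * H)) = b at *
  have hΓ := Real.Gamma_pos_of_pos hb
  have hΓn : 0 < Real.Gamma (n * b + 1) := Real.Gamma_pos_of_pos (by positivity)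
  have hfac := factorial_rpow_mul_le_Gamma hb hb1 n
  have hpow (x : ℝ) (hx : 0 < x) : x ^ (n * b) = (x ^ b) ^ n := by
    rw [mul_comm, Real.rpow_mul hx.le, Real.rpow_natCast]
  rw [hpow b hb] at hfac
  rw [hpow t ht]
  have hin : (n.factorial : ℝ) * ((A ^ (1 / (2 * H))) ^ n * (Real.Gamma b ^ n * (t ^ b) ^ n /
      Real.Gamma (n * b + 1))) ≤
      (n.factorial : ℝ) ^ (1 - b) * (A ^ (1 / (2 * H)) * Real.Gamma b * t ^ b * (b ^ b)⁻¹) ^ n := by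
    have h1 : (n.factorial : ℝ) = (n.factorial : ℝ) ^ (1 - b) * (n.factorial : ℝ) ^ b := by
      rw [← Real.rpow_add hn]; simp
    have h2 : (n.factorial : ℝ) ^ b / Real.Gamma (n * b + 1) ≤ ((b ^ b)⁻¹) ^ n := by
      rw [inv_pow, div_le_iff₀ hΓn, ← div_eq_inv_mul, le_div_iff₀ (by positivity)]
      exact hfac
    calc _ = (n.factorial : ℝ) ^ (1 - b) * ((A ^ (1 / (2 * H))) ^ n * Real.Gamma b ^ n *
          (t ^ b) ^ n) * ((n.factorial : ℝ) ^ b / Real.Gamma (n * b + 1)) := by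
          nth_rewrite 1 [h1]; ring
      _ ≤ (n.factorial : ℝ) ^ (1 - b) * ((A ^ (1 / (2 * H))) ^ n * Real.Gamma b ^ n *
          (t ^ b) ^ n) * ((b ^ b)⁻¹) ^ n := by gcongr
      _ = _ := by ring
  calc _ ≤ c ^ n * ((n.factorial : ℝ) ^ (1 - b) *
        (A ^ (1 / (2 * H)) * Real.Gamma b * t ^ b * (b ^ b)⁻¹) ^ n) ^ (2 * H) := by
        gcongr
    _ = _ := by
        have hX : 0 < A ^ (1 / (2 * H)) * Real.Gamma b * t ^ b * (b ^ b)⁻¹ := by positivity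
        have hXpow : (A ^ (1 / (2 * H)) * Real.Gamma b * t ^ b * (b ^ b)⁻¹) ^ (2 * H) =
            A * Real.Gamma b ^ (2 * H) * t ^ (b * (2 * H)) * b ^ (-(b * (2 * H))) := by
          rw [Real.mul_rpow (by positivity) (by positivity),
            Real.mul_rpow (by positivity) (by positivity),
            Real.mul_rpow (by positivity) (by positivity), ← Real.rpow_mul hA.le,
            one_div_mul_cancel (by positivity), Real.rpow_one, ← Real.rpow_mul ht.le,
            ← Real.rpow_neg hb.le, ← Real.rpow_mul hb.le, neg_mul]
        have hXn {x : ℝ} (hx : 0 < x) : (x ^ n) ^ (2 * H) = (x ^ (2 * H)) ^ n := by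
          rw [← Real.rpow_natCast, ← Real.rpow_mul hx.le, mul_comm, Real.rpow_mul hx.le,
            Real.rpow_natCast]
        rw [Real.mul_rpow (by positivity) (by positivity), ← Real.rpow_mul hn.le, hXn hX, hXpow]
        ring

section Kernels

variable {Ω : Type*} [MeasurableSpace Ω] {P : Measure Ω} {d : ℕ} {ν : Measure ℝ}
  {f : EuclideanSpace ℝ (Fin d) → ℝ}
  {W W' B₁ B₂ : ℝ≥0 → Ω → EuclideanSpace ℝ (Fin d)} {α H γ t : ℝ} {η : ℝ → ℝ → ℝ}

lemma IsRoughKernelConst.mixture_le {D : ℝ} (hD : IsRoughKernelConst d α f D)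
    (hf : IsGaussianMixture d f ν) (hd : 0 < d) {τ : ℝ} (hτ : 0 ≤ τ) (hαd : α < d) :
    mixture d ν (2 * τ) 0 ≤ ENNReal.ofReal (D * 2 ^ (-(((d : ℝ) - α) / 2))) *
      ENNReal.ofReal τ ^ (-(((d : ℝ) - α) / 2)) := by
  have hD0 := hD.1
  -- at `τ = 0` the right side is `∞`
  rcases hτ.eq_or_lt with rfl | hτ
  · have hneg : -(((d : ℝ) - α) / 2) < 0 := by linarith
    rw [ENNReal.ofReal_zero, ENNReal.zero_rpow_of_neg hneg, ENNReal.mul_top]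
    · exact le_top
    · simp only [ne_eq, ENNReal.ofReal_eq_zero, not_le]; positivity
  · have h := hD.2 τ τ hτ hτ 0 0
    rw [hf.kernelEnergy_eq hd hτ hτ, sub_zero, ← two_mul,
      Real.mul_rpow two_pos.le hτ.le, ← mul_assoc] at h
    rwa [ENNReal.ofReal_rpow_of_pos hτ, ← ENNReal.ofReal_mul (by positivity)]

lemma lintegral_mixtureLocalTime_pow_le_growthConst [IsProbabilityMeasure P]
    (hf : IsGaussianMixture d f ν) (hd : 0 < d)
    (hW : IsHeatMarkov P d W) (hW' : IsHeatMarkov P d W')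
    (hind : IndepFun (fun ω (t : ℝ≥0) => W t ω) (fun ω (t : ℝ≥0) => W' t ω) P)
    (hαd : α < d) (hdα : (d : ℝ) ≤ 2 + α) (hH : 1 / 2 < H) (hH1 : H < 1) {D β : ℝ}
    (hD : IsRoughKernelConst d α f D) (hβ : IsTimeConst H β) (hη : IsWeight H γ t η)
    (hγ : 0 < γ) (ht : 0 < t) {ε : ℝ} (hε : 0 ≤ ε) (n : ℕ) :
    ∫⁻ ω, mixtureLocalTime d ν η W W' t ε ω ^ n ∂P ≤
      ENNReal.ofReal (growthConst d α H γ D β t ^ n *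
        (n.factorial : ℝ) ^ (((d : ℝ) - α) / 2)) := by
  have := hf.sigmaFinite
  have hα := alphaH_pos hH
  have hD0 := hD.1
  set κ : ℝ := ((d : ℝ) - α) / 2 with hκ
  have hκ0 : 0 < κ := by rw [hκ]; linarith
  have hθ1 : 1 / (2 * H) < 1 := by rw [div_lt_one (by linarith)]; linarith
  have hθ0 : 0 < 1 / (2 * H) := by positivity
  have hκθ0 : 0 < κ * (1 / (2 * H)) := by positivity
  have hκθ : κ * (1 / (2 * H)) < 1 := by
    -- this is where `d ≤ 2 + α` enters
    have : κ ≤ 1 := by rw [hκ]; linarith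
    nlinarith
  set A : ℝ := D * 2 ^ (-κ) with hA
  have hA0 : 0 < A := by positivity
  refine (lintegral_mixtureLocalTime_pow_le hW hW' hind hf.pos
    (fun τ hτ => hD.mixture_le hf hd hτ hαd) hH hH1 hκθ hβ hη hγ ht hε n).trans ?_
  have hb : 0 < 1 - κ * (1 / (2 * H)) := by linarith
  have hΓ := Real.Gamma_pos_of_pos hb
  have hΓn : 0 < Real.Gamma (n * (1 - κ * (1 / (2 * H))) + 1) :=
    Real.Gamma_pos_of_pos (by positivity)
  have hn : (n.factorial : ℝ≥0∞) = ENNReal.ofReal n.factorial := by simp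
  rw [← hκ, ← hA, hn, ENNReal.ofReal_rpow_of_pos hA0, ← ENNReal.ofReal_pow (by positivity),
    ← ENNReal.ofReal_pow (by positivity),
    ← ENNReal.ofReal_mul (by positivity), ← ENNReal.ofReal_mul (by positivity),
    ENNReal.ofReal_rpow_of_nonneg (by positivity) (by positivity),
    ← ENNReal.ofReal_mul (by positivity)]
  refine ENNReal.ofReal_le_ofReal ((moment_bound_le (by positivity) hA0 (by linarith) ht hb
    (by linarith) n).trans_eq ?_)
  have h4 : ((d : ℝ) - α) / (4 * H) = κ * (1 / (2 * H)) := by rw [hκ]; field_simp; norm_num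
  rw [growthConst, h4, ← hκ, ← hA]
  congr 2
  ring

lemma isRoughKernelConst_of_mixture_le (hf : IsGaussianMixture d f ν) (hd : 0 < d) {D : ℝ}
    (hD : 0 < D) (hle : ∀ τ : ℝ, 0 < τ →
      mixture d ν τ 0 ≤ ENNReal.ofReal (D * τ ^ (-(((d : ℝ) - α) / 2)))) :
    IsRoughKernelConst d α f D :=
  ⟨hD, fun u v hu hv y z => by
    rw [hf.kernelEnergy_eq hd hu hv]
    exact (mixture_le_zero hf.pos (by positivity) _).trans (hle _ (by positivity))⟩

lemma IsSmoothKernelConst.mixture_le {K : ℝ} (hK : IsSmoothKernelConst d f K)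
    (hf : IsGaussianMixture d f ν) (hd : 0 < d) {ε : ℝ} (hε : 0 < ε) :
    mixture d ν ε 0 ≤ ENNReal.ofReal K := by
  have h := hK.2 (ε / 2) (ε / 2) (by positivity) (by positivity) 0 0
  rwa [hf.kernelEnergy_eq hd (by positivity) (by positivity), sub_zero, add_halves] at h

lemma isSmoothKernelConst_of_mixture_le (hf : IsGaussianMixture d f ν) (hd : 0 < d) {K : ℝ}
    (hK : 0 < K) (hle : mixture d ν 0 0 ≤ ENNReal.ofReal K) : IsSmoothKernelConst d f K :=
  ⟨hK, fun u v hu hv y z => by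
    rw [hf.kernelEnergy_eq hd hu hv]
    exact (mixture_le_zero hf.pos (by positivity) _).trans
      ((mixture_zero_anti hf.pos le_rfl (by positivity)).trans hle)⟩

end Kernels

section Main

variable {Ω : Type*} [MeasurableSpace Ω] {P : Measure Ω} [IsProbabilityMeasure P] {d : ℕ}
  {f : EuclideanSpace ℝ (Fin d) → ℝ} {B₁ B₂ : ℝ≥0 → Ω → EuclideanSpace ℝ (Fin d)}
  {α H γ t : ℝ} {η : ℝ → ℝ → ℝ}

lemma approxLocalTime_of_isRieszOrBessel (hd : 0 < d) (hα : 0 < α) (hH : 1 / 2 < H) (hH1 : H < 1)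
    (hαd : α < d) (hdα : (d : ℝ) ≤ 2 + α) (hf : IsRieszOrBessel d α f)
    (hB : IsIndepBrownianPair P d B₁ B₂) (ht : 0 < t) (hγ : 0 < γ) (hη : IsWeight H γ t η) :
    ApproxWellDefined P d f η B₁ B₂ t ∧
      ConvergesInAllLp P (approxLocalTime d f η B₁ B₂ t) ∧
      ∀ D β : ℝ, IsRoughKernelConst d α f D → IsTimeConst H β → ∀ l : ℝ, 0 < l →
        supExpMoment P (approxLocalTime d f η B₁ B₂ t) l ≤
          seriesPhi (l * growthConst d α H γ D β t) (1 - ((d : ℝ) - α) / 2) := by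
  obtain ⟨ν, hν, D₀, hD₀, hle⟩ := hf.exists_mixture hα hαd
  have := hν.sigmaFinite
  have hD₀' := isRoughKernelConst_of_mixture_le (α := α) hν hd hD₀ hle
  have hκθ : ((d : ℝ) - α) / 2 * (1 / (2 * H)) < 1 := by
    have hθ1 : 1 / (2 * H) < 1 := by rw [div_lt_one (by linarith)]; linarith
    have hθ0 : 0 < 1 / (2 * H) := by positivity
    nlinarith
  obtain ⟨hwell, hconv, W, W', hW, hW', hind, heq⟩ := hB.exists_mixtureLocalTime hν hd
    ENNReal.ofReal_ne_top (fun τ hτ => hD₀'.mixture_le hν hd hτ hαd) hH hH1 hκθ hη hγ ht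
  refine ⟨hwell, hconv, fun D β hD hβ l hl => iSup₂_le fun ε hε => ?_⟩
  have hae : (fun ω => ENNReal.ofReal (Real.exp (l * approxLocalTime d f η B₁ B₂ t ε ω))) =ᵐ[P]
      fun ω => ENNReal.ofReal (Real.exp (l * (mixtureLocalTime d ν η W W' t ε ω).toReal)) := by
    filter_upwards [heq ε hε] with ω hω
    rw [hω]
  rw [lintegral_congr_ae hae]
  exact lintegral_exp_le_seriesPhi (measurable_mixtureLocalTime hW hW' hη ε) hl.le fun n =>
    lintegral_mixtureLocalTime_pow_le_growthConst hν hd hW hW' hind hαd hdα hH hH1 hD hβ hη hγ ht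
      hε.le n

lemma seriesPhi_growthConst_lt_top {D β l : ℝ} (hH : 1 / 2 < H) (hdα : (d : ℝ) ≤ 2 + α)
    (hγ : 0 < γ) (ht : 0 < t) (hD : 0 < D) (hβ : 0 < β) (hl : 0 < l)
    (hlt : ENNReal.ofReal l < lambdaZero d α H γ D β t) :
    seriesPhi (l * growthConst d α H γ D β t) (1 - ((d : ℝ) - α) / 2) < ∞ := by
  have hb : 0 < 1 - ((d : ℝ) - α) / (4 * H) := by
    rw [sub_pos, div_lt_one (by linarith)]; linarith
  have hG := growthConst_pos (d := d) (α := α) hH hD hγ hβ ht hb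
  rcases hdα.eq_or_lt with h | h
  · have h0 : 1 - ((d : ℝ) - α) / 2 = 0 := by rw [h]; ring
    rw [h0]
    exact seriesPhi_zero_lt_top (by positivity)
      (mul_growthConst_lt_one hH hD hγ hβ ht h hlt)
  · exact seriesPhi_lt_top_of_pos (by positivity) (by linarith)

lemma approxLocalTime_of_isHeatOrPoisson (hd : 0 < d) (hα : 0 < α) (hH : 1 / 2 < H) (hH1 : H < 1)
    (hf : IsHeatOrPoisson d α f) (hB : IsIndepBrownianPair P d B₁ B₂) (ht : 0 < t) (hγ : 0 < γ)
    (hη : IsWeight H γ t η) :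
    ApproxWellDefined P d f η B₁ B₂ t ∧
      ConvergesInAllLp P (approxLocalTime d f η B₁ B₂ t) ∧
      ∀ K : ℝ, IsSmoothKernelConst d f K → ∀ l : ℝ, 0 < l →
        supExpMoment P (approxLocalTime d f η B₁ B₂ t) l ≤
          ENNReal.ofReal (Real.exp (l * (K * γ * t ^ (2 * H) / alphaH H))) := by
  obtain ⟨ν, hν, K₀, hK₀, hle⟩ := hf.exists_mixture hα
  -- the mixture is bounded, so that the singularity has order `κ = 0`
  have hA (τ : ℝ) (hτ : 0 ≤ τ) :
      mixture d ν (2 * τ) 0 ≤ ENNReal.ofReal K₀ * ENNReal.ofReal τ ^ (-0 : ℝ) := by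
    rw [neg_zero, ENNReal.rpow_zero, mul_one]
    exact (mixture_zero_anti hν.pos le_rfl (by positivity)).trans hle
  obtain ⟨hwell, hconv, W, W', hW, hW', hind, heq⟩ := hB.exists_mixtureLocalTime hν hd
    ENNReal.ofReal_ne_top hA hH hH1 (by norm_num) hη hγ ht
  refine ⟨hwell, hconv, fun K hK l hl => iSup₂_le fun ε hε => ?_⟩
  have hαH := alphaH_pos hH
  have hK0 := hK.1
  calc ∫⁻ ω, ENNReal.ofReal (Real.exp (l * approxLocalTime d f η B₁ B₂ t ε ω)) ∂P
      ≤ ∫⁻ _, ENNReal.ofReal (Real.exp (l * (K * γ * t ^ (2 * H) / alphaH H))) ∂P := by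
        refine lintegral_mono_ae ?_
        filter_upwards [heq ε hε] with ω hω
        rw [hω]
        gcongr
        refine ENNReal.toReal_le_of_le_ofReal (by positivity) ?_
        refine (mixtureLocalTime_le hν.pos hη hγ hH ht hε.le ω).trans ?_
        refine (mul_le_mul_left (hK.mixture_le hν hd hε) _).trans_eq ?_
        rw [← ENNReal.ofReal_mul hK0.le]
        congr 1; ring
    _ = _ := by simp

end Main

end

end ConvolutedLocalTime

end

theorem proposition4 (d : ℕ) (hd : 0 < d) (α : ℝ) (hα : 0 < α) (H : ℝ) (hH : 1 / 2 < H)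
    (hH1 : H < 1) :
    -- the constant `β_H` exists
    (∃ β : ℝ, ConvolutedLocalTime.IsTimeConst H β) ∧
    -- (i) Riesz and Bessel kernels
    (α < (d : ℝ) → (d : ℝ) ≤ 2 + α →
      ∃ C : ℝ, 0 < C ∧
        ∀ f : EuclideanSpace ℝ (Fin d) → ℝ, ConvolutedLocalTime.IsRieszOrBessel d α f →
          (∃ D : ℝ, ConvolutedLocalTime.IsRoughKernelConst d α f D) ∧
          ∀ (Ω : Type*) [MeasurableSpace Ω] (P : Measure Ω) [IsProbabilityMeasure P]
            (B₁ B₂ : ℝ≥0 → Ω → EuclideanSpace ℝ (Fin d)),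
            ConvolutedLocalTime.IsIndepBrownianPair P d B₁ B₂ →
            ∀ (t γ : ℝ) (η : ℝ → ℝ → ℝ), 0 < t → 0 < γ →
              ConvolutedLocalTime.IsWeight H γ t η →
              ConvolutedLocalTime.ApproxWellDefined P d f η B₁ B₂ t ∧
              ConvolutedLocalTime.ConvergesInAllLp P
                (ConvolutedLocalTime.approxLocalTime d f η B₁ B₂ t) ∧
              ∀ D β : ℝ, ConvolutedLocalTime.IsRoughKernelConst d α f D →
                ConvolutedLocalTime.IsTimeConst H β →
                ∀ l : ℝ, 0 < l →
                  ConvolutedLocalTime.supExpMoment P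
                      (ConvolutedLocalTime.approxLocalTime d f η B₁ B₂ t) l
                    ≤ ENNReal.ofReal C * ConvolutedLocalTime.seriesPhi
                        (l * ConvolutedLocalTime.growthConst d α H γ D β t)
                        (1 - ((d : ℝ) - α) / 2) ∧
                  (ENNReal.ofReal l < ConvolutedLocalTime.lambdaZero d α H γ D β t →
                    ConvolutedLocalTime.seriesPhi
                        (l * ConvolutedLocalTime.growthConst d α H γ D β t)
                        (1 - ((d : ℝ) - α) / 2) < ⊤)) ∧
    -- (ii) heat and Poisson kernels
    (∀ f : EuclideanSpace ℝ (Fin d) → ℝ, ConvolutedLocalTime.IsHeatOrPoisson d α f →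
      (∃ K : ℝ, ConvolutedLocalTime.IsSmoothKernelConst d f K) ∧
      ∀ (Ω : Type*) [MeasurableSpace Ω] (P : Measure Ω) [IsProbabilityMeasure P]
        (B₁ B₂ : ℝ≥0 → Ω → EuclideanSpace ℝ (Fin d)),
        ConvolutedLocalTime.IsIndepBrownianPair P d B₁ B₂ →
        ∀ (t γ : ℝ) (η : ℝ → ℝ → ℝ), 0 < t → 0 < γ →
          ConvolutedLocalTime.IsWeight H γ t η →
          ConvolutedLocalTime.ApproxWellDefined P d f η B₁ B₂ t ∧
          ConvolutedLocalTime.ConvergesInAllLp P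
            (ConvolutedLocalTime.approxLocalTime d f η B₁ B₂ t) ∧
          ∀ K : ℝ, ConvolutedLocalTime.IsSmoothKernelConst d f K →
            ∀ l : ℝ, 0 < l →
              ConvolutedLocalTime.supExpMoment P
                  (ConvolutedLocalTime.approxLocalTime d f η B₁ B₂ t) l
                ≤ ENNReal.ofReal (Real.exp
                    (l * (K * γ * t ^ (2 * H) / ConvolutedLocalTime.alphaH H)))) := by
  refine ⟨ConvolutedLocalTime.exists_isTimeConst hH hH1, fun hαd hdα => ⟨1, one_pos, fun f hf =>
    ⟨?_, fun Ω _ P _ B₁ B₂ hB t γ η ht hγ hη => ?_⟩⟩, fun f hf =>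
    ⟨?_, fun Ω _ P _ B₁ B₂ hB t γ η ht hγ hη =>
      ConvolutedLocalTime.approxLocalTime_of_isHeatOrPoisson hd hα hH hH1 hf hB ht hγ hη⟩⟩
  · obtain ⟨ν, hν, D, hD, hle⟩ := hf.exists_mixture hα hαd
    exact ⟨D, ConvolutedLocalTime.isRoughKernelConst_of_mixture_le hν hd hD hle⟩
  · obtain ⟨hwell, hconv, hexp⟩ := ConvolutedLocalTime.approxLocalTime_of_isRieszOrBessel
      hd hα hH hH1 hαd hdα hf hB ht hγ hη
    refine ⟨hwell, hconv, fun D β hD hβ l hl => ⟨?_, fun hlt =>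
      ConvolutedLocalTime.seriesPhi_growthConst_lt_top hH hdα hγ ht hD.1 hβ.1 hl hlt⟩⟩
    rw [ENNReal.ofReal_one, one_mul]
    exact hexp D β hD hβ l hl
  · obtain ⟨ν, hν, K, hK, hle⟩ := hf.exists_mixture hα
    exact ⟨K, ConvolutedLocalTime.isSmoothKernelConst_of_mixture_le hν hd hK hle⟩
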